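/- Let $b>0$ be real and $\beta=b^2$. Let $\psi_r,\psi^*_r$ ($r\in\mathbb Z+\tfrac12$) be the free fermion modes, $\{\psi_r,\psi^*_s\}=\delta_{r+s,0}$, all other anticommutators being zero, acting on the fermionic Fock space over $\mathbb C$ with vacuum $|vac\rangle$, where $\psi_r|vac\rangle=\psi_r^*|vac\rangle=0$ for $r>0$; let $:\ :$ denote normal ordering and $\tilde a_n=\sum_{r}:\psi_{n-r}\psi^*_r:$. The Calogero–Sutherland (CS) Hamiltonian is $$H=H_0+(1-b^2)\Big(\sum_{n>0}n\,\tilde a_{-n}\tilde a_n-\sum_{n,m>0}\tilde a_{-n}\tilde a_{-m}\tilde a_{n+m}\Big),\qquad H_0=\sum_{n,m>0}(\tilde a_{-n}\tilde a_{-m}\tilde a_{n+m}+\tilde a_{-n-m}\tilde a_n\tilde a_m).$$ Put $H_0^\beta=H_0+(1-b^2)H_d$, where (all indices being half-integers) $$H_d=\sum_{k>0}\Big(\tfrac13(k-\tfrac12)\psi_{-k}\psi^*_k+(k-\tfrac12)(k+\tfrac16)\psi^*_{-k}\psi_k\Big)+\sum_{k+l>0}\tfrac23(2k+l):\psi_{-l}\psi^*_{-k}\psi_k\psi^*_l:\,,$$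 $$H_t=\sum_{\substack{r+s+k+l=0\\ k+l>0,\ k+s<0,\ k>r}}2(k-r):\psi_r\psi_s^*\psi_k\psi_l^*:\,.$$ For a partition $\lambda$ of $n$ with conjugate $\lambda^t$ and $d(\lambda)$ diagonal boxes put $n_i=\lambda_i-i+\tfrac12$, $m_i=\lambda^t_i-i+\tfrac12$, $$|s_\lambda\rangle=(-1)^{\sum_{i\le d(\lambda)}(m_i-1/2)}\prod_{i=1}^{d(\lambda)}\psi_{-n_i}\psi^*_{-m_i}|vac\rangle,\qquad E_\lambda^1=\sum_{i=1}^{d(\lambda)}(n_i^2-m_i^2),\qquad E_\lambda^\beta=E_\lambda^1+(1-b^2)\sum_{i=1}^{\lambda_1}(\lambda_i^t)^2 .$$ Let $<$ be the strict dominance order on the partitions of $n$, and let $V_{<\lambda}$, $V_{\le\lambda}$ be the spans of the $|s_\mu\rangle$ with $\mu<\lambda$, respectively $\mu\le\lambda$. Then for every partition $\lambda$ of $n$: 1. $|s_\lambda\rangle$ is an eigenvector of $H_0$ with eigenvalue $E^1_\lambda$ and of $H_0^\beta$ with eigenvalue $E_\lambda^\beta$. 2. $H_t$ maps $V_{\le\lambda}$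 into $V_{<\lambda}$, $E_\lambda^\beta-H_0^\beta$ restricts to a bijection of $V_{<\lambda}$, and the operator $1-(1-b^2)(E_\lambda^\beta-H_0^\beta)^{-1}H_t$ on $V_{\le\lambda}$ is invertible, with inverse $R(E)$, say. 3. The vector $$|P_\lambda\rangle=R(E)|s_\lambda\rangle=\frac{1}{1-\frac{1-b^2}{E_\lambda^\beta-H_0^\beta}H_t}\,|s_\lambda\rangle$$ has the triangular form $|P_\lambda\rangle=|s_\lambda\rangle+\sum_{\mu<\lambda}c_{\lambda\mu}|s_\mu\rangle$ and is an eigenvector of $H$ with eigenvalue $E_\lambda^\beta$; it is the only vector in $|s_\lambda\rangle+V_{<\lambda}$ with $H|P_\lambda\rangle=E_\lambda^\beta|P_\lambda\rangle$. 4. There is a polynomial $f$ with $|P_\lambda\rangle=f(\tilde a_{-1},\tilde a_{-2},\dots)|vac\rangle$ such that, with the similarity transformation $D=\exp(-\log b\sum_{n>0}\tilde a_{-n}\tilde a_n/n)$, the state $Df$ in the Fock space of bosonic oscillators $[a_n,a_m]=n\delta_{n+m,0}$ is an eigenvector, with eigenvalue $E_\lambda^\beta$, of $$\sum_{n,m>0}b\,(a_{-n}a_{-m}a_{n+m}+a_{-n-m}a_na_m)+(1-b^2)\sum_{n>0}n\,a_{-n}a_n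 ,$$ and for every $N\ge0$ its $N$-particle wave function $P_\lambda(z_1,\dots,z_N)$, obtained by substituting $b\sum_iz_i^k$ for $a_{-k}$, is the monic Jack polynomial of $\lambda$ for the coupling $\beta$ (Jack parameter $1/\beta$), that is, it is $m_\lambda$ plus a linear combination of monomial symmetric polynomials $m_\mu$ with $\mu<\lambda$ and an eigenfunction of $$\sum_i(z_i\partial_{z_i})^2+\beta\sum_{i<j}\frac{z_i+z_j}{z_i-z_j}(z_i\partial_{z_i}-z_j\partial_{z_j}),$$ the eigenvalue being $E_\lambda^\beta+b^2Nn$; moreover $P_\lambda(z)=s_\lambda(z)+\sum_{\mu<\lambda}c_{\lambda\mu}s_\mu(z)$ with Schur polynomials $s_\mu(z_1,\dots,z_N)$ and the same coefficients $c_{\lambda\mu}$. -/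

import Mathlib

open MvPolynomial

noncomputable section

namespace CalogeroSutherland

/-! ### Partitions -/

/-- The part `λ_{i+1}` of a partition (parts in decreasing order, counted from `i = 0`, and `0`
beyond the last part). -/
def row {n : ℕ} (lam : n.Partition) (i : ℕ) : ℕ :=
  (lam.parts.sort (· ≥ ·)).getD i 0

/-- The part `λᵗ_{i+1}` of the conjugate partition: the number of parts of `λ` exceeding `i`. -/
def col {n : ℕ} (lam : n.Partition) (i : ℕ) : ℕ :=
  lam.parts.countP (i < ·)

/-- The number `d(λ)` of boxes on the main diagonal of the Young diagram of `λ`. -/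
def durfee {n : ℕ} (lam : n.Partition) : ℕ :=
  ((Finset.range n).filter fun i => i < row lam i).card

/-- `μ < λ` in the dominance order. -/
def DominanceLT {n : ℕ} (mu lam : n.Partition) : Prop :=
  mu ≠ lam ∧ ∀ j, ∑ i ∈ Finset.range j, row mu i ≤ ∑ i ∈ Finset.range j, row lam i

open Classical in
/-- The finite set of all partitions `μ < λ`. -/
def lower {n : ℕ} (lam : n.Partition) : Finset n.Partition :=
  Finset.univ.filter fun mu => DominanceLT mu lam

/-- The free-fermion energy
`E_λ^1 = ∑_{i=1}^{d(λ)} ((λ_i - i + 1/2)² - (λᵗ_i - i + 1/2)²)` (here `i` starts from `0`). -/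
def freeEnergy {n : ℕ} (lam : n.Partition) : ℂ :=
  ∑ i ∈ Finset.range (durfee lam),
    (((row lam i : ℂ) - i - 1 / 2) ^ 2 - ((col lam i : ℂ) - i - 1 / 2) ^ 2)

/-- `E_λ^β = E_λ^1 + (1 - b²) ∑_{i=1}^{λ_1} (λᵗ_i)²`, where `β = b²`. -/
def energy (b : ℝ) {n : ℕ} (lam : n.Partition) : ℂ :=
  freeEnergy lam + (1 - (b : ℂ) ^ 2) * ∑ i ∈ Finset.range (row lam 0), (col lam i : ℂ) ^ 2

/-! ### Locally finite sums of operators -/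

/-- The sum of a family of operators which is locally finite with respect to a basis: on each basis
vector only finitely many operators of the family are nonzero.  All families below have this
property. -/
def locSum {κ M ι : Type*} [AddCommGroup M] [Module ℂ M] (B : Module.Basis κ ℂ M)
    (T : ι → Module.End ℂ M) : Module.End ℂ M :=
  B.constr ℂ fun k => ∑ᶠ i, T i (B k)

/-! ### The fermionic Fock space

The half-integer `k + 1/2` is represented by the integer `k`; thus `k + 1/2 > 0` iff `0 ≤ k`, and
`-(k + 1/2)` is represented by `-k - 1`.  The modes `ψ_r` and `ψ*_r` with `r < 0` create, those with
`r > 0` annihilate the vacuum.  The creation operators are numbered by the integers: `j < 0` stands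
for `ψ_{j + 1/2}`, and `0 ≤ j` stands for `ψ*_{-(j + 1/2)}`.  A basis vector of the Fock space is
given by the finite set of those creation operators that have been applied to the vacuum, in
increasing order from left to right. -/

/-- The fermionic Fock space (all charges). -/
def Fock : Type := Finset ℤ →₀ ℂ

instance : AddCommGroup Fock := inferInstanceAs (AddCommGroup (Finset ℤ →₀ ℂ))

instance : Module ℂ Fock := inferInstanceAs (Module ℂ (Finset ℤ →₀ ℂ))

/-- The basis of occupation-number states. -/
def fockBasis : Module.Basis (Finset ℤ) ℂ Fock := .ofRepr (LinearEquiv.refl ℂ (Finset ℤ →₀ ℂ))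

/-- The vacuum. -/
def vac : Fock := fockBasis ∅

/-- The creation operator number `j`. -/
def create (j : ℤ) : Module.End ℂ Fock :=
  fockBasis.constr ℂ fun S =>
    if j ∈ S then 0 else ((-1 : ℂ) ^ (S.filter (· < j)).card) • fockBasis (insert j S)

/-- The annihilation operator number `j`. -/
def annihilate (j : ℤ) : Module.End ℂ Fock :=
  fockBasis.constr ℂ fun S =>
    if j ∈ S then ((-1 : ℂ) ^ (S.filter (· < j)).card) • fockBasis (S.erase j) else 0

/-- A fermionic mode: `psi k` is `ψ_{k + 1/2}` and `psiStar k` is `ψ*_{k + 1/2}`. -/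
inductive Mode
  | psi (k : ℤ)
  | psiStar (k : ℤ)

/-- The integer `k` that represents the index `k + 1/2` of a mode. -/
def Mode.index : Mode → ℤ
  | .psi k => k
  | .psiStar k => k

/-- The operator of a mode; `{ψ_r, ψ*_s} = δ_{r+s,0}`, all other anticommutators vanish. -/
def Mode.op : Mode → Module.End ℂ Fock
  | .psi k => if k < 0 then create k else annihilate k
  | .psiStar k => if k < 0 then create (-k - 1) else annihilate (-k - 1)

/-- The operator `ψ_{k + 1/2}`. -/
def ψ (k : ℤ) : Module.End ℂ Fock := (Mode.psi k).op

/-- The operator `ψ*_{k + 1/2}`. -/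
def ψs (k : ℤ) : Module.End ℂ Fock := (Mode.psiStar k).op

/-- The normally ordered product of a list of modes: the annihilation operators are moved to the
right of the creation operators, with the sign of the permutation. -/
def normalOrder : List Mode → Module.End ℂ Fock
  | [] => 1
  | a :: L =>
    if a.index < 0 then a.op * normalOrder L
    else ((-1 : ℂ) ^ L.length) • (normalOrder L * a.op)

/-- The half-integer represented by `k`. -/
def half (k : ℤ) : ℂ := (k : ℂ) + 1 / 2

/-- The bosonic oscillator `ã_n = ∑_{r ∈ ℤ + 1/2} :ψ_{n-r} ψ*_r:`. -/
def osc (n : ℤ) : Module.End ℂ Fock :=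
  locSum fockBasis fun k : ℤ => normalOrder [.psi (n - k - 1), .psiStar k]

/-! ### The Hamiltonian -/

/-- `H_0 = ∑_{n,m>0} (ã_{-n} ã_{-m} ã_{n+m} + ã_{-n-m} ã_n ã_m)`. -/
def H0 : Module.End ℂ Fock :=
  locSum fockBasis fun p : ℕ+ × ℕ+ =>
    osc (-p.1) * osc (-p.2) * osc (p.1 + p.2) + osc (-p.1 - p.2) * osc p.1 * osc p.2

/-- `H_int = (1 - b²) (∑_{n>0} n ã_{-n} ã_n - ∑_{n,m>0} ã_{-n} ã_{-m} ã_{n+m})`. -/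
def Hint (b : ℝ) : Module.End ℂ Fock :=
  (1 - (b : ℂ) ^ 2) •
    (locSum fockBasis (fun n : ℕ+ => (n : ℂ) • (osc (-n) * osc n)) -
      locSum fockBasis fun p : ℕ+ × ℕ+ => osc (-p.1) * osc (-p.2) * osc (p.1 + p.2))

/-- The Calogero-Sutherland Hamiltonian `H = H_0 + H_int`. -/
def H (b : ℝ) : Module.End ℂ Fock := H0 + Hint b

/-- `H_d = ∑_{k>0} (1/3 (k - 1/2) ψ_{-k} ψ*_k + (k - 1/2)(k + 1/6) ψ*_{-k} ψ_k)
  + ∑_{k+l>0} 2/3 (2k + l) :ψ_{-l} ψ*_{-k} ψ_k ψ*_l:` (sums over half-integers). -/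
def Hd : Module.End ℂ Fock :=
  locSum fockBasis (fun k : ℕ =>
      (1 / 3 * (half k - 1 / 2)) • (ψ (-k - 1) * ψs k) +
        ((half k - 1 / 2) * (half k + 1 / 6)) • (ψs (-k - 1) * ψ k)) +
    locSum fockBasis fun p : ℤ × ℤ =>
      if 0 < p.1 + p.2 + 1 then
        (2 / 3 * (2 * half p.1 + half p.2)) •
          normalOrder [.psi (-p.2 - 1), .psiStar (-p.1 - 1), .psi p.1, .psiStar p.2]
      else 0

/-- `H_t = ∑ 2 (k - r) :ψ_r ψ*_s ψ_k ψ*_l:`, the sum over the half-integers `r, s, k, l` with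
`r + s + k + l = 0`, `k + l > 0`, `k + s < 0`, `k > r`.  The summation variable is `(s, k, l)`. -/
def Ht : Module.End ℂ Fock :=
  locSum fockBasis fun p : ℤ × ℤ × ℤ =>
    let s := p.1
    let k := p.2.1
    let l := p.2.2
    let r := -s - k - l - 2
    if 0 < k + l + 1 ∧ k + s + 1 < 0 ∧ r < k then
      (2 * (half k - half r)) • normalOrder [.psi r, .psiStar s, .psi k, .psiStar l]
    else 0

/-- `H_0^β = H_0 + (1 - b²) H_d`. -/
def H0β (b : ℝ) : Module.End ℂ Fock := H0 + (1 - (b : ℂ) ^ 2) • Hd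

/-! ### Schur states -/

/-- The Schur state `|s_λ⟩ = (-1)^{∑ (m_i - 1/2)} ∏_{i=1}^{d(λ)} ψ_{-n_i} ψ*_{-m_i} |vac⟩`, where
`n_i = λ_i - i + 1/2` and `m_i = λᵗ_i - i + 1/2`. -/
def schurState {n : ℕ} (lam : n.Partition) : Fock :=
  ((-1 : ℂ) ^ ∑ i ∈ Finset.range (durfee lam), (col lam i - i - 1)) •
    (((List.range (durfee lam)).map fun i : ℕ =>
      ψ ((i : ℤ) - row lam i) * ψs ((i : ℤ) - col lam i)).prod vac)

/-- The span of the Schur states `|s_μ⟩` with `μ < λ`. -/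
def spanLT {n : ℕ} (lam : n.Partition) : Submodule ℂ Fock :=
  Submodule.span ℂ (schurState '' {mu | DominanceLT mu lam})

/-- The span of the Schur states `|s_μ⟩` with `μ ≤ λ`. -/
def spanLE {n : ℕ} (lam : n.Partition) : Submodule ℂ Fock :=
  Submodule.span ℂ (schurState '' {mu | mu = lam ∨ DominanceLT mu lam})

theorem schurState_mem_spanLE {n : ℕ} (lam : n.Partition) : schurState lam ∈ spanLE lam :=
  Submodule.subset_span ⟨lam, Or.inl rfl, rfl⟩

/-- The Schur state as a vector of `spanLE`. -/
def schurVec {n : ℕ} (lam : n.Partition) : spanLE lam :=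
  ⟨schurState lam, schurState_mem_spanLE lam⟩

/-! ### The bosonic Fock space and the similarity transformation -/

/-- Polynomials in the creation oscillators; the variable `X n` stands for the oscillator with
index `-n`. -/
abbrev BosonFock : Type := MvPolynomial ℕ+ ℂ

/-- The basis of monomials in the creation oscillators. -/
def bosonBasis : Module.Basis (ℕ+ →₀ ℕ) ℂ BosonFock := basisMonomials ℕ+ ℂ

/-- The bosonic creation operator with index `-n`, for `n > 0`. -/
def bosonCreate (n : ℕ+) : Module.End ℂ BosonFock := LinearMap.mulLeft ℂ (X n)

/-- The bosonic annihilation operator with index `n > 0`, so that `[a_n, a_{-m}] = n δ_{n,m}`. -/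
def bosonAnnihilate (n : ℕ+) : Module.End ℂ BosonFock := (n : ℂ) • (pderiv n).toLinearMap

/-- The state `f(ã_{-1}, ã_{-2}, …) |vac⟩` in the fermionic Fock space. -/
def bosonize : BosonFock →ₗ[ℂ] Fock :=
  bosonBasis.constr ℂ fun m =>
    ((m.support.sort (· ≤ ·)).map fun n : ℕ+ => osc (-n) ^ m n).prod vac

/-- The operator `∑_{n>0} ã_{-n} ã_n / n`. -/
def oscNumber : Module.End ℂ BosonFock :=
  locSum bosonBasis fun n : ℕ+ => (1 / (n : ℂ)) • (bosonCreate n * bosonAnnihilate n)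

/-- Each monomial is an eigenvector of `∑_{n>0} ã_{-n} ã_n / n`, with its degree as eigenvalue. -/
theorem oscNumber_monomial (m : ℕ+ →₀ ℕ) :
    oscNumber (bosonBasis m) = (m.degree : ℂ) • bosonBasis m := by
  have key : ∀ n : ℕ+, ((1 / (n : ℂ)) • (bosonCreate n * bosonAnnihilate n)) (bosonBasis m)
      = (m n : ℂ) • bosonBasis m := by
    intro n
    have hn : ((n : ℕ) : ℂ) ≠ 0 := Nat.cast_ne_zero.mpr n.pos.ne'
    have h := X_mul_pderiv_monomial (R := ℂ) (i := n) (m := m) (r := 1)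
    simp only [bosonBasis, coe_basisMonomials, bosonCreate, bosonAnnihilate,
      LinearMap.smul_apply, Module.End.mul_apply, LinearMap.mulLeft_apply,
      Derivation.coeFn_coe, mul_smul_comm, smul_smul]
    rw [h, one_div, inv_mul_cancel₀ hn, one_smul, Nat.cast_smul_eq_nsmul]
  rw [oscNumber, locSum, Module.Basis.constr_basis, finsum_congr key,
    finsum_eq_sum_of_support_subset (s := m.support), ← Finset.sum_smul, Finsupp.degree_apply]
  · push_cast
    rfl
  · intro n hn
    simp only [Function.mem_support] at hn
    simp only [Finset.mem_coe, Finsupp.mem_support_iff]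
    rintro h0
    exact hn (by rw [h0]; simp)

/-- The similarity transformation `D = exp(-log b · ∑_{n>0} ã_{-n} ã_n / n)`, given on the common
eigenvectors of its exponent. -/
def similarity (b : ℝ) : Module.End ℂ BosonFock :=
  bosonBasis.constr ℂ fun m =>
    Complex.exp (-(Real.log b : ℂ) * (m.degree : ℂ)) • bosonBasis m

/-- The Calogero-Sutherland Hamiltonian in the undeformed oscillators,
`∑_{n,m>0} b (a_{-n} a_{-m} a_{n+m} + a_{-n-m} a_n a_m) + (1 - b²) ∑_{n>0} n a_{-n} a_n`. -/
def bosonHamiltonian (b : ℝ) : Module.End ℂ BosonFock :=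
  locSum bosonBasis (fun p : ℕ+ × ℕ+ => (b : ℂ) •
      (bosonCreate p.1 * bosonCreate p.2 * bosonAnnihilate (p.1 + p.2) +
        bosonCreate (p.1 + p.2) * bosonAnnihilate p.1 * bosonAnnihilate p.2)) +
    (1 - (b : ℂ) ^ 2) •
      locSum bosonBasis fun n : ℕ+ => (n : ℂ) • (bosonCreate n * bosonAnnihilate n)

/-! ### Wave functions and Jack polynomials -/

/-- The wave function of `N` particles (the factor `Ψ_CS` removed) of the state
`g(a_{-1}, a_{-2}, …)|0⟩`: the oscillator `a_{-n}` becomes `b` times the power sum `∑_i z_i^n`. -/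
def waveFunction (b : ℝ) (N : ℕ) (g : BosonFock) : MvPolynomial (Fin N) ℂ :=
  aeval (fun n : ℕ+ => C (b : ℂ) * psum (Fin N) ℂ n) g

/-- `Q` satisfies the eigenvalue equation with eigenvalue `ε` for the differential operator
`∑_i (z_i ∂_i)² + β ∑_{i<j} (z_i + z_j)/(z_i - z_j) (z_i ∂_i - z_j ∂_j)`. -/
def SatisfiesCS {N : ℕ} (β ε : ℂ) (Q : MvPolynomial (Fin N) ℂ) : Prop :=
  ∀ z : Fin N → ℂ, Function.Injective z →
    (∑ i, eval z (X i * pderiv i (X i * pderiv i Q))) +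
      β * (∑ i, ∑ j ∈ Finset.Ioi i, (z i + z j) / (z i - z j) *
        (z i * eval z (pderiv i Q) - z j * eval z (pderiv j Q))) = ε * eval z Q

/-- `Q` is the monic Jack polynomial `P_λ^{(1/β)}(z_1, …, z_N)`: it is `m_λ` plus a combination of
monomial symmetric polynomials `m_μ` with `μ < λ`, and an eigenfunction of the
Calogero-Sutherland differential operator with coupling `β`. -/
def IsJack {n N : ℕ} (β : ℂ) (lam : n.Partition) (Q : MvPolynomial (Fin N) ℂ) : Prop :=
  (∃ t : n.Partition → ℂ,
    Q = msymm (Fin N) ℂ lam + ∑ mu ∈ lower lam, t mu • msymm (Fin N) ℂ mu) ∧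
  ∃ ε : ℂ, SatisfiesCS β ε Q

/-- The alternant `det (z_i^{ρ_j + N - j})` of a weakly decreasing sequence `ρ`; it is `0` if `ρ` has
more than `N` nonzero terms.  The Schur polynomial `s_μ(z_1, …, z_N)` is the quotient of the
alternants of `μ` and of the zero sequence. -/
def alternant (N : ℕ) (ρ : ℕ → ℕ) : MvPolynomial (Fin N) ℂ :=
  if ρ N = 0 then
    (Matrix.of fun i j : Fin N => (X i : MvPolynomial (Fin N) ℂ) ^ (ρ j + (N - 1 - j))).det
  else 0

end CalogeroSutherland

end

noncomputable section

namespace CalogeroSutherland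

/-! ### Partitions, particle-hole coordinates and the dominance order. -/

section

/-! ### Combinatorics of partitions -/

/-! The proof translates the fermionic statement into one about antisymmetric polynomials in `N`
variables. Picture a charge-zero state as a set of occupied sites of `ℤ` in which only finitely many
sites differ from the vacuum. Emptying the `N` sites `N - 1 - α i` and projecting to the shifted
vacuum gives the numbers `correlator (sites α) v`, which alternate in `α` and are the coefficients
of an antisymmetric polynomial. Under this dictionary `bosonize g` becomes `powerSumEval N g * delta
N`, because an oscillator with index `-k` shifts one site by `k`, just as multiplication by the
power sum lowers one exponent by `k` (`correlator_sites_bosonize`). The Schur state of a partition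
becomes its alternant (`correlator_sites_schurState`). Power products are as numerous as Schur
states, so every charge-zero state of level `n` is the image of a polynomial in the oscillators
(`exists_bosonize_eq`).

On power sums the operator `quadratic + cubicDown` is the Laplacian `∑ (z_i ∂_i)²`, and the two-body
drift is `N` times the degree minus `interaction` (`laplacian_powerSumEval`,
`interactionAt_powerSumEval`). Conjugation with the Vandermonde determinant makes both transparent.
The cubic operator becomes the Laplacian up to a constant, hence is diagonal on monomials
(`powerSumEval_cubic_mul_delta`); this gives the spectrum of `H0`. The interaction becomes a sum
over pairs of an operator that squeezes two exponents towards each other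
(`powerSumEval_interaction_mul_delta`). The three-body terms collapse to a constant by the addition
theorem for cotangents. Read off coefficientwise, the off-diagonal part of the squeezing is exactly
`Ht` (`coeff_squeeze`, `correlator_Ht`). The diagonal part equals the eigenvalue of `Hd`, computed
independently on occupation-number states (`diagonal_constant`, `diagonalValue_stateSet`). Hence `H
= H0β + (1 - b²) Ht` on charge-zero states of a given level (`H_apply`).

What remains is triangular linear algebra. Squeezing lowers a partition strictly in dominance
(`dominanceLT_of_schurCoeff_Ht_ne_zero`). Energies along a dominance chain differ, by Abel summation
(`DominanceLT.energy_ne`). So `E_λ - H0β` is invertible below `λ`, the operator `1 - (1 - b²)(E_λ -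
H0β)⁻¹ Ht` is unitriangular, and its inverse applied to the Schur state solves the eigenvalue
equation, uniquely (`eigen_of_resolvent`, `resolvent_of_eigen`).

For the Jack polynomial, the rescaling by `D` turns the bosonic Hamiltonian into `H`, and the
factors of `b` in the wave function cancel (`bosonHamiltonian_similarity`,
`waveFunction_similarity`). Triangularity in Schur polynomials becomes triangularity in monomial
symmetric polynomials by comparing coefficients in the product with the Vandermonde determinant,
downwards in dominance order (`coeff_rowExponents`). -/

theorem lt_card_filter_range_iff {p : ℕ → Prop} [DecidablePred p] {N : ℕ}
    (hp : ∀ i j, i ≤ j → p j → p i) (hN : ∀ i, p i → i < N) (i : ℕ) :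
    i < ((Finset.range N).filter p).card ↔ p i := by
  constructor
  · intro h
    by_contra hi
    have : (Finset.range N).filter p ⊆ Finset.range i := by
      intro j hj
      simp only [Finset.mem_filter, Finset.mem_range] at hj ⊢
      by_contra hij
      exact hi (hp i j (by omega) hj.2)
    have := Finset.card_le_card this
    simp only [Finset.card_range] at this
    omega
  · intro h
    have : Finset.range (i + 1) ⊆ (Finset.range N).filter p := by
      intro j hj
      simp only [Finset.mem_filter, Finset.mem_range] at hj ⊢
      have := hp j i (by omega) h
      exact ⟨hN j this, this⟩
    have := Finset.card_le_card this
    simp only [Finset.card_range] at this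
    omega

theorem lt_getD_iff_lt_countP (l : List ℕ) (hl : l.Pairwise (· ≥ ·)) (i j : ℕ) :
    j < l.getD i 0 ↔ i < l.countP (j < ·) := by
  induction l generalizing i with
  | nil => simp
  | cons a t ih =>
    rw [List.pairwise_cons] at hl
    by_cases hja : j < a
    · cases i with
      | zero => simp [hja]
      | succ i => simpa [hja] using ih hl.2 i
    · have h0 : t.countP (j < ·) = 0 := by
        rw [List.countP_eq_zero]
        intro x hx
        have := hl.1 x hx
        simp only [decide_eq_true_eq]
        omega
      have := ih hl.2
      cases i with
      | zero => simp [hja, h0]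
      | succ i =>
        have := ih hl.2 i
        simp only [h0] at this
        simp [hja, h0]
        simpa using this

variable {n : ℕ}

/-- Both sides say that the box in row `i` and column `j` lies in the Young diagram. The properties
of `col` below are derived from this equivalence. -/
theorem lt_row_iff (lam : n.Partition) (i j : ℕ) : j < row lam i ↔ i < col lam j := by
  rw [row, lt_getD_iff_lt_countP _ (Multiset.pairwise_sort _ _), col]
  conv_rhs => rw [← Multiset.sort_eq lam.parts (· ≥ ·)]
  rw [Multiset.coe_countP]

theorem row_antitone (lam : n.Partition) : Antitone (row lam) := by
  intro i j hij
  by_contra h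
  push Not at h
  have h1 := (lt_row_iff lam j (row lam i)).1 h
  exact lt_irrefl _ ((lt_row_iff lam i (row lam i)).2 (by omega))

theorem sum_getD_range (l : List ℕ) {N : ℕ} (h : l.length ≤ N) :
    ∑ i ∈ Finset.range N, l.getD i 0 = l.sum := by
  induction l generalizing N with
  | nil => simp
  | cons a t ih =>
    obtain ⟨N, rfl⟩ : ∃ M, N = M + 1 := ⟨N - 1, by simp at h; omega⟩
    rw [Finset.sum_range_succ']
    simp only [List.length_cons, add_le_add_iff_right] at h
    simpa [add_comm] using ih h

theorem card_parts_le (lam : n.Partition) : lam.parts.card ≤ n := by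
  have := Multiset.card_nsmul_le_sum (s := lam.parts) (a := 1) fun x hx => lam.parts_pos hx
  simpa [lam.parts_sum] using this

theorem row_eq_zero (lam : n.Partition) {i : ℕ} (h : n ≤ i) : row lam i = 0 := by
  rw [row, List.getD_eq_default]
  simpa using (card_parts_le lam).trans h

theorem sum_row_of_le (lam : n.Partition) {N : ℕ} (h : n ≤ N) :
    ∑ i ∈ Finset.range N, row lam i = n := by
  have := sum_getD_range (lam.parts.sort (· ≥ ·)) (N := N)
    (by simpa using (card_parts_le lam).trans h)
  have h2 : (lam.parts.sort (· ≥ ·)).sum = n := by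
    conv_rhs => rw [← lam.parts_sum]
    rw [← Multiset.sum_coe, Multiset.sort_eq]
  exact this.trans h2

theorem sum_range_eq_of_row_eq_zero (lam : n.Partition) {N : ℕ} (h : row lam N = 0)
    {A : Type*} [AddCommMonoid A] (f : ℕ → ℕ → A) (hf : ∀ i, f i 0 = 0) :
    ∑ i ∈ Finset.range N, f i (row lam i) = ∑ i ∈ Finset.range n, f i (row lam i) := by
  rcases le_total N n with hN | hN
  · refine Finset.sum_subset (by simpa using hN) fun i _ hi => ?_
    have := row_antitone lam (show N ≤ i by simpa using hi)
    rw [show row lam i = 0 by omega, hf]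
  · refine (Finset.sum_subset (by simpa using hN) fun i _ hi => ?_).symm
    rw [row_eq_zero lam (by simpa using hi), hf]

theorem sum_row (lam : n.Partition) {N : ℕ} (h : row lam N = 0) :
    ∑ i ∈ Finset.range N, row lam i = n := by
  rw [sum_range_eq_of_row_eq_zero lam h (fun _ r => r) fun _ => rfl, sum_row_of_le lam le_rfl]

theorem row_injective : Function.Injective (row : n.Partition → ℕ → ℕ) := by
  intro lam mu h
  have hc : ∀ j, col lam j = col mu j := fun j => by
    apply le_antisymm <;> by_contra hlt <;> push Not at hlt
    · have := (lt_row_iff lam _ _).2 hlt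
      rw [h] at this
      exact lt_irrefl _ ((lt_row_iff mu _ _).1 this)
    · have := (lt_row_iff mu _ _).2 hlt
      rw [← h] at this
      exact lt_irrefl _ ((lt_row_iff lam _ _).1 this)
  ext1
  rw [← Multiset.sort_eq lam.parts (· ≥ ·), ← Multiset.sort_eq mu.parts (· ≥ ·)]
  congr 1
  -- Padding by zeros hides the length of the sorted list. It is recovered as `col nu 0`, since all
  -- parts are positive.
  have hlen : ∀ nu : n.Partition, nu.parts.card = col nu 0 := fun nu => by
    rw [col, eq_comm, Multiset.countP_eq_card]
    exact fun x hx => nu.parts_pos hx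
  refine List.ext_getElem (by simp [hlen, hc]) fun i h1 h2 => ?_
  have := congrFun h i
  rwa [row, row, List.getD_eq_getElem _ _ h1, List.getD_eq_getElem _ _ h2] at this

/-- Produces partitions from sets of occupied sites and from sorted exponent vectors. -/
theorem exists_partition_row_eq {ρ : ℕ → ℕ} (hρ : Antitone ρ) {N : ℕ} (hN : ρ N = 0)
    (hs : ∑ i ∈ Finset.range N, ρ i = n) :
    ∃ lam : n.Partition, row lam = ρ ∧
      lam.parts = ((Finset.range N).val.map ρ).filter (· ≠ 0) := by
  refine ⟨Nat.Partition.ofSums n ((Finset.range N).val.map ρ) hs, ?_, rfl⟩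
  funext i
  refine eq_of_forall_lt_iff fun j => ?_
  rw [lt_row_iff, col]
  change i < Multiset.countP _ (((Finset.range N).val.map ρ).filter (· ≠ 0)) ↔ _
  rw [Multiset.countP_filter, Multiset.countP_map]
  refine Iff.trans ?_ (lt_card_filter_range_iff (p := fun i => j < ρ i) (N := N)
    (fun i k hik hk => hk.trans_le (hρ hik)) ?_ i)
  · rw [Finset.card_def, Finset.filter_val]
    have : (fun a => j < ρ a ∧ ρ a ≠ 0) = fun a => j < ρ a := by
      funext a; apply propext; constructor
      · exact And.left
      · intro h; exact ⟨h, by omega⟩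
    simp only [this]
  · intro k hk
    by_contra h
    have := hρ (show N ≤ k by omega)
    omega

theorem lt_durfee_iff (lam : n.Partition) (i : ℕ) : i < durfee lam ↔ i < row lam i := by
  refine lt_card_filter_range_iff (p := fun i => i < row lam i) (fun i j hij h => ?_)
    (fun i h => ?_) i
  · have := row_antitone lam hij
    omega
  · by_contra hi
    rw [row_eq_zero lam (by omega)] at h
    omega

theorem lt_durfee_iff_col (lam : n.Partition) (i : ℕ) : i < durfee lam ↔ i < col lam i := by
  rw [lt_durfee_iff, lt_row_iff]

theorem col_antitone (lam : n.Partition) : Antitone (col lam) := by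
  intro i j hij
  by_contra h
  push Not at h
  have h1 := (lt_row_iff lam _ _).2 h
  exact lt_irrefl _ ((lt_row_iff lam (col lam i) i).1 (by omega))

theorem col_le (lam : n.Partition) {N : ℕ} (h : row lam N = 0) (j : ℕ) : col lam j ≤ N := by
  by_contra hlt
  have := (lt_row_iff lam _ _).2 (not_le.1 hlt)
  omega

/-- The positions of the particles (`i - λ_{i+1}`) and of the holes never coincide. -/
theorem row_add_col_ne (lam : n.Partition) (i j : ℕ) :
    (i : ℤ) - row lam i ≠ col lam j - j - 1 := by
  -- Equality would mean `(row lam i - j) + (col lam j - i) = 1`. This number is at least 2 for a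
  -- box of the diagram and at most 0 otherwise.
  by_cases h : j < row lam i
  · have := (lt_row_iff lam _ _).1 h
    omega
  · have := mt (lt_row_iff lam _ _).2 h
    omega

theorem strictMono_sub_row (lam : n.Partition) : StrictMono fun i : ℕ => (i : ℤ) - row lam i := by
  intro i j hij
  have := row_antitone lam hij.le
  simp only
  omega

theorem strictAnti_col_sub (lam : n.Partition) :
    StrictAnti fun j : ℕ => (col lam j : ℤ) - j - 1 := by
  intro i j hij
  have := col_antitone lam hij.le
  simp only
  omega

/-- The sites `i - row lam i` with `i ≥ durfee lam` are the nonnegative ones still occupied, the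
holes are those vacated. They are disjoint subsets of `[0, N)` with `N - d` and `d` elements, so
they exhaust it. -/
theorem range_eq_particles_union_holes (lam : n.Partition) {N : ℕ} (h : row lam N = 0) :
    Finset.Ico (0 : ℤ) N = (Finset.Ico (durfee lam) N).image (fun i : ℕ => (i : ℤ) - row lam i) ∪
      (Finset.range (durfee lam)).image (fun j : ℕ => (col lam j : ℤ) - j - 1) := by
  have hd : durfee lam ≤ N := by
    by_contra hlt
    have := (lt_durfee_iff lam N).1 (not_le.1 hlt)
    omega
  symm
  apply Finset.eq_of_subset_of_card_le
  · intro x hx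
    simp only [Finset.mem_union, Finset.mem_image, Finset.mem_Ico, Finset.mem_range] at hx ⊢
    rcases hx with ⟨i, hi, rfl⟩ | ⟨j, hj, rfl⟩
    · have := mt (lt_durfee_iff lam i).2 (by omega)
      omega
    · have := (lt_durfee_iff_col lam j).1 hj
      have := col_le lam h j
      omega
  · rw [Finset.card_union_of_disjoint, Finset.card_image_of_injective,
      Finset.card_image_of_injective]
    · simp; omega
    · exact (strictAnti_col_sub lam).injective
    · exact (strictMono_sub_row lam).injective
    · rw [Finset.disjoint_left]
      intro x hx hx'
      simp only [Finset.mem_image] at hx hx'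
      obtain ⟨i, -, rfl⟩ := hx
      obtain ⟨j, -, hj⟩ := hx'
      exact row_add_col_ne lam i j hj.symm

/-- Passes from the particle-hole (Frobenius) coordinates to the rows. It is applied to the squares
for the energy, to the identity for the size, and to `Int.toNat` for the sign of a Schur state. -/
theorem sum_particles_sub_sum_holes (lam : n.Partition) {N : ℕ} (h : row lam N = 0)
    {A : Type*} [AddCommGroup A] (φ : ℤ → A) :
    ∑ i ∈ Finset.range (durfee lam), φ (i - row lam i) -
      ∑ j ∈ Finset.range (durfee lam), φ (col lam j - j - 1) =
    ∑ i ∈ Finset.range N, φ (i - row lam i) - ∑ i ∈ Finset.range N, φ i := by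
  have hd : durfee lam ≤ N := by
    by_contra hlt
    have := (lt_durfee_iff lam N).1 (not_le.1 hlt)
    omega
  have h1 : ∑ i ∈ Finset.range N, φ i = ∑ x ∈ Finset.Ico (0 : ℤ) N, φ x := by
    refine Finset.sum_bij (fun i _ => (i : ℤ)) ?_ ?_ ?_ ?_
    · intro i hi
      simpa using hi
    · intro i _ j _ hij
      simpa using hij
    · intro x hx
      simp only [Finset.mem_Ico] at hx
      exact ⟨x.toNat, by simp; omega, by simp; omega⟩
    · intro i _
      rfl
  rw [h1, range_eq_particles_union_holes lam h, Finset.sum_union,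
    Finset.sum_image (strictMono_sub_row lam).injective.injOn,
    Finset.sum_image (strictAnti_col_sub lam).injective.injOn,
    ← Finset.sum_range_add_sum_Ico _ hd]
  · abel
  · rw [Finset.disjoint_left]
    intro x hx hx'
    simp only [Finset.mem_image] at hx hx'
    obtain ⟨i, -, rfl⟩ := hx
    obtain ⟨j, -, hj⟩ := hx'
    exact row_add_col_ne lam i j hj.symm

theorem freeEnergy_eq (lam : n.Partition) {N : ℕ} (h : row lam N = 0) :
    freeEnergy lam = ∑ i ∈ Finset.range N,
      ((row lam i : ℂ) ^ 2 - (2 * i + 1) * row lam i) := by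
  have := sum_particles_sub_sum_holes lam h fun x : ℤ => ((x : ℂ) + 1 / 2) ^ 2
  rw [← Finset.sum_sub_distrib, ← Finset.sum_sub_distrib] at this
  rw [freeEnergy]
  convert this using 1
  · refine Finset.sum_congr rfl fun i _ => ?_
    push_cast
    ring
  · refine Finset.sum_congr rfl fun i _ => ?_
    push_cast
    ring

theorem sum_range_two_mul_add_one (k : ℕ) : ∑ i ∈ Finset.range k, (2 * i + 1) = k ^ 2 := by
  induction k with
  | zero => rfl
  | succ k ih => rw [Finset.sum_range_succ, ih]; ring

/-- Give each box in row `k` the weight `2 * k + 1`. A column then adds up to a square, and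
summation along rows gives the right side. -/
theorem sum_col_sq (lam : n.Partition) {N : ℕ} (h : row lam N = 0) :
    ∑ i ∈ Finset.range (row lam 0), col lam i ^ 2 =
      ∑ i ∈ Finset.range N, (2 * i + 1) * row lam i := by
  have h1 : ∀ i, col lam i ^ 2 =
      ∑ k ∈ Finset.range N, if i < row lam k then 2 * k + 1 else 0 := by
    intro i
    rw [← sum_range_two_mul_add_one, ← Finset.sum_filter]
    refine Finset.sum_congr ?_ fun _ _ => rfl
    ext k
    simp only [Finset.mem_range, Finset.mem_filter, lt_row_iff]
    have := col_le lam h i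
    omega
  simp only [h1]
  rw [Finset.sum_comm]
  refine Finset.sum_congr rfl fun k _ => ?_
  rw [← Finset.sum_filter, Finset.sum_const, smul_eq_mul, mul_comm]
  congr 1
  conv_rhs => rw [← Finset.card_range (row lam k)]
  congr 1
  ext i
  have := row_antitone lam (Nat.zero_le k)
  simp only [Finset.mem_range, Finset.mem_filter]
  omega

/-- In this form dominance controls both sums: the first grows and the second does not grow when
boxes move to higher rows. -/
theorem energy_eq (b : ℝ) (lam : n.Partition) {N : ℕ} (h : row lam N = 0) :
    energy b lam = ∑ i ∈ Finset.range N, ((row lam i : ℂ) ^ 2) -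
      (b : ℂ) ^ 2 * ∑ i ∈ Finset.range N, ((2 * i + 1) * row lam i : ℂ) := by
  rw [energy, freeEnergy_eq lam h]
  have := sum_col_sq lam h
  have h2 : ∑ i ∈ Finset.range (row lam 0), (col lam i : ℂ) ^ 2 =
      ∑ i ∈ Finset.range N, ((2 * i + 1) * row lam i : ℂ) := by exact_mod_cast this
  rw [h2, Finset.sum_sub_distrib]
  ring

/-! ### Dominance -/

/-- Abel summation in inductive form, for decreasing weights and nonnegative partial sums. -/
theorem mul_sum_le_sum_mul {w x : ℕ → ℤ} (hw : Antitone w)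
    (hx : ∀ k, 0 ≤ ∑ i ∈ Finset.range k, x i) (k : ℕ) :
    w k * ∑ i ∈ Finset.range k, x i ≤ ∑ i ∈ Finset.range k, w i * x i := by
  induction k with
  | zero => simp
  | succ k ih =>
    rw [Finset.sum_range_succ (fun i => w i * x i)]
    have h1 := mul_le_mul_of_nonneg_right (hw (Nat.le_succ k)) (hx (k + 1))
    rw [Finset.sum_range_succ] at h1 ⊢
    simp only [Nat.succ_eq_add_one] at h1
    linarith

/-- The difference `x` of the rows has nonnegative partial sums and total zero. The squares differ
by `2 ∑ μ_i x_i + ∑ x_i²`, where the first sum is nonnegative by Abel summation and the second is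
positive. The increasing weights `2 * i + 1` give a nonpositive sum, which enters with the factor
`-b²`. So the energy of `lam` is in fact strictly larger. -/
theorem DominanceLT.energy_ne {b : ℝ} (hb : 0 < b) {mu lam : n.Partition}
    (h : DominanceLT mu lam) : energy b lam ≠ energy b mu := by
  obtain ⟨hne, hdom⟩ := h
  have hl := row_eq_zero lam le_rfl
  have hm := row_eq_zero mu le_rfl
  set x : ℕ → ℤ := fun i => (row lam i : ℤ) - row mu i with hxdef
  have hx : ∀ k, 0 ≤ ∑ i ∈ Finset.range k, x i := by
    intro k
    rw [hxdef, Finset.sum_sub_distrib, sub_nonneg]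
    exact_mod_cast hdom k
  have hx0 : ∑ i ∈ Finset.range n, x i = 0 := by
    rw [hxdef, Finset.sum_sub_distrib, sub_eq_zero]
    have h1 := sum_row lam hl
    have h2 := sum_row mu hm
    exact_mod_cast h1.trans h2.symm
  have h1 : 0 ≤ ∑ i ∈ Finset.range n, (row mu i : ℤ) * x i := by
    have := mul_sum_le_sum_mul (w := fun i => (row mu i : ℤ))
      (fun i j hij => by simpa using row_antitone mu hij) hx n
    rwa [hx0, mul_zero] at this
  have h2 : ∑ i ∈ Finset.range n, (2 * i + 1 : ℤ) * x i ≤ 0 := by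
    have := mul_sum_le_sum_mul (w := fun i => -(2 * i + 1 : ℤ))
      (fun i j hij => by simp only; omega) hx n
    rw [hx0, mul_zero] at this
    simp only [neg_mul, Finset.sum_neg_distrib] at this
    linarith
  have h3 : 0 < ∑ i ∈ Finset.range n, x i ^ 2 := by
    refine Finset.sum_pos' (fun i _ => sq_nonneg _) ?_
    by_contra hall
    push Not at hall
    refine hne (row_injective (funext fun i => ?_))
    by_cases hi : i < n
    · have := hall i (by simpa using hi)
      have h0 : x i = 0 := by
        by_contra hxi
        exact absurd this (not_le.2 (by positivity))
      simp only [hxdef] at h0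
      omega
    · rw [row_eq_zero lam (by omega), row_eq_zero mu (by omega)]
  have key : energy b lam - energy b mu =
      ((2 * ∑ i ∈ Finset.range n, (row mu i : ℤ) * x i + ∑ i ∈ Finset.range n, x i ^ 2 : ℤ) -
        b ^ 2 * (∑ i ∈ Finset.range n, (2 * i + 1 : ℤ) * x i : ℤ) : ℝ) := by
    rw [energy_eq b lam hl, energy_eq b mu hm]
    push_cast [hxdef]
    rw [show ∀ a a' c c' e : ℂ, a - e * c - (a' - e * c') = (a - a') - e * (c - c') by
      intros; ring, ← Finset.sum_sub_distrib, ← Finset.sum_sub_distrib]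
    congr 1
    · rw [Finset.mul_sum, ← Finset.sum_add_distrib]
      refine Finset.sum_congr rfl fun i _ => by ring
    · congr 1
      refine Finset.sum_congr rfl fun i _ => by ring
  intro heq
  rw [heq, sub_self] at key
  have key' := (Complex.ofReal_eq_zero.1 key.symm)
  have h1' : (0 : ℝ) ≤ (∑ i ∈ Finset.range n, (row mu i : ℤ) * x i : ℤ) := by exact_mod_cast h1
  have h2' : ((∑ i ∈ Finset.range n, (2 * i + 1 : ℤ) * x i : ℤ) : ℝ) ≤ 0 := by exact_mod_cast h2
  have h3' : (0 : ℝ) < (∑ i ∈ Finset.range n, x i ^ 2 : ℤ) := by exact_mod_cast h3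
  have h4 : b ^ 2 * ((∑ i ∈ Finset.range n, (2 * i + 1 : ℤ) * x i : ℤ) : ℝ) ≤ 0 :=
    mul_nonpos_of_nonneg_of_nonpos (by positivity) h2'
  rw [Int.cast_add, Int.cast_mul] at key'
  push_cast at key' h1' h3' h4
  linarith

theorem DominanceLT.trans {mu nu lam : n.Partition} (h1 : DominanceLT mu nu)
    (h2 : DominanceLT nu lam) : DominanceLT mu lam := by
  refine ⟨?_, fun j => (h1.2 j).trans (h2.2 j)⟩
  rintro rfl
  refine h1.1 (row_injective (funext fun i => ?_))
  have e := fun j => le_antisymm (h1.2 j) (h2.2 j)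
  have := e (i + 1)
  rw [Finset.sum_range_succ, Finset.sum_range_succ, e i] at this
  omega

theorem not_dominanceLT_self (lam : n.Partition) : ¬ DominanceLT lam lam := fun h => h.1 rfl

theorem mem_lower {mu lam : n.Partition} : mu ∈ lower lam ↔ DominanceLT mu lam := by
  classical
  simp [lower]

end

/-! ### Locally finite sums, fermionic modes and their oscillators. -/

section

/-! ### Locally finite families -/

section LocSum

variable {κ M ι : Type*} [AddCommGroup M] [Module ℂ M] {B : Module.Basis κ ℂ M}
  {T : ι → Module.End ℂ M}

/-- On each basis vector only finitely many members of the family are nonzero. -/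
def LocFin (B : Module.Basis κ ℂ M) (T : ι → Module.End ℂ M) : Prop :=
  ∀ k, {i | T i (B k) ≠ 0}.Finite

theorem LocFin.finite (h : LocFin B T) (v : M) : (Function.support fun i => T i v).Finite := by
  induction B.mem_span v using Submodule.span_induction with
  | mem x hx =>
    obtain ⟨k, rfl⟩ := hx
    exact h k
  | zero => simp
  | add x y _ _ hx hy =>
    refine (hx.union hy).subset fun i hi => ?_
    simp only [Function.mem_support, map_add, Set.mem_union] at hi ⊢
    by_contra hc
    push Not at hc
    exact hi (by rw [hc.1, hc.2, add_zero])
  | smul a x _ hx =>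
    refine hx.subset fun i hi => ?_
    simp only [Function.mem_support, map_smul] at hi ⊢
    exact fun h0 => hi (by rw [h0, smul_zero])

theorem LocFin.locSum_apply (h : LocFin B T) (v : M) : locSum B T v = ∑ᶠ i, T i v := by
  induction B.mem_span v using Submodule.span_induction with
  | mem x hx =>
    obtain ⟨k, rfl⟩ := hx
    rw [locSum, Module.Basis.constr_basis]
  | zero => simp
  | add x y _ _ hx hy =>
    simp only [map_add]
    rw [finsum_add_distrib (h.finite x) (h.finite y), hx, hy]
  | smul a x _ hx =>
    simp only [map_smul]
    rw [hx, smul_finsum]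

theorem LocFin.of_forall_finite (h : ∀ v : M, (Function.support fun i => T i v).Finite) :
    LocFin B T := fun k => h (B k)

theorem LocFin.map_locSum_apply (h : LocFin B T) {M' : Type*} [AddCommGroup M'] [Module ℂ M']
    (X : M →ₗ[ℂ] M') (v : M) : X (locSum B T v) = ∑ᶠ i, X (T i v) := by
  rw [h.locSum_apply]
  exact map_finsum X (h.finite v)

/-- Commutators of infinite sums may be taken termwise, because both `v` and `X v` meet only
finitely many members of the family. -/
theorem LocFin.commutator_apply (h : LocFin B T) (X : Module.End ℂ M) (v : M) :
    (locSum B T * X - X * locSum B T) v = ∑ᶠ i, (T i * X - X * T i) v := by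
  simp only [LinearMap.sub_apply, Module.End.mul_apply]
  rw [h.locSum_apply, h.map_locSum_apply, finsum_sub_distrib (h.finite _)]
  refine (h.finite v).subset fun i hi => ?_
  simp only [Function.mem_support] at hi ⊢
  exact fun h0 => hi (by rw [h0, map_zero])

theorem LocFin.add {T' : ι → Module.End ℂ M} (h : LocFin B T) (h' : LocFin B T') :
    LocFin B fun i => T i + T' i := fun k => by
  refine ((h k).union (h' k)).subset fun i hi => ?_
  simp only [Set.mem_ofPred_eq, LinearMap.add_apply, Set.mem_union] at hi ⊢
  by_contra hc
  push Not at hc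
  exact hi (by rw [hc.1, hc.2, add_zero])

theorem LocFin.smul (h : LocFin B T) (a : ι → ℂ) : LocFin B fun i => a i • T i := fun k => by
  refine (h k).subset fun i hi => ?_
  simp only [Set.mem_ofPred_eq, LinearMap.smul_apply] at hi ⊢
  exact fun h0 => hi (by rw [h0, smul_zero])

theorem LocFin.mul_left (h : LocFin B T) (X : ι → Module.End ℂ M) :
    LocFin B fun i => X i * T i := fun k => by
  refine (h k).subset fun i hi => ?_
  simp only [Set.mem_ofPred_eq, Module.End.mul_apply] at hi ⊢
  exact fun h0 => hi (by rw [h0, map_zero])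

theorem LocFin.locSum_add {T' : ι → Module.End ℂ M} (h : LocFin B T) (h' : LocFin B T') :
    locSum B (fun i => T i + T' i) = locSum B T + locSum B T' := by
  refine LinearMap.ext fun v => ?_
  rw [LinearMap.add_apply, h.locSum_apply, h'.locSum_apply, (h.add h').locSum_apply]
  exact finsum_add_distrib (h.finite v) (h'.finite v)

end LocSum

/-! ### Canonical anticommutation relations -/

/-- The sign `(-1)^#{x ∈ S | x < j}`. -/
def sgn (j : ℤ) (S : Finset ℤ) : ℂ := (-1) ^ (S.filter (· < j)).card

theorem create_apply (j : ℤ) (S : Finset ℤ) :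
    create j (fockBasis S) = if j ∈ S then 0 else sgn j S • fockBasis (insert j S) := by
  rw [create, Module.Basis.constr_basis, sgn]

theorem annihilate_apply (j : ℤ) (S : Finset ℤ) :
    annihilate j (fockBasis S) = if j ∈ S then sgn j S • fockBasis (S.erase j) else 0 := by
  rw [annihilate, Module.Basis.constr_basis, sgn]

theorem sgn_insert {i j : ℤ} {S : Finset ℤ} (hj : j ∉ S) :
    sgn i (insert j S) = if j < i then -sgn i S else sgn i S := by
  rw [sgn, sgn, Finset.filter_insert]
  split_ifs with h
  · rw [Finset.card_insert_of_notMem (by simp [hj]), pow_succ, mul_neg_one]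
  · rfl

theorem sgn_erase {i j : ℤ} {S : Finset ℤ} (hj : j ∈ S) :
    sgn i (S.erase j) = if j < i then -sgn i S else sgn i S := by
  have := sgn_insert (i := i) (Finset.notMem_erase j S)
  rw [Finset.insert_erase hj] at this
  rw [this]
  split_ifs <;> simp

theorem sgn_mul_self (i : ℤ) (S : Finset ℤ) : sgn i S * sgn i S = 1 := by
  rw [sgn, ← mul_pow]
  norm_num

/-- The sign `sgn i` changes when `j` is inserted or erased exactly if `j < i`. For two distinct
sites exactly one of the two orders produces this change, which is the source of all anticommutation
signs. -/
theorem create_mul_create (i j : ℤ) : create i * create j + create j * create i = 0 := by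
  refine fockBasis.ext fun S => ?_
  simp only [LinearMap.add_apply, Module.End.mul_apply, LinearMap.zero_apply, create_apply]
  rcases eq_or_ne i j with rfl | hij
  · by_cases hi : i ∈ S <;> simp [hi, create_apply]
  by_cases hi : i ∈ S <;> by_cases hj : j ∈ S <;>
    simp [hi, hj, hij, hij.symm, create_apply, sgn_insert, Finset.insert_comm j i, smul_smul]
  rcases lt_or_gt_of_ne hij with h | h <;> simp [h, h.not_gt, mul_comm (sgn i S)]

theorem annihilate_mul_annihilate (i j : ℤ) :
    annihilate i * annihilate j + annihilate j * annihilate i = 0 := by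
  refine fockBasis.ext fun S => ?_
  simp only [LinearMap.add_apply, Module.End.mul_apply, LinearMap.zero_apply, annihilate_apply]
  rcases eq_or_ne i j with rfl | hij
  · by_cases hi : i ∈ S <;> simp [hi, annihilate_apply]
  by_cases hi : i ∈ S <;> by_cases hj : j ∈ S <;>
    simp [hi, hj, hij, hij.symm, annihilate_apply, sgn_erase, Finset.erase_right_comm (a := j),
      smul_smul]
  rcases lt_or_gt_of_ne hij with h | h <;> simp [h, h.not_gt, mul_comm (sgn i S)]

theorem create_mul_annihilate (i j : ℤ) :
    create i * annihilate j + annihilate j * create i = if i = j then 1 else 0 := by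
  refine fockBasis.ext fun S => ?_
  simp only [LinearMap.add_apply, Module.End.mul_apply, annihilate_apply, create_apply]
  rcases eq_or_ne i j with rfl | hij
  · by_cases hi : i ∈ S <;>
      simp [hi, create_apply, annihilate_apply, sgn_insert, sgn_erase, smul_smul, sgn_mul_self]
  by_cases hi : i ∈ S <;> by_cases hj : j ∈ S <;>
    simp [hi, hj, hij, hij.symm, annihilate_apply, create_apply, sgn_erase, sgn_insert,
      smul_smul, Finset.erase_insert_of_ne hij]
  rcases lt_or_gt_of_ne hij with h | h <;> simp [h, h.not_gt, mul_comm (sgn i S)]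

/-! The operator `ψ a` puts a particle on the site `a`, the operator `del a` removes it.  In the
vacuum the nonnegative sites are occupied. -/

/-- The mode that removes a particle from the site `a`. -/
def del (a : ℤ) : Module.End ℂ Fock := ψs (-a - 1)

theorem ψ_of_neg {a : ℤ} (h : a < 0) : ψ a = create a := by
  simp [ψ, Mode.op, h]

theorem ψ_of_nonneg {a : ℤ} (h : 0 ≤ a) : ψ a = annihilate a := by
  simp [ψ, Mode.op, h]

theorem del_of_neg {a : ℤ} (h : a < 0) : del a = annihilate a := by
  have : ¬ (-a - 1 < 0) := by omega
  simp [del, ψs, Mode.op, this]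

theorem del_of_nonneg {a : ℤ} (h : 0 ≤ a) : del a = create a := by
  have : (-a - 1 < 0) := by omega
  simp [del, ψs, Mode.op, this]

theorem ψs_eq_del (k : ℤ) : ψs k = del (-k - 1) := by
  rw [del]; congr 1; omega

theorem ψ_mul_ψ (a b : ℤ) : ψ a * ψ b + ψ b * ψ a = 0 := by
  rcases lt_or_ge a 0 with ha | ha <;> rcases lt_or_ge b 0 with hb | hb
  · rw [ψ_of_neg ha, ψ_of_neg hb, create_mul_create]
  · rw [ψ_of_neg ha, ψ_of_nonneg hb, create_mul_annihilate, if_neg (by omega)]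
  · rw [ψ_of_nonneg ha, ψ_of_neg hb, add_comm, create_mul_annihilate, if_neg (by omega)]
  · rw [ψ_of_nonneg ha, ψ_of_nonneg hb, annihilate_mul_annihilate]

theorem del_mul_del (a b : ℤ) : del a * del b + del b * del a = 0 := by
  rcases lt_or_ge a 0 with ha | ha <;> rcases lt_or_ge b 0 with hb | hb
  · rw [del_of_neg ha, del_of_neg hb, annihilate_mul_annihilate]
  · rw [del_of_neg ha, del_of_nonneg hb, add_comm, create_mul_annihilate, if_neg (by omega)]
  · rw [del_of_nonneg ha, del_of_neg hb, create_mul_annihilate, if_neg (by omega)]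
  · rw [del_of_nonneg ha, del_of_nonneg hb, create_mul_create]

theorem ψ_mul_del (a b : ℤ) : ψ a * del b + del b * ψ a = if a = b then 1 else 0 := by
  rcases lt_or_ge a 0 with ha | ha <;> rcases lt_or_ge b 0 with hb | hb
  · rw [ψ_of_neg ha, del_of_neg hb, create_mul_annihilate]
  · rw [ψ_of_neg ha, del_of_nonneg hb, create_mul_create, if_neg (by omega)]
  · rw [ψ_of_nonneg ha, del_of_neg hb, annihilate_mul_annihilate, if_neg (by omega)]
  · rw [ψ_of_nonneg ha, del_of_nonneg hb, add_comm, create_mul_annihilate]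
    simp [eq_comm]

theorem del_mul_ψ_of_ne {a b : ℤ} (h : a ≠ b) : del b * ψ a = -(ψ a * del b) := by
  have := ψ_mul_del a b
  rw [if_neg h] at this
  exact eq_neg_of_add_eq_zero_right this

theorem ψ_mul_ψ_swap (a b : ℤ) : ψ a * ψ b = -(ψ b * ψ a) :=
  eq_neg_of_add_eq_zero_left (ψ_mul_ψ a b)

theorem del_mul_del_swap (a b : ℤ) : del a * del b = -(del b * del a) :=
  eq_neg_of_add_eq_zero_left (del_mul_del a b)

theorem normalOrder_singleton (a : Mode) : normalOrder [a] = a.op := by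
  simp [normalOrder]

theorem normalOrder_psi_psiStar (a k : ℤ) : normalOrder [.psi a, .psiStar k] =
    if a < 0 then ψ a * del (-k - 1) else -(del (-k - 1) * ψ a) := by
  rw [normalOrder, normalOrder_singleton]
  simp only [Mode.index, List.length_singleton, pow_one, neg_smul, one_smul]
  rw [← ψs_eq_del]
  rfl

/-- Both orderings of the pair, taken with their signs, differ by a scalar, so the commutator does
not see the normal ordering. It follows from `[AB, C] = A{B, C} - {A, C}B` and its mirror image. -/
theorem normalOrder_commutator_ψ (a k c : ℤ) :
    normalOrder [.psi a, .psiStar k] * ψ c - ψ c * normalOrder [.psi a, .psiStar k] =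
      if -k - 1 = c then ψ a else 0 := by
  have h1 := ψ_mul_ψ a c
  have h2 := ψ_mul_del c (-k - 1)
  have e : (if -k - 1 = c then ψ a else 0) = ψ a * (if c = -k - 1 then 1 else 0) := by
    simp [eq_comm (a := c)]
  have e' : (if -k - 1 = c then ψ a else 0) = (if c = -k - 1 then 1 else 0) * ψ a := by
    simp [eq_comm (a := c)]
  rw [normalOrder_psi_psiStar]
  by_cases ha : a < 0
  · rw [if_pos ha, e, ← h2, ← sub_eq_zero]
    have : ψ a * del (-k - 1) * ψ c - ψ c * (ψ a * del (-k - 1)) -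
      ψ a * (ψ c * del (-k - 1) + del (-k - 1) * ψ c) =
      -((ψ a * ψ c + ψ c * ψ a) * del (-k - 1)) := by noncomm_ring
    rw [this, h1, zero_mul, neg_zero]
  · rw [if_neg ha, e', ← h2, ← sub_eq_zero]
    have : -(del (-k - 1) * ψ a) * ψ c - ψ c * -(del (-k - 1) * ψ a) -
      (ψ c * del (-k - 1) + del (-k - 1) * ψ c) * ψ a =
      -(del (-k - 1) * (ψ a * ψ c + ψ c * ψ a)) := by noncomm_ring
    rw [this, h1, mul_zero, neg_zero]

theorem normalOrder_commutator_del (a k c : ℤ) :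
    normalOrder [.psi a, .psiStar k] * del c - del c * normalOrder [.psi a, .psiStar k] =
      if a = c then -del (-k - 1) else 0 := by
  have h1 := del_mul_del (-k - 1) c
  have h2 := ψ_mul_del a c
  have e : (if a = c then -del (-k - 1) else 0) =
      -((if a = c then 1 else 0) * del (-k - 1)) := by
    split_ifs <;> simp
  have e' : (if a = c then -del (-k - 1) else 0) =
      -(del (-k - 1) * (if a = c then 1 else 0)) := by
    split_ifs <;> simp
  rw [normalOrder_psi_psiStar]
  by_cases ha : a < 0
  · rw [if_pos ha, e, ← h2, ← sub_eq_zero]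
    have : ψ a * del (-k - 1) * del c - del c * (ψ a * del (-k - 1)) -
      -((ψ a * del c + del c * ψ a) * del (-k - 1)) =
      ψ a * (del (-k - 1) * del c + del c * del (-k - 1)) := by noncomm_ring
    rw [this, h1, mul_zero]
  · rw [if_neg ha, e', ← h2, ← sub_eq_zero]
    have : -(del (-k - 1) * ψ a) * del c - del c * -(del (-k - 1) * ψ a) -
      -(del (-k - 1) * (ψ a * del c + del c * ψ a)) =
      (del (-k - 1) * del c + del c * del (-k - 1)) * ψ a := by noncomm_ring
    rw [this, h1, zero_mul]

/-! ### Bosonic oscillators -/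

/-- All sites outside `[-B, B)` are as in the vacuum. -/
def BoundedBy (B : ℤ) (S : Finset ℤ) : Prop := 0 ≤ B ∧ ∀ x ∈ S, -B ≤ x ∧ x < B

theorem exists_boundedBy (S : Finset ℤ) : ∃ B, BoundedBy B S := by
  refine ⟨∑ x ∈ S, (|x| + 1), Finset.sum_nonneg fun x _ => by positivity, fun x hx => ?_⟩
  have := Finset.single_le_sum (f := fun x : ℤ => |x| + 1) (fun x _ => by positivity) hx
  have h1 := neg_abs_le x
  have h2 := le_abs_self x
  constructor <;> linarith

theorem BoundedBy.del_apply {B : ℤ} {S : Finset ℤ} (h : BoundedBy B S) {b : ℤ} (hb : b < -B) :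
    del b (fockBasis S) = 0 := by
  have := h.1
  rw [del_of_neg (by omega), annihilate_apply, if_neg]
  intro hx
  have := h.2 b hx
  omega

theorem BoundedBy.ψ_apply {B : ℤ} {S : Finset ℤ} (h : BoundedBy B S) {a : ℤ} (ha : B ≤ a) :
    ψ a (fockBasis S) = 0 := by
  have := h.1
  rw [ψ_of_nonneg (by omega), annihilate_apply, if_neg]
  intro hx
  have := h.2 a hx
  omega

/-- For large `k` the summand removes a particle from an empty negative site, and for very negative
`k` it fills a site that is already occupied. -/
theorem locFin_osc (n : ℤ) :
    LocFin fockBasis fun k : ℤ => normalOrder [.psi (n - k - 1), .psiStar k] := by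
  intro S
  obtain ⟨B, hB⟩ := exists_boundedBy S
  refine (Set.finite_Icc (-(B + |n| + 1)) (B + |n| + 1)).subset fun k hk => ?_
  have h1 := neg_abs_le n
  have h2 := le_abs_self n
  have h0 := hB.1
  simp only [Set.mem_ofPred_eq, normalOrder_psi_psiStar, Set.mem_Icc] at hk ⊢
  by_contra hc
  apply hk
  rw [not_and_or] at hc
  rcases hc with hc | hc
  · rw [if_neg (by omega), LinearMap.neg_apply, Module.End.mul_apply, hB.ψ_apply (by omega),
      map_zero, neg_zero]
  · rw [if_pos (by omega), Module.End.mul_apply, hB.del_apply (by omega), map_zero]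

/-- A single summand of `osc n` fails to commute with a given mode, so no convergence question
remains. -/
theorem osc_commutator_ψ (n a : ℤ) : osc n * ψ a - ψ a * osc n = ψ (a + n) := by
  refine LinearMap.ext fun v => ?_
  rw [osc, (locFin_osc n).commutator_apply, finsum_eq_single _ (-a - 1)]
  · rw [normalOrder_commutator_ψ, if_pos (by omega)]
    congr 2; omega
  · intro k hk
    rw [normalOrder_commutator_ψ, if_neg (by omega), LinearMap.zero_apply]

theorem osc_commutator_del (n a : ℤ) : osc n * del a - del a * osc n = -del (a - n) := by
  refine LinearMap.ext fun v => ?_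
  rw [osc, (locFin_osc n).commutator_apply, finsum_eq_single _ (n - a - 1)]
  · rw [normalOrder_commutator_del, if_pos (by omega)]
    congr 3; omega
  · intro k hk
    rw [normalOrder_commutator_del, if_neg (by omega), LinearMap.zero_apply]

end

/-! ### Heisenberg relations and the boson-fermion correspondence. -/

section

/-! ### Coordinates and commutation relations -/

theorem coord_create (S : Finset ℤ) (j : ℤ) (v : Fock) :
    fockBasis.coord S (create j v) =
      if j ∈ S then sgn j S * fockBasis.coord (S.erase j) v else 0 := by
  have : fockBasis.coord S ∘ₗ create j =
      if j ∈ S then sgn j S • fockBasis.coord (S.erase j) else 0 := by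
    refine fockBasis.ext fun T => ?_
    rw [LinearMap.comp_apply, create_apply]
    by_cases hT : j ∈ T
    · rw [if_pos hT, map_zero]
      split_ifs
      · have : S.erase j ≠ T := fun h => by rw [← h] at hT; simp at hT
        simp [this.symm]
      · rfl
    · rw [if_neg hT]
      by_cases hS : j ∈ S
      · rw [if_pos hS]
        by_cases h : insert j T = S
        · subst h
          have : sgn j T = sgn j (insert j T) := by rw [sgn_insert hT, if_neg (lt_irrefl j)]
          simp [this, Finset.erase_insert hT]
        · have h' : T ≠ S.erase j := fun h' => h (by rw [h', Finset.insert_erase hS])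
          simp [h, h']
      · rw [if_neg hS]
        have h : insert j T ≠ S := fun h => hS (h ▸ Finset.mem_insert_self j T)
        simp [h]
  have := LinearMap.congr_fun this v
  rw [LinearMap.comp_apply] at this
  rw [this]
  split_ifs <;> simp

theorem coord_annihilate (S : Finset ℤ) (j : ℤ) (v : Fock) :
    fockBasis.coord S (annihilate j v) =
      if j ∈ S then 0 else sgn j S * fockBasis.coord (insert j S) v := by
  have : fockBasis.coord S ∘ₗ annihilate j =
      if j ∈ S then 0 else sgn j S • fockBasis.coord (insert j S) := by
    refine fockBasis.ext fun T => ?_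
    rw [LinearMap.comp_apply, annihilate_apply]
    by_cases hT : j ∈ T
    · rw [if_pos hT]
      by_cases hS : j ∈ S
      · rw [if_pos hS]
        have : T.erase j ≠ S := fun h => by rw [← h] at hS; simp at hS
        simp [this]
      · rw [if_neg hS]
        by_cases h : T = insert j S
        · subst h
          rw [Finset.erase_insert hS, sgn_insert hS, if_neg (lt_irrefl j)]
          simp
        · have h' : T.erase j ≠ S := fun h' => h (by rw [← h', Finset.insert_erase hT])
          simp [h, h']
    · rw [if_neg hT, map_zero]
      split_ifs
      · rfl
      · have : T ≠ insert j S := fun h => hT (h ▸ Finset.mem_insert_self j S)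
        simp [this]
  have := LinearMap.congr_fun this v
  rw [LinearMap.comp_apply] at this
  rw [this]
  split_ifs <;> simp

/-- A component of `v` along a nonempty set `S` would survive the annihilation of an element of `S`.
-/
theorem eq_smul_vac {v : Fock} (h : ∀ j, annihilate j v = 0) :
    v = fockBasis.coord ∅ v • vac := by
  refine fockBasis.ext_elem fun S => ?_
  rcases S.eq_empty_or_nonempty with rfl | ⟨j, hj⟩
  · simp [vac]
  · have h1 := coord_annihilate (S.erase j) j v
    rw [h j, map_zero, if_neg (Finset.notMem_erase j S), Finset.insert_erase hj] at h1
    have h2 : fockBasis.repr v S = 0 := by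
      have := congrArg (fun x => sgn j (S.erase j) * x) h1
      simpa [← mul_assoc, sgn_mul_self] using this.symm
    have h3 : (∅ : Finset ℤ) ≠ S := fun h => by simp [← h] at hj
    simp [h2, vac, h3]

/-- The creation operators generate the Fock space from the vacuum, so such an operator is
determined by its value there. Building `S` by inserting new minima avoids all signs. -/
theorem eq_smul_one_of_commute {X : Module.End ℂ Fock} (h : ∀ j, X * create j = create j * X)
    {κ : ℂ} (hv : X vac = κ • vac) : X = κ • 1 := by
  refine fockBasis.ext fun S => ?_
  rw [LinearMap.smul_apply, Module.End.one_apply]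
  induction S using Finset.induction_on_min with
  | empty => exact hv
  | insert j S hlt ih =>
    have hj : j ∉ S := fun hj => lt_irrefl _ (hlt j hj)
    have hs : sgn j S = 1 := by
      rw [sgn, Finset.filter_eq_empty_iff.2 fun x hx => (hlt x hx).not_gt]
      simp
    have e : fockBasis (insert j S) = create j (fockBasis S) := by
      rw [create_apply, if_neg hj, hs, one_smul]
    rw [e, ← Module.End.mul_apply, h, Module.End.mul_apply, ih, map_smul]

theorem annihilate_vac (j : ℤ) : annihilate j vac = 0 := by
  rw [vac, annihilate_apply, if_neg (Finset.notMem_empty j)]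

theorem ψ_vac {a : ℤ} (h : 0 ≤ a) : ψ a vac = 0 := by
  rw [ψ_of_nonneg h, annihilate_vac]

theorem del_vac {a : ℤ} (h : a < 0) : del a vac = 0 := by
  rw [del_of_neg h, annihilate_vac]

theorem coord_empty_ψ {a : ℤ} (h : a < 0) (v : Fock) : fockBasis.coord ∅ (ψ a v) = 0 := by
  rw [ψ_of_neg h, coord_create, if_neg (Finset.notMem_empty a)]

theorem coord_empty_del {a : ℤ} (h : 0 ≤ a) (v : Fock) : fockBasis.coord ∅ (del a v) = 0 := by
  rw [del_of_nonneg h, coord_create, if_neg (Finset.notMem_empty a)]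

theorem osc_vac {n : ℤ} (h : 0 ≤ n) : osc n vac = 0 := by
  rw [osc, (locFin_osc n).locSum_apply]
  refine finsum_eq_zero_of_forall_eq_zero fun k => ?_
  rw [normalOrder_psi_psiStar]
  split_ifs with hk
  · rw [Module.End.mul_apply, del_vac (by omega), map_zero]
  · rw [LinearMap.neg_apply, Module.End.mul_apply, ψ_vac (by omega), map_zero, neg_zero]

theorem coord_empty_osc {n : ℤ} (h : n ≤ 0) (v : Fock) : fockBasis.coord ∅ (osc n v) = 0 := by
  rw [osc, (locFin_osc n).map_locSum_apply]
  refine finsum_eq_zero_of_forall_eq_zero fun k => ?_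
  rw [normalOrder_psi_psiStar]
  split_ifs with hk
  · rw [Module.End.mul_apply, coord_empty_ψ (by omega)]
  · rw [LinearMap.neg_apply, map_neg, Module.End.mul_apply, coord_empty_del (by omega), neg_zero]

theorem osc_mul_ψ (n a : ℤ) : osc n * ψ a = ψ a * osc n + ψ (a + n) := by
  rw [← osc_commutator_ψ, add_sub_cancel]

theorem osc_mul_del (n a : ℤ) : osc n * del a = del a * osc n - del (a - n) := by
  rw [sub_eq_add_neg, ← osc_commutator_del, add_sub_cancel]

/-- The central term is a count. `osc (-l)` creates `l` particle-hole pairs from the vacuum, and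
`osc n` can bring a particle back into its own hole only if `n = l`. Each pair then contributes 1.
-/
theorem coord_empty_commutator_osc_vac {n l : ℤ} (hn : 0 < n) :
    fockBasis.coord ∅ ((osc n * osc (-l) - osc (-l) * osc n) vac) =
      if n = l then (n : ℂ) else 0 := by
  -- The bounds on `k` say that the particle site `-l - k - 1` is negative and the hole site `-k -
  -- 1` nonnegative; otherwise the summand kills the vacuum or is not a creation pair.
  have h1 : ∀ k : ℤ, fockBasis.coord ∅ (osc n (normalOrder [.psi (-l - k - 1), .psiStar k] vac)) =
      if (-l ≤ k ∧ k < 0) ∧ n = l then 1 else 0 := by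
    intro k
    rw [normalOrder_psi_psiStar]
    split_ifs with h2 h3 h3
    · rw [← Module.End.mul_apply, ← mul_assoc, osc_mul_ψ, add_mul, LinearMap.add_apply, map_add,
        mul_assoc, Module.End.mul_apply, coord_empty_ψ h2, zero_add, ψ_of_nonneg (by omega),
        Module.End.mul_apply, del_of_nonneg (by omega), coord_annihilate,
        if_neg (Finset.notMem_empty _), coord_create, if_pos (by simp; omega)]
      have e : (insert (-l - k - 1 + n) (∅ : Finset ℤ)).erase (-k - 1) = ∅ := by
        rw [show -l - k - 1 + n = -k - 1 by omega]
        simp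
      rw [e]
      have e2 : fockBasis.coord ∅ vac = 1 := by simp [vac]
      rw [e2, show -l - k - 1 + n = -k - 1 by omega]
      simp [sgn, Finset.filter_singleton]
    · by_cases hk : k < 0
      · rw [← Module.End.mul_apply, ← mul_assoc, osc_mul_ψ, add_mul, LinearMap.add_apply, map_add,
          mul_assoc, Module.End.mul_apply, coord_empty_ψ h2, zero_add, Module.End.mul_apply]
        by_cases h4 : -l - k - 1 + n < 0
        · rw [coord_empty_ψ h4]
        · rw [ψ_of_nonneg (by omega), del_of_nonneg (by omega), coord_annihilate,
            if_neg (Finset.notMem_empty _), coord_create, if_neg (by simp; omega), mul_zero]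
      · rw [Module.End.mul_apply, del_vac (by omega), map_zero, map_zero, map_zero]
    · omega
    · rw [LinearMap.neg_apply, Module.End.mul_apply, ψ_vac (by omega), map_zero, neg_zero, map_zero,
        map_zero]
  rw [LinearMap.sub_apply, map_sub, Module.End.mul_apply, Module.End.mul_apply, osc_vac hn.le,
    map_zero, map_zero, sub_zero]
  have h2 := (locFin_osc (-l)).map_locSum_apply (fockBasis.coord ∅ ∘ₗ osc n) vac
  rw [LinearMap.comp_apply] at h2
  rw [show osc (-l) = locSum fockBasis fun k : ℤ => normalOrder [.psi (-l - k - 1), .psiStar k]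
    from rfl, h2]
  simp only [LinearMap.comp_apply, h1]
  split_ifs with h3
  · rw [finsum_eq_sum_of_support_subset (s := Finset.Ico (-l) 0)]
    · rw [Finset.sum_congr rfl (g := fun _ => (1 : ℂ))]
      · rw [Finset.sum_const, Int.card_Ico, nsmul_eq_mul, mul_one, h3]
        rw [← Int.cast_natCast]
        congr 1
        omega
      · intro k hk
        simp only [Finset.mem_Ico] at hk
        rw [if_pos ⟨hk, h3⟩]
    · intro k hk
      simp only [Function.mem_support, ne_eq, ite_eq_right_iff, one_ne_zero, imp_false, not_not]
        at hk
      simpa using hk.1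
  · simp [h3]

/-- The commutator commutes with every mode, since oscillators act on modes by shifts of the index
and shifts commute. It therefore maps the vacuum to a vector killed by all annihilators, is a
scalar, and the scalar is a vacuum expectation value. -/
theorem osc_commutator (n m : ℤ) :
    osc n * osc m - osc m * osc n = if n + m = 0 then (n : ℂ) • 1 else 0 := by
  set X := osc n * osc m - osc m * osc n with hX
  have hψ : ∀ a, X * ψ a = ψ a * X := fun a => by
    have e : ∀ n m : ℤ, osc n * osc m * ψ a =
        ψ a * osc n * osc m + ψ (a + n) * osc m + ψ (a + m) * osc n + ψ (a + (m + n)) := by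
      intro n m
      rw [mul_assoc, osc_mul_ψ, mul_add, ← mul_assoc, osc_mul_ψ, osc_mul_ψ, add_mul, add_assoc a]
      abel
    rw [hX, sub_mul, e, e, mul_sub, add_comm m n, ← mul_assoc, ← mul_assoc]
    abel
  have hdel : ∀ a, X * del a = del a * X := fun a => by
    have e : ∀ n m : ℤ, osc n * osc m * del a =
        del a * osc n * osc m - del (a - n) * osc m - del (a - m) * osc n + del (a - (m + n)) := by
      intro n m
      rw [mul_assoc, osc_mul_del, mul_sub, ← mul_assoc, osc_mul_del, osc_mul_del, sub_mul,
        sub_sub a]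
      abel
    rw [hX, sub_mul, e, e, mul_sub, add_comm m n, ← mul_assoc, ← mul_assoc]
    abel
  have hc : ∀ j, X * create j = create j * X := fun j => by
    rcases lt_or_ge j 0 with hj | hj
    · rw [← ψ_of_neg hj, hψ]
    · rw [← del_of_nonneg hj, hdel]
  have ha : ∀ j, X * annihilate j = annihilate j * X := fun j => by
    rcases lt_or_ge j 0 with hj | hj
    · rw [← del_of_neg hj, hdel]
    · rw [← ψ_of_nonneg hj, hψ]
  have hv := eq_smul_vac (v := X vac) fun j => by
    rw [← Module.End.mul_apply, ← ha, Module.End.mul_apply, annihilate_vac, map_zero]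
  rw [eq_smul_one_of_commute hc hv]
  -- Only opposite signs of `n` and `m` matter, and antisymmetry reduces them to `n > 0 > m`. In the
  -- other cases both products vanish between vacua.
  have key : fockBasis.coord ∅ (X vac) = if n + m = 0 then (n : ℂ) else 0 := by
    rcases lt_or_ge 0 n with hn | hn
    · rcases lt_or_ge m 0 with hm | hm
      · have := coord_empty_commutator_osc_vac hn (l := -m)
        rw [neg_neg] at this
        rw [this]
        simp only [show n = -m ↔ n + m = 0 by omega]
      · rw [hX, LinearMap.sub_apply, Module.End.mul_apply, Module.End.mul_apply, osc_vac hn.le,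
          osc_vac hm, map_zero, map_zero, sub_zero, map_zero, if_neg (by omega)]
    · rcases lt_or_ge 0 m with hm | hm
      · rcases lt_or_ge n 0 with hn' | hn'
        · have := coord_empty_commutator_osc_vac hm (l := -n)
          rw [neg_neg, ← neg_sub, ← hX, LinearMap.neg_apply, map_neg, neg_eq_iff_eq_neg] at this
          rw [this]
          by_cases h : n + m = 0
          · rw [if_pos (by omega), if_pos h, show m = -n by omega]
            simp
          · rw [if_neg (by omega), if_neg h, neg_zero]
        · obtain rfl : n = 0 := le_antisymm hn hn'
          rw [hX, LinearMap.sub_apply, Module.End.mul_apply, Module.End.mul_apply, osc_vac le_rfl,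
            osc_vac hm.le, map_zero, map_zero, sub_zero, map_zero, if_neg (by omega)]
      · rw [hX, LinearMap.sub_apply, map_sub, Module.End.mul_apply, Module.End.mul_apply,
          coord_empty_osc hn, coord_empty_osc hm, sub_zero]
        split_ifs with h
        · rw [show n = 0 by omega]; simp
        · rfl
  rw [key]
  split_ifs <;> simp

theorem osc_commute {n m : ℤ} (h : n + m ≠ 0) : Commute (osc n) (osc m) := by
  have := osc_commutator n m
  rw [if_neg h] at this
  exact sub_eq_zero.1 this

theorem BoundedBy.osc_apply {B : ℤ} {S : Finset ℤ} (h : BoundedBy B S) {p : ℤ} (hp : 0 < p)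
    (hp' : 2 * B ≤ p) : osc p (fockBasis S) = 0 := by
  have := h.1
  rw [osc, (locFin_osc p).locSum_apply]
  refine finsum_eq_zero_of_forall_eq_zero fun k => ?_
  rw [normalOrder_psi_psiStar]
  split_ifs with hk
  · rw [Module.End.mul_apply, h.del_apply (by omega), map_zero]
  · by_cases ha : B ≤ p - k - 1
    · rw [LinearMap.neg_apply, Module.End.mul_apply, h.ψ_apply ha, map_zero, neg_zero]
    · rw [del_mul_ψ_of_ne (by omega), neg_neg, Module.End.mul_apply, h.del_apply (by omega),
        map_zero]

theorem exists_osc_apply_eq_zero (v : Fock) : ∃ P : ℕ, ∀ p : ℤ, P < p → osc p v = 0 := by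
  induction fockBasis.mem_span v using Submodule.span_induction with
  | mem x hx =>
    obtain ⟨S, rfl⟩ := hx
    obtain ⟨B, hB⟩ := exists_boundedBy S
    have := hB.1
    exact ⟨(2 * B).toNat, fun p hp => hB.osc_apply (by omega) (by omega)⟩
  | zero => exact ⟨0, fun p _ => map_zero _⟩
  | add x y _ _ hx hy =>
    obtain ⟨P, hP⟩ := hx
    obtain ⟨Q, hQ⟩ := hy
    refine ⟨max P Q, fun p hp => ?_⟩
    push_cast at hp
    rw [map_add, hP p (by omega), hQ p (by omega), add_zero]
  | smul a x _ hx =>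
    obtain ⟨P, hP⟩ := hx
    exact ⟨P, fun p hp => by rw [map_smul, hP p hp, smul_zero]⟩

/-! ### Bosonization -/

theorem bosonize_monomial (m : ℕ+ →₀ ℕ) : bosonize (monomial m 1) =
    ((m.support.sort (· ≤ ·)).map fun n : ℕ+ => osc (-n) ^ m n).prod vac := by
  rw [bosonize]
  exact Module.Basis.constr_basis _ _ _ _

theorem creation_commute (n m : ℕ+) : Commute (osc (-(n : ℤ))) (osc (-(m : ℤ))) := by
  have := n.pos
  have := m.pos
  exact osc_commute (by omega)

/-- Creation oscillators commute, so any one factor can be brought to the front of the sorted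
product that defines `bosonize`. -/
theorem sort_map_prod_eq (m : ℕ+ →₀ ℕ) (n : ℕ+) :
    ((m.support.sort (· ≤ ·)).map fun k : ℕ+ => osc (-k) ^ m k).prod =
      osc (-n) ^ m n *
        (((m.support.erase n).sort (· ≤ ·)).map fun k : ℕ+ => osc (-k) ^ m k).prod := by
  by_cases hn : n ∈ m.support
  · have hp : (m.support.sort (· ≤ ·)).Perm (n :: (m.support.erase n).sort (· ≤ ·)) := by
      rw [List.perm_ext_iff_of_nodup (Finset.sort_nodup _ _)]
      · intro a
        simp only [Finset.mem_sort, List.mem_cons, Finset.mem_erase]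
        by_cases h : a = n
        · simpa [h] using hn
        · simp [h]
      · rw [List.nodup_cons]
        exact ⟨by simp, Finset.sort_nodup _ _⟩
    rw [(hp.map _).prod_eq', List.map_cons, List.prod_cons]
    refine List.pairwise_map.2 (List.pairwise_of_forall fun a b => ?_)
    exact (creation_commute a b).pow_pow _ _
  · rw [Finset.erase_eq_of_notMem hn, Finsupp.notMem_support_iff.1 hn, pow_zero, one_mul]

theorem bosonize_X_mul (n : ℕ+) (g : BosonFock) :
    bosonize (X n * g) = osc (-n) (bosonize g) := by
  have : bosonize ∘ₗ LinearMap.mulLeft ℂ (X n) = osc (-n) ∘ₗ bosonize := by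
    refine (basisMonomials ℕ+ ℂ).ext fun m => ?_
    simp only [coe_basisMonomials, LinearMap.comp_apply, LinearMap.mulLeft_apply]
    have e : (X n : BosonFock) * monomial m 1 = monomial (m + Finsupp.single n 1) 1 := by
      rw [X, monomial_mul, one_mul, add_comm]
    rw [e, bosonize_monomial, bosonize_monomial, sort_map_prod_eq _ n, sort_map_prod_eq m n,
      ← Module.End.mul_apply, ← mul_assoc]
    congr 2
    · simp [pow_succ']
    · have hs : (m + Finsupp.single n 1).support.erase n = m.support.erase n := by
        ext a
        by_cases h : a = n
        · simp [h]
        · simp [h]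
      rw [hs]
      congr 1
      refine List.map_congr_left fun a ha => ?_
      have : a ≠ n := by
        simp only [Finset.mem_sort, Finset.mem_erase] at ha
        exact ha.1
      simp [this.symm]
  exact LinearMap.congr_fun this g

theorem bosonize_C (a : ℂ) : bosonize (C a) = a • vac := by
  have : (C a : BosonFock) = a • monomial 0 1 := by
    rw [smul_monomial, smul_eq_mul, mul_one]; rfl
  rw [this, map_smul, bosonize_monomial]
  simp

theorem bosonize_bosonCreate (n : ℕ+) (g : BosonFock) :
    bosonize (bosonCreate n g) = osc (-n) (bosonize g) := bosonize_X_mul n g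

theorem bosonAnnihilate_X_mul (n k : ℕ+) (g : BosonFock) : bosonAnnihilate n (X k * g) =
    X k * bosonAnnihilate n g + if n = k then (n : ℂ) • g else 0 := by
  simp only [bosonAnnihilate, LinearMap.smul_apply, Derivation.coeFn_coe, Derivation.leibniz,
    pderiv_X, smul_add, smul_eq_mul, mul_smul_comm]
  congr 1
  split_ifs with h
  · simp [h]
  · simp [Ne.symm h]

/-- Both operators kill the constant state and satisfy the same commutation relation with the
creation oscillators, so induction on the polynomial identifies them. -/
theorem bosonize_bosonAnnihilate (n : ℕ+) (g : BosonFock) :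
    bosonize (bosonAnnihilate n g) = osc n (bosonize g) := by
  induction g using MvPolynomial.induction_on with
  | C a =>
    rw [bosonize_C, map_smul, osc_vac (by positivity), smul_zero]
    simp [bosonAnnihilate]
  | add p q hp hq => rw [map_add, map_add, map_add, map_add, hp, hq]
  | mul_X g k hg =>
    rw [mul_comm, bosonAnnihilate_X_mul, map_add, bosonize_X_mul, bosonize_X_mul, hg,
      ← Module.End.mul_apply, ← Module.End.mul_apply, eq_comm, ← sub_eq_iff_eq_add',
      ← LinearMap.sub_apply, osc_commutator]
    have : ((n : ℕ) : ℤ) + -((k : ℕ) : ℤ) = 0 ↔ n = k := by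
      rw [← PNat.coe_inj]; omega
    simp only [this]
    split_ifs <;> simp

theorem coord_empty_bosonize (g : BosonFock) :
    fockBasis.coord ∅ (bosonize g) = constantCoeff g := by
  induction g using MvPolynomial.induction_on with
  | C a => rw [bosonize_C]; simp [vac]
  | add p q hp hq => rw [map_add, map_add, map_add, hp, hq]
  | mul_X g k hg =>
    rw [mul_comm, bosonize_X_mul, coord_empty_osc (by simp)]
    simp

/-- Every coefficient of `g` is, up to a nonzero factor, the constant term of an iterated
derivative. Derivatives are annihilation oscillators, and the constant term is the vacuum component
of the state. -/
theorem bosonize_injective : Function.Injective bosonize := by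
  rw [← LinearMap.ker_eq_bot, LinearMap.ker_eq_bot']
  have key : ∀ d : ℕ, ∀ m : ℕ+ →₀ ℕ, m.degree = d → ∀ g : BosonFock, bosonize g = 0 →
      g.coeff m = 0 := by
    intro d
    induction d with
    | zero =>
      intro m hm g hg
      rw [Finsupp.degree_eq_zero_iff] at hm
      rw [hm, ← constantCoeff_eq, ← coord_empty_bosonize, hg, map_zero]
    | succ d ih =>
      intro m hm g hg
      obtain ⟨n, hn⟩ : ∃ n, m n ≠ 0 := by
        by_contra hc
        push Not at hc
        have : m = 0 := Finsupp.ext hc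
        simp [this] at hm
      have h1 : bosonize (bosonAnnihilate n g) = 0 := by
        rw [bosonize_bosonAnnihilate, hg, map_zero]
      have hm' : m - Finsupp.single n 1 + Finsupp.single n 1 = m := by
        refine tsub_add_cancel_of_le ?_
        rw [Finsupp.single_le_iff]
        omega
      have h2 := ih (m - Finsupp.single n 1) (by
        have := congrArg Finsupp.degree hm'
        rw [map_add, Finsupp.degree_single, hm] at this
        omega) _ h1
      rw [bosonAnnihilate, LinearMap.smul_apply, coeff_smul, Derivation.coeFn_coe, coeff_pderiv,
        hm'] at h2
      have h3 : ((n : ℕ) : ℂ) ≠ 0 := Nat.cast_ne_zero.2 n.pos.ne'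
      rw [smul_eq_zero] at h2
      have h4 := h2.resolve_left h3
      rw [mul_eq_zero] at h4
      refine h4.resolve_right ?_
      exact Nat.cast_add_one_ne_zero _
  intro g hg
  ext m
  rw [key _ m rfl g hg, coeff_zero]

end

/-! ### Oscillator Hamiltonians and the rescaling by `D`. -/

section

/-! ### The Hamiltonians on the bosonic side -/

theorem locSum_const_smul {κ M ι : Type*} [AddCommGroup M] [Module ℂ M] {B : Module.Basis κ ℂ M}
    {T : ι → Module.End ℂ M} (h : LocFin B T) (a : ℂ) :
    locSum B (fun i => a • T i) = a • locSum B T := by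
  refine LinearMap.ext fun v => ?_
  rw [LinearMap.smul_apply, h.locSum_apply, (h.smul fun _ => a).locSum_apply, smul_finsum]
  rfl

/-- Two locally finite families that are intertwined have intertwined sums. -/
theorem LocFin.intertwine {κ κ' M M' ι : Type*} [AddCommGroup M] [Module ℂ M] [AddCommGroup M']
    [Module ℂ M'] {B : Module.Basis κ ℂ M} {B' : Module.Basis κ' ℂ M'}
    {T : ι → Module.End ℂ M} {T' : ι → Module.End ℂ M'} (h : LocFin B T) (h' : LocFin B' T')
    (X : M →ₗ[ℂ] M') (hX : ∀ i v, X (T i v) = T' i (X v)) (v : M) :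
    X (locSum B T v) = locSum B' T' (X v) := by
  rw [h.map_locSum_apply, h'.locSum_apply]
  exact finsum_congr fun i => hX i v

/-! ### The Hamiltonian on the bosonic Fock space -/

theorem finite_add_le (P : ℕ) : {p : ℕ+ × ℕ+ | (p.1 + p.2 : ℕ) ≤ P}.Finite := by
  refine ((Set.finite_Iic P.succPNat).prod (Set.finite_Iic P.succPNat)).subset fun p hp => ?_
  simp only [Set.mem_ofPred_eq] at hp
  constructor <;>
  · rw [Set.mem_Iic, ← PNat.coe_le_coe, Nat.succPNat_coe]
    omega

theorem finite_le_prod (P : ℕ) : {p : ℕ+ × ℕ+ | (p.1 : ℕ) ≤ P ∧ (p.2 : ℕ) ≤ P}.Finite :=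
  (finite_add_le (2 * P)).subset fun p hp => by
    simp only [Set.mem_ofPred_eq] at hp ⊢
    omega

theorem finite_pnat_le (P : ℕ) : {p : ℕ+ | (p : ℕ) ≤ P}.Finite := by
  refine (Set.finite_Iic P.succPNat).subset fun p hp => ?_
  simp only [Set.mem_ofPred_eq] at hp
  rw [Set.mem_Iic, ← PNat.coe_le_coe, Nat.succPNat_coe]
  omega

theorem exists_bosonAnnihilate_eq_zero (g : BosonFock) :
    ∃ P : ℕ, ∀ p : ℕ+, P < p → bosonAnnihilate p g = 0 := by
  refine ⟨∑ p ∈ g.vars, (p : ℕ), fun p hp => ?_⟩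
  rw [bosonAnnihilate, LinearMap.smul_apply, Derivation.coeFn_coe,
    pderiv_eq_zero_of_notMem_vars, smul_zero]
  intro hv
  have := Finset.single_le_sum (f := fun p : ℕ+ => (p : ℕ)) (fun _ _ => Nat.zero_le _) hv
  omega

/-- Transported from the Fock space, where the oscillators with positive index commute. -/
theorem bosonAnnihilate_comm (n m : ℕ+) (g : BosonFock) :
    bosonAnnihilate n (bosonAnnihilate m g) = bosonAnnihilate m (bosonAnnihilate n g) := by
  apply bosonize_injective
  simp only [bosonize_bosonAnnihilate]
  rw [← Module.End.mul_apply, ← Module.End.mul_apply, (osc_commute (n := n) (m := m) (by have := n.pos; omega)).eq]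

theorem locFin_cubic_up : LocFin bosonBasis fun p : ℕ+ × ℕ+ =>
    bosonCreate p.1 * bosonCreate p.2 * bosonAnnihilate (p.1 + p.2) := by
  refine LocFin.mul_left (.of_forall_finite fun g => ?_) _
  obtain ⟨P, hP⟩ := exists_bosonAnnihilate_eq_zero g
  refine (finite_add_le P).subset fun p hp => ?_
  by_contra h
  exact hp (hP _ (by rw [PNat.add_coe]; simpa using h))

theorem locFin_cubic_down : LocFin bosonBasis fun p : ℕ+ × ℕ+ =>
    bosonCreate (p.1 + p.2) * bosonAnnihilate p.1 * bosonAnnihilate p.2 := by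
  simp only [mul_assoc]
  refine LocFin.mul_left (.of_forall_finite fun g => ?_) _
  obtain ⟨P, hP⟩ := exists_bosonAnnihilate_eq_zero g
  refine (finite_le_prod P).subset fun p hp => ?_
  by_contra h
  simp only [Set.mem_ofPred_eq, not_and_or, not_le] at h
  rcases h with h | h
  · exact hp (by beta_reduce; rw [Module.End.mul_apply, bosonAnnihilate_comm, hP _ h, map_zero])
  · exact hp (by beta_reduce; rw [Module.End.mul_apply, hP _ h, map_zero])

theorem locFin_quadratic : LocFin bosonBasis fun n : ℕ+ =>
    (n : ℂ) • (bosonCreate n * bosonAnnihilate n) := by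
  refine LocFin.smul (LocFin.mul_left (.of_forall_finite fun g => ?_) _) _
  obtain ⟨P, hP⟩ := exists_bosonAnnihilate_eq_zero g
  refine (finite_pnat_le P).subset fun p hp => ?_
  by_contra h
  exact hp (hP _ (by simpa using h))

/-- `∑ a_{-n} a_{-m} a_{n+m}`. -/
def cubicUp : Module.End ℂ BosonFock := locSum bosonBasis fun p : ℕ+ × ℕ+ =>
  bosonCreate p.1 * bosonCreate p.2 * bosonAnnihilate (p.1 + p.2)

/-- `∑ a_{-n-m} a_n a_m`. -/
def cubicDown : Module.End ℂ BosonFock := locSum bosonBasis fun p : ℕ+ × ℕ+ =>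
  bosonCreate (p.1 + p.2) * bosonAnnihilate p.1 * bosonAnnihilate p.2

/-- `∑ n a_{-n} a_n`. -/
def quadratic : Module.End ℂ BosonFock := locSum bosonBasis fun n : ℕ+ =>
  (n : ℂ) • (bosonCreate n * bosonAnnihilate n)

theorem locFin_osc_cubic_up : LocFin fockBasis fun p : ℕ+ × ℕ+ =>
    osc (-p.1) * osc (-p.2) * osc (p.1 + p.2) := by
  refine LocFin.mul_left (.of_forall_finite fun g => ?_) _
  obtain ⟨P, hP⟩ := exists_osc_apply_eq_zero g
  refine (finite_add_le P).subset fun p hp => ?_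
  by_contra h
  simp only [Set.mem_ofPred_eq] at h
  exact hp (hP _ (by omega))

theorem locFin_osc_cubic_down : LocFin fockBasis fun p : ℕ+ × ℕ+ =>
    osc (-p.1 - p.2) * osc p.1 * osc p.2 := by
  simp only [mul_assoc]
  refine LocFin.mul_left (.of_forall_finite fun g => ?_) _
  obtain ⟨P, hP⟩ := exists_osc_apply_eq_zero g
  refine (finite_le_prod P).subset fun p hp => ?_
  by_contra h
  simp only [Set.mem_ofPred_eq, not_and_or, not_le] at h
  have := p.1.pos
  rcases h with h | h
  · exact hp (by beta_reduce; rw [(osc_commute (n := p.1) (m := p.2) (by omega)).eq, Module.End.mul_apply,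
      hP _ (by omega), map_zero])
  · exact hp (by beta_reduce; rw [Module.End.mul_apply, hP _ (by omega), map_zero])

theorem locFin_osc_quadratic : LocFin fockBasis fun n : ℕ+ => (n : ℂ) • (osc (-n) * osc n) := by
  refine LocFin.smul (LocFin.mul_left (.of_forall_finite fun g => ?_) _) _
  obtain ⟨P, hP⟩ := exists_osc_apply_eq_zero g
  refine (finite_pnat_le P).subset fun p hp => ?_
  by_contra h
  simp only [Set.mem_ofPred_eq] at h
  exact hp (hP _ (by omega))

theorem bosonize_cubicUp (g : BosonFock) : bosonize (cubicUp g) =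
    locSum fockBasis (fun p : ℕ+ × ℕ+ => osc (-p.1) * osc (-p.2) * osc (p.1 + p.2))
      (bosonize g) := by
  refine locFin_cubic_up.intertwine locFin_osc_cubic_up _ (fun p v => ?_) g
  simp only [Module.End.mul_apply, bosonize_bosonCreate, bosonize_bosonAnnihilate, PNat.add_coe,
    Nat.cast_add]

theorem bosonize_cubicDown (g : BosonFock) : bosonize (cubicDown g) =
    locSum fockBasis (fun p : ℕ+ × ℕ+ => osc (-p.1 - p.2) * osc p.1 * osc p.2)
      (bosonize g) := by
  refine locFin_cubic_down.intertwine locFin_osc_cubic_down _ (fun p v => ?_) g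
  simp only [Module.End.mul_apply, bosonize_bosonCreate, bosonize_bosonAnnihilate, PNat.add_coe,
    Nat.cast_add, neg_add']

theorem bosonize_quadratic (g : BosonFock) : bosonize (quadratic g) =
    locSum fockBasis (fun n : ℕ+ => (n : ℂ) • (osc (-n) * osc n)) (bosonize g) := by
  refine locFin_quadratic.intertwine locFin_osc_quadratic _ (fun p v => ?_) g
  simp only [Module.End.mul_apply, LinearMap.smul_apply, map_smul, bosonize_bosonCreate,
    bosonize_bosonAnnihilate]

theorem H0_bosonize (g : BosonFock) : H0 (bosonize g) = bosonize (cubicUp g + cubicDown g) := by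
  rw [map_add, bosonize_cubicUp, bosonize_cubicDown, H0,
    locFin_osc_cubic_up.locSum_add locFin_osc_cubic_down, LinearMap.add_apply]

/-- The operator `∑ n a_{-n} a_n - ∑ a_{-n} a_{-m} a_{n+m}` on the bosonic Fock space. -/
def interaction : Module.End ℂ BosonFock := quadratic - cubicUp

theorem Hint_bosonize (b : ℝ) (g : BosonFock) :
    Hint b (bosonize g) = (1 - (b : ℂ) ^ 2) • bosonize (interaction g) := by
  rw [interaction, LinearMap.sub_apply, map_sub, bosonize_cubicUp, bosonize_quadratic, Hint]
  rfl

/-! ### The similarity transformation -/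

theorem exp_neg_log_mul {b : ℝ} (hb : 0 < b) (d : ℕ) :
    Complex.exp (-(Real.log b : ℂ) * d) = ((b : ℂ)⁻¹) ^ d := by
  rw [mul_comm, Complex.exp_nat_mul, ← Complex.ofReal_neg, ← Complex.ofReal_exp, Real.exp_neg,
    Real.exp_log hb, Complex.ofReal_inv]

theorem similarity_monomial {b : ℝ} (hb : 0 < b) (m : ℕ+ →₀ ℕ) :
    similarity b (monomial m 1) = ((b : ℂ)⁻¹) ^ m.degree • monomial m 1 := by
  rw [← exp_neg_log_mul hb, similarity]
  exact Module.Basis.constr_basis _ _ _ _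

theorem similarity_X_mul {b : ℝ} (hb : 0 < b) (n : ℕ+) (g : BosonFock) :
    similarity b (X n * g) = (b : ℂ)⁻¹ • (X n * similarity b g) := by
  have : similarity b ∘ₗ LinearMap.mulLeft ℂ (X n) =
      (b : ℂ)⁻¹ • (LinearMap.mulLeft ℂ (X n) ∘ₗ similarity b) := by
    refine (basisMonomials ℕ+ ℂ).ext fun m => ?_
    simp only [coe_basisMonomials, LinearMap.comp_apply, LinearMap.mulLeft_apply,
      LinearMap.smul_apply]
    have e : (X n : BosonFock) * monomial m 1 = monomial (m + Finsupp.single n 1) 1 := by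
      rw [X, monomial_mul, one_mul, add_comm]
    rw [e, similarity_monomial hb, similarity_monomial hb, mul_smul_comm, e, smul_smul, map_add,
      Finsupp.degree_single, pow_succ']
  exact LinearMap.congr_fun this g

theorem similarity_C {b : ℝ} (hb : 0 < b) (a : ℂ) : similarity b (C a) = C a := by
  have : (C a : BosonFock) = a • monomial 0 1 := by
    rw [smul_monomial, smul_eq_mul, mul_one]; rfl
  rw [this, map_smul, similarity_monomial hb]
  simp

theorem bosonAnnihilate_similarity {b : ℝ} (hb : 0 < b) (n : ℕ+) (g : BosonFock) :
    bosonAnnihilate n (similarity b g) = (b : ℂ)⁻¹ • similarity b (bosonAnnihilate n g) := by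
  induction g using MvPolynomial.induction_on with
  | C a =>
    rw [similarity_C hb]
    simp [bosonAnnihilate]
  | add p q hp hq => simp only [map_add, hp, hq, smul_add]
  | mul_X g k hg =>
    rw [mul_comm, similarity_X_mul hb, map_smul, bosonAnnihilate_X_mul, bosonAnnihilate_X_mul,
      hg, map_add, similarity_X_mul hb, mul_smul_comm]
    split_ifs <;> simp

theorem bosonCreate_similarity {b : ℝ} (hb : 0 < b) (n : ℕ+) (g : BosonFock) :
    bosonCreate n (similarity b g) = (b : ℂ) • similarity b (bosonCreate n g) := by
  have hb' : (b : ℂ) ≠ 0 := Complex.ofReal_ne_zero.2 hb.ne'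
  rw [bosonCreate, LinearMap.mulLeft_apply, LinearMap.mulLeft_apply, similarity_X_mul hb,
    smul_smul, mul_inv_cancel₀ hb', one_smul]

theorem similarity_similarity_inv {b : ℝ} (hb : 0 < b) (g : BosonFock) :
    similarity b⁻¹ (similarity b g) = g := by
  have hb' : (b : ℂ) ≠ 0 := Complex.ofReal_ne_zero.2 hb.ne'
  induction g using MvPolynomial.induction_on with
  | C a => rw [similarity_C hb, similarity_C (inv_pos.2 hb)]
  | add p q hp hq => rw [map_add, map_add, hp, hq]
  | mul_X g k hg =>
    rw [mul_comm, similarity_X_mul hb, map_smul, similarity_X_mul (inv_pos.2 hb), hg, smul_smul,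
      Complex.ofReal_inv, inv_inv, inv_mul_cancel₀ hb', one_smul]

/-- `similarity b` multiplies each monomial by `b⁻¹` to the power of its degree, and `cubicUp`
raises the degree by one. In the same way `cubicDown` acquires the inverse factor and `quadratic`
none. -/
theorem cubicUp_similarity {b : ℝ} (hb : 0 < b) (g : BosonFock) :
    cubicUp (similarity b g) = (b : ℂ) • similarity b (cubicUp g) := by
  have hb' : (b : ℂ) ≠ 0 := Complex.ofReal_ne_zero.2 hb.ne'
  rw [← LinearMap.smul_apply]
  have h := locFin_cubic_up
  rw [cubicUp, h.map_locSum_apply, h.locSum_apply]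
  refine finsum_congr fun p => ?_
  simp only [Module.End.mul_apply, bosonAnnihilate_similarity hb, map_smul,
    bosonCreate_similarity hb, LinearMap.smul_apply, smul_smul]
  congr 1
  field_simp

theorem cubicDown_similarity {b : ℝ} (hb : 0 < b) (g : BosonFock) :
    (b : ℂ) • cubicDown (similarity b g) = similarity b (cubicDown g) := by
  have hb' : (b : ℂ) ≠ 0 := Complex.ofReal_ne_zero.2 hb.ne'
  have h := locFin_cubic_down
  rw [cubicDown, h.map_locSum_apply, h.locSum_apply, smul_finsum]
  refine finsum_congr fun p => ?_
  simp only [Module.End.mul_apply, bosonAnnihilate_similarity hb, map_smul,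
    bosonCreate_similarity hb, smul_smul]
  rw [show (b : ℂ) * ((b : ℂ)⁻¹ * ((b : ℂ)⁻¹ * b)) = 1 by field_simp, one_smul]

theorem quadratic_similarity {b : ℝ} (hb : 0 < b) (g : BosonFock) :
    quadratic (similarity b g) = similarity b (quadratic g) := by
  have hb' : (b : ℂ) ≠ 0 := Complex.ofReal_ne_zero.2 hb.ne'
  symm
  refine locFin_quadratic.intertwine locFin_quadratic _ (fun p v => ?_) g
  simp only [Module.End.mul_apply, LinearMap.smul_apply, bosonAnnihilate_similarity hb, map_smul,
    bosonCreate_similarity hb, smul_smul]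
  congr 1
  field_simp

/-- The factor `b` in front of the cubic terms becomes `b²` on `cubicUp` and `1` on `cubicDown`.
This equals the undeformed cubic operator plus `1 - b²` times `quadratic - cubicUp`. -/
theorem bosonHamiltonian_similarity {b : ℝ} (hb : 0 < b) (g : BosonFock) :
    bosonHamiltonian b (similarity b g) = similarity b
      (cubicUp g + cubicDown g + (1 - (b : ℂ) ^ 2) • interaction g) := by
  have h : bosonHamiltonian b =
      (b : ℂ) • (cubicUp + cubicDown) + (1 - (b : ℂ) ^ 2) • quadratic := by
    rw [bosonHamiltonian, locSum_const_smul (locFin_cubic_up.add locFin_cubic_down),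
      locFin_cubic_up.locSum_add locFin_cubic_down]
    rfl
  rw [h]
  simp only [LinearMap.add_apply, LinearMap.smul_apply, smul_add, cubicDown_similarity hb,
    cubicUp_similarity hb, quadratic_similarity hb, interaction, LinearMap.sub_apply, map_add,
    map_smul, map_sub]
  module

/-- The polynomial in `N` variables obtained by substituting the power sums. -/
def powerSumEval (N : ℕ) : BosonFock →ₐ[ℂ] MvPolynomial (Fin N) ℂ :=
  aeval fun n : ℕ+ => psum (Fin N) ℂ n

/-- Each oscillator contributes `b` from the substitution of power sums and `b⁻¹` from `D`. -/
theorem waveFunction_similarity {b : ℝ} (hb : 0 < b) (N : ℕ) (g : BosonFock) :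
    waveFunction b N (similarity b g) = powerSumEval N g := by
  have hb' : (b : ℂ) ≠ 0 := Complex.ofReal_ne_zero.2 hb.ne'
  induction g using MvPolynomial.induction_on with
  | C a => simp [similarity_C hb, waveFunction, powerSumEval]
  | add p q hp hq =>
    rw [map_add, map_add, ← hp, ← hq]
    simp only [waveFunction, map_add]
  | mul_X g k hg =>
    rw [mul_comm, similarity_X_mul hb, map_mul, ← hg]
    simp only [waveFunction, powerSumEval, map_smul, map_mul, aeval_X]
    rw [mul_assoc, ← smul_eq_C_mul, smul_smul, inv_mul_cancel₀ hb', one_smul]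

end

/-! ### Oscillator operators as differential operators in `N` variables. -/

section

/-! ### The Calogero-Sutherland operator on power sums -/

/-- An operator on polynomials is determined by its values on constants and its commutators with
multiplication by variables. The oscillator operators are compared with differential operators by
matching these data. -/
theorem locSum_X_mul {ι : Type*} {T : ι → Module.End ℂ BosonFock} (h : LocFin bosonBasis T)
    (m : ℕ+) (g : BosonFock) : locSum bosonBasis T (X m * g) =
      X m * locSum bosonBasis T g + ∑ᶠ i, (T i (X m * g) - X m * T i g) := by
  have := h.commutator_apply (LinearMap.mulLeft ℂ (X m)) g
  simp only [LinearMap.sub_apply, Module.End.mul_apply, LinearMap.mulLeft_apply] at this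
  rw [← this]
  ring

theorem locSum_C {ι : Type*} {T : ι → Module.End ℂ BosonFock} (h : LocFin bosonBasis T)
    (hT : ∀ i a, T i (C a) = 0) (a : ℂ) : locSum bosonBasis T (C a) = 0 := by
  rw [h.locSum_apply]
  exact finsum_eq_zero_of_forall_eq_zero fun i => hT i a

theorem bosonAnnihilate_C (n : ℕ+) (a : ℂ) : bosonAnnihilate n (C a) = 0 := by
  simp [bosonAnnihilate]

theorem quadratic_C (a : ℂ) : quadratic (C a) = 0 :=
  locSum_C locFin_quadratic (fun n a => by simp [Module.End.mul_apply, bosonAnnihilate_C]) a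

theorem cubicUp_C (a : ℂ) : cubicUp (C a) = 0 :=
  locSum_C locFin_cubic_up (fun n a => by simp [Module.End.mul_apply, bosonAnnihilate_C]) a

theorem cubicDown_C (a : ℂ) : cubicDown (C a) = 0 :=
  locSum_C locFin_cubic_down (fun n a => by simp [Module.End.mul_apply, bosonAnnihilate_C]) a

theorem bosonCreate_apply (n : ℕ+) (g : BosonFock) : bosonCreate n g = X n * g := rfl

theorem quadratic_X_mul (m : ℕ+) (g : BosonFock) :
    quadratic (X m * g) = X m * quadratic g + ((m : ℂ) ^ 2) • (X m * g) := by
  rw [quadratic, locSum_X_mul locFin_quadratic, finsum_eq_single _ m]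
  · simp only [LinearMap.smul_apply, Module.End.mul_apply, bosonCreate_apply,
      bosonAnnihilate_X_mul, if_true]
    simp only [smul_eq_C_mul, map_pow]
    ring
  · intro n hn
    simp only [LinearMap.smul_apply, Module.End.mul_apply, bosonCreate_apply,
      bosonAnnihilate_X_mul, if_neg hn]
    simp only [smul_eq_C_mul]
    ring

/-- For `1 ≤ t < m` both `t` and `m - t` are positive, so the default value of `Nat.toPNat'` never
occurs. -/
theorem finsum_add_eq (m : ℕ+) {A : Type*} [AddCommMonoid A] (F : ℕ+ → ℕ+ → A) :
    ∑ᶠ p : ℕ+ × ℕ+, (if p.1 + p.2 = m then F p.1 p.2 else 0) =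
      ∑ t ∈ Finset.Ico 1 (m : ℕ), F t.toPNat' ((m : ℕ) - t).toPNat' := by
  have hlt : ∀ p : ℕ+ × ℕ+, p.1 + p.2 = m → (p.1 : ℕ) + p.2 = m := fun p hp => by
    rw [← hp, PNat.add_coe]
  rw [finsum_eq_sum_of_support_subset (s := (Finset.Iio m ×ˢ Finset.Iio m).filter
    fun p => p.1 + p.2 = m)]
  · refine Finset.sum_bij' (fun p _ => (p.1 : ℕ))
      (fun t _ => (t.toPNat', ((m : ℕ) - t).toPNat')) ?_ ?_ ?_ ?_ ?_
    · intro p hp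
      simp only [Finset.mem_filter] at hp
      have := hlt p hp.2
      have := p.1.pos
      have := p.2.pos
      simp only [Finset.mem_Ico]
      omega
    · intro t ht
      simp only [Finset.mem_Ico] at ht
      simp only [Finset.mem_filter, Finset.mem_product, Finset.mem_Iio, ← PNat.coe_lt_coe,
        ← PNat.coe_inj, PNat.add_coe, Nat.toPNat'_coe]
      split_ifs <;> omega
    · intro p hp
      simp only [Finset.mem_filter] at hp
      have := hlt p hp.2
      have := p.1.pos
      have := p.2.pos
      ext1 <;> simp only [← PNat.coe_inj, Nat.toPNat'_coe] <;> split_ifs <;> omega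
    · intro t ht
      simp only [Finset.mem_Ico] at ht
      simp only [Nat.toPNat'_coe]
      split_ifs <;> omega
    · intro p hp
      simp only [Finset.mem_filter] at hp
      have := hlt p hp.2
      have := p.1.pos
      have := p.2.pos
      rw [if_pos hp.2]
      congr 1 <;> simp only [← PNat.coe_inj, Nat.toPNat'_coe] <;> split_ifs <;> omega
  · intro p hp
    simp only [Function.mem_support, ne_eq, ite_eq_right_iff, Classical.not_imp] at hp
    have := hlt p hp.1
    have := p.1.pos
    have := p.2.pos
    simp only [Finset.coe_filter, Finset.mem_product, Finset.mem_Iio, ← PNat.coe_lt_coe,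
      Set.mem_ofPred_eq]
    exact ⟨by omega, hp.1⟩

theorem cubicUp_X_mul (m : ℕ+) (g : BosonFock) : cubicUp (X m * g) = X m * cubicUp g +
    ((m : ℂ) • ∑ t ∈ Finset.Ico 1 (m : ℕ), X t.toPNat' * X ((m : ℕ) - t).toPNat') * g := by
  rw [cubicUp, locSum_X_mul locFin_cubic_up]
  congr 1
  rw [Finset.smul_sum, Finset.sum_mul,
    ← finsum_add_eq m fun p q => (m : ℂ) • (X p * X q : BosonFock) * g]
  refine finsum_congr fun p => ?_
  simp only [Module.End.mul_apply, bosonCreate_apply, bosonAnnihilate_X_mul]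
  split_ifs with h
  · rw [h]
    simp only [smul_eq_C_mul]
    ring
  · ring

/-- `∑_n a_{-n-m} a_n`. -/
def shiftOp (m : ℕ+) : Module.End ℂ BosonFock := locSum bosonBasis fun n : ℕ+ =>
  bosonCreate (m + n) * bosonAnnihilate n

theorem locFin_shiftOp (m : ℕ+) : LocFin bosonBasis fun n : ℕ+ =>
    bosonCreate (m + n) * bosonAnnihilate n := by
  refine LocFin.mul_left (.of_forall_finite fun g => ?_) _
  obtain ⟨P, hP⟩ := exists_bosonAnnihilate_eq_zero g
  refine (finite_pnat_le P).subset fun p hp => ?_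
  by_contra h
  exact hp (hP _ (by simpa using h))

theorem shiftOp_X_mul (m k : ℕ+) (g : BosonFock) :
    shiftOp m (X k * g) = X k * shiftOp m g + (k : ℂ) • (X (m + k) * g) := by
  rw [shiftOp, locSum_X_mul (locFin_shiftOp m), finsum_eq_single _ k]
  · simp only [Module.End.mul_apply, bosonCreate_apply,
      bosonAnnihilate_X_mul, if_true]
    simp only [smul_eq_C_mul]
    ring
  · intro n hn
    simp only [Module.End.mul_apply, bosonCreate_apply,
      bosonAnnihilate_X_mul, if_neg hn]
    ring

theorem finsum_prod_fst_eq {α β A : Type*} [DecidableEq α] [AddCommMonoid A] (m : α)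
    (F : β → A) : ∑ᶠ p : α × β, (if p.1 = m then F p.2 else 0) = ∑ᶠ n, F n := by
  have h1 : ∀ p : α × β, (if p.1 = m then F p.2 else 0) =
      ∑ᶠ (_ : p ∈ Set.range (Prod.mk m : β → α × β)), F p.2 := by
    rintro ⟨a, b⟩
    classical
    rw [finsum_eq_if]
    simp [eq_comm]
  rw [finsum_congr h1, finsum_mem_range (Prod.mk_right_injective m)]

/-- Either of the two annihilators can absorb the new variable, which gives the factor 2. Both
cannot, since the variable is multiplied only once. -/
theorem cubicDown_X_mul (m : ℕ+) (g : BosonFock) :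
    cubicDown (X m * g) = X m * cubicDown g + (2 * m : ℂ) • shiftOp m g := by
  rw [cubicDown, locSum_X_mul locFin_cubic_down]
  congr 1
  have h1 : ∀ p : ℕ+ × ℕ+, (bosonCreate (p.1 + p.2) * bosonAnnihilate p.1 * bosonAnnihilate p.2)
      (X m * g) - X m * (bosonCreate (p.1 + p.2) * bosonAnnihilate p.1 * bosonAnnihilate p.2) g =
      (if p.1 = m then (m : ℂ) • (bosonCreate (m + p.2) * bosonAnnihilate p.2) g else 0) +
      (if p.2 = m then (m : ℂ) • (bosonCreate (m + p.1) * bosonAnnihilate p.1) g else 0) := by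
    intro p
    simp only [Module.End.mul_apply, bosonCreate_apply, bosonAnnihilate_X_mul, map_add]
    by_cases h1 : p.1 = m <;> by_cases h2 : p.2 = m <;>
      simp only [h1, h2, if_true, if_false, map_smul, map_zero, add_comm m p.1] <;>
      (try simp only [smul_eq_C_mul]) <;> ring
  have hf := (locFin_shiftOp m).finite g
  have h2 : (Function.support fun p : ℕ+ × ℕ+ => if p.1 = m then
      (m : ℂ) • (bosonCreate (m + p.2) * bosonAnnihilate p.2) g else 0).Finite := by
    refine ((Set.finite_singleton m).prod hf).subset fun p hp => ?_
    simp only [Function.mem_support, ne_eq, ite_eq_right_iff, Classical.not_imp,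
      smul_eq_zero, not_or] at hp
    exact ⟨hp.1, hp.2.2⟩
  have h3 : (Function.support fun p : ℕ+ × ℕ+ => if p.2 = m then
      (m : ℂ) • (bosonCreate (m + p.1) * bosonAnnihilate p.1) g else 0).Finite := by
    refine (hf.prod (Set.finite_singleton m)).subset fun p hp => ?_
    simp only [Function.mem_support, ne_eq, ite_eq_right_iff, Classical.not_imp,
      smul_eq_zero, not_or] at hp
    exact ⟨hp.2.2, hp.1⟩
  rw [finsum_congr h1, finsum_add_distrib h2 h3]
  have h4 := finsum_prod_fst_eq (β := ℕ+) m
    fun n => (m : ℂ) • (bosonCreate (m + n) * bosonAnnihilate n) g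
  have h5 : (∑ᶠ p : ℕ+ × ℕ+, if p.2 = m then
      (m : ℂ) • (bosonCreate (m + p.1) * bosonAnnihilate p.1) g else 0) = _ :=
    (finsum_comp_equiv (Equiv.prodComm ℕ+ ℕ+) (f := fun p : ℕ+ × ℕ+ => if p.1 = m then
      (m : ℂ) • (bosonCreate (m + p.2) * bosonAnnihilate p.2) g else 0))
  rw [h5, h4, ← smul_finsum, ← (locFin_shiftOp m).locSum_apply, ← shiftOp]
  module

variable {N : ℕ}

/-- The derivation `z_i ∂_i`. -/
def theta (i : Fin N) : Derivation ℂ (MvPolynomial (Fin N) ℂ) (MvPolynomial (Fin N) ℂ) :=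
  (X i : MvPolynomial (Fin N) ℂ) • pderiv i

theorem theta_apply (i : Fin N) (Q : MvPolynomial (Fin N) ℂ) :
    theta i Q = X i * pderiv i Q := rfl

theorem theta_X (i j : Fin N) : theta i (X j) = if i = j then X i else 0 := by
  rw [theta_apply, pderiv_X]
  by_cases h : i = j
  · simp [h]
  · simp [h]

theorem theta_psum (i : Fin N) (k : ℕ) :
    theta i (psum (Fin N) ℂ k) = (k : ℂ) • X i ^ k := by
  rw [psum, map_sum, Finset.sum_eq_single i]
  · rw [Derivation.leibniz_pow, theta_X, if_pos rfl]
    rcases Nat.eq_zero_or_pos k with rfl | hk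
    · simp
    · rw [smul_eq_mul, ← pow_succ, Nat.sub_add_cancel hk, Nat.cast_smul_eq_nsmul]
  · intro j _ hj
    rw [Derivation.leibniz_pow, theta_X, if_neg (Ne.symm hj)]
    simp
  · simp

theorem theta_mul (i : Fin N) (P Q : MvPolynomial (Fin N) ℂ) :
    theta i (P * Q) = P * theta i Q + Q * theta i P := by
  rw [Derivation.leibniz, smul_eq_mul, smul_eq_mul]

theorem theta_C (i : Fin N) (a : ℂ) : theta i (C a) = 0 := by
  rw [theta_apply, pderiv_C, mul_zero]

theorem powerSumEval_X (k : ℕ+) : powerSumEval N (X k) = psum (Fin N) ℂ k := by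
  rw [powerSumEval, aeval_X]

theorem powerSumEval_C (a : ℂ) : powerSumEval N (C a) = C a := by
  rw [powerSumEval, aeval_C]; rfl

/-- Identifies the cross term in the Leibniz rule for the Laplacian. -/
theorem sum_pow_mul_theta (m : ℕ+) (g : BosonFock) :
    ∑ i, X i ^ (m : ℕ) * theta i (powerSumEval N g) = powerSumEval N (shiftOp m g) := by
  induction g using MvPolynomial.induction_on with
  | C a =>
    rw [shiftOp, locSum_C (locFin_shiftOp m)
      (fun n a => by simp [Module.End.mul_apply, bosonAnnihilate_C]), powerSumEval_C, map_zero]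
    simp
  | add p q hp hq => simp only [map_add, mul_add, Finset.sum_add_distrib, hp, hq]
  | mul_X g k hg =>
    rw [mul_comm, shiftOp_X_mul, map_add, map_smul, map_mul, map_mul, map_mul, powerSumEval_X,
      powerSumEval_X, ← hg, show psum (Fin N) ℂ (m + k : ℕ+) = ∑ i, X i ^ ((m : ℕ) + k) from rfl,
      Finset.mul_sum, Finset.sum_mul, Finset.smul_sum, ← Finset.sum_add_distrib]
    refine Finset.sum_congr rfl fun i _ => ?_
    rw [theta_mul, theta_psum, pow_add]
    simp only [smul_eq_C_mul]
    ring

/-- The operator `∑_i (z_i ∂_i)²`. -/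
def laplacian (Q : MvPolynomial (Fin N) ℂ) : MvPolynomial (Fin N) ℂ :=
  ∑ i, theta i (theta i Q)

theorem laplacian_mul (P Q : MvPolynomial (Fin N) ℂ) : laplacian (P * Q) =
    P * laplacian Q + 2 * ∑ i, theta i P * theta i Q + Q * laplacian P := by
  simp only [laplacian, Finset.mul_sum, ← Finset.sum_add_distrib]
  refine Finset.sum_congr rfl fun i _ => ?_
  simp only [theta_mul, map_add]
  ring

/-- The Laplacian multiplies the power sum of index `k` by `k²`, which is the commutator of
`quadratic`. Its cross term with the rest is `2 * k` times `shiftOp k`, which is the commutator of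
`cubicDown`. -/
theorem laplacian_powerSumEval (g : BosonFock) :
    laplacian (powerSumEval N g) = powerSumEval N (quadratic g + cubicDown g) := by
  induction g using MvPolynomial.induction_on with
  | C a =>
    rw [quadratic_C, cubicDown_C, powerSumEval_C]
    simp [laplacian]
  | add p q hp hq =>
    have : ∀ P Q : MvPolynomial (Fin N) ℂ, laplacian (P + Q) = laplacian P + laplacian Q := by
      intro P Q
      simp [laplacian, Finset.sum_add_distrib]
    simp only [map_add, this, hp, hq]
    ring
  | mul_X g k hg =>
    have h1 : laplacian (psum (Fin N) ℂ k) = ((k : ℂ) ^ 2) • psum (Fin N) ℂ k := by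
      rw [laplacian, psum, Finset.smul_sum]
      refine Finset.sum_congr rfl fun i _ => ?_
      rw [← psum, theta_psum, Derivation.map_smul, Derivation.leibniz_pow, theta_X, if_pos rfl, smul_eq_mul,
        ← pow_succ, Nat.sub_add_cancel k.pos, ← Nat.cast_smul_eq_nsmul ℂ, smul_smul, sq]
    have h2 : ∑ i, theta i (psum (Fin N) ℂ k) * theta i (powerSumEval N g) =
        (k : ℂ) • powerSumEval N (shiftOp k g) := by
      rw [← sum_pow_mul_theta, Finset.smul_sum]
      refine Finset.sum_congr rfl fun i _ => ?_
      rw [theta_psum, smul_mul_assoc]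
    rw [mul_comm, quadratic_X_mul, cubicDown_X_mul, map_mul, laplacian_mul, powerSumEval_X, h1, h2,
      hg]
    simp only [map_add, map_mul, map_smul, powerSumEval_X]
    simp only [smul_eq_C_mul, map_mul, map_ofNat]
    ring

/-- The weight `(z_i + z_j)/(z_i - z_j)` of the two-body interaction; it is `0` for `i = j`. -/
def cot (z : Fin N → ℂ) (i j : Fin N) : ℂ := (z i + z j) / (z i - z j)

theorem cot_self (z : Fin N → ℂ) (i : Fin N) : cot z i i = 0 := by simp [cot]

theorem cot_swap (z : Fin N → ℂ) (i j : Fin N) : cot z j i = -cot z i j := by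
  rw [cot, cot, ← div_neg, neg_sub, add_comm]

/-- The sum `∑_j (z_i + z_j)/(z_i - z_j)`. -/
def cotSum (z : Fin N → ℂ) (i : Fin N) : ℂ := ∑ j, cot z i j

/-- Antisymmetry of the weight folds the ordered pairs into a full double sum, turning the two-body
drift into a vector field with components `cotSum`. -/
theorem sum_sum_Ioi_eq (u : Fin N → Fin N → ℂ) (hu : ∀ i j, u j i = -u i j) (A : Fin N → ℂ) :
    ∑ i, ∑ j ∈ Finset.Ioi i, u i j * (A i - A j) = ∑ i, (∑ j, u i j) * A i := by
  have h0 : ∀ i, u i i = 0 := fun i => by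
    have := hu i i
    linear_combination this / 2
  have h1 : ∀ i, ∑ j, u i j * A i = ∑ j ∈ Finset.Ioi i, u i j * A i +
      ∑ j ∈ Finset.Iio i, u i j * A i := fun i => by
    rw [← Finset.sum_union (by
      rw [Finset.disjoint_left]
      intro a ha hb
      simp only [Finset.mem_Ioi, Finset.mem_Iio] at ha hb
      exact lt_asymm ha hb)]
    symm
    refine Finset.sum_subset (Finset.subset_univ _) fun j _ hj => ?_
    simp only [Finset.mem_union, Finset.mem_Ioi, Finset.mem_Iio, not_or, not_lt] at hj
    rw [le_antisymm hj.1 hj.2, h0, zero_mul]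
  simp only [Finset.sum_mul, h1, Finset.sum_add_distrib]
  have h2 : ∑ i, ∑ j ∈ Finset.Iio i, u i j * A i = ∑ i, ∑ j ∈ Finset.Ioi i, -(u i j * A j) := by
    rw [Finset.sum_comm' (t' := Finset.univ) (s' := fun j => Finset.Ioi j) (by simp)]
    refine Finset.sum_congr rfl fun i _ => Finset.sum_congr rfl fun j _ => ?_
    rw [hu]
    ring
  rw [h2, ← Finset.sum_add_distrib]
  refine Finset.sum_congr rfl fun i _ => ?_
  rw [← Finset.sum_add_distrib]
  exact Finset.sum_congr rfl fun j _ => by ring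

/-- The value at `z` of the two-body interaction applied to `Q`. -/
def interactionAt (z : Fin N → ℂ) (Q : MvPolynomial (Fin N) ℂ) : ℂ :=
  ∑ i, cotSum z i * eval z (theta i Q)

theorem satisfiesCS_iff (β ε : ℂ) (Q : MvPolynomial (Fin N) ℂ) :
    SatisfiesCS β ε Q ↔ ∀ z : Fin N → ℂ, Function.Injective z →
      eval z (laplacian Q) + β * interactionAt z Q = ε * eval z Q := by
  have h : ∀ z : Fin N → ℂ, interactionAt z Q = ∑ i, ∑ j ∈ Finset.Ioi i,
      (z i + z j) / (z i - z j) * (z i * eval z (pderiv i Q) - z j * eval z (pderiv j Q)) := by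
    intro z
    have := sum_sum_Ioi_eq (cot z) (cot_swap z) fun i => eval z (theta i Q)
    rw [interactionAt]
    simp only [cotSum]
    rw [← this]
    simp only [theta_apply, map_mul, eval_X]
    rfl
  simp only [SatisfiesCS, h, laplacian, map_sum, theta_apply]

theorem interactionAt_mul (z : Fin N → ℂ) (P Q : MvPolynomial (Fin N) ℂ) :
    interactionAt z (P * Q) = eval z P * interactionAt z Q + eval z Q * interactionAt z P := by
  simp only [interactionAt, Finset.mul_sum, ← Finset.sum_add_distrib, theta_mul, map_add, map_mul]
  exact Finset.sum_congr rfl fun i _ => by ring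

/-- The left side is `(x + y)(x^m - y^m)/(x - y)`. In the geometric sum times `x + y` every mixed
monomial is counted twice and the pure powers once. -/
theorem cot_mul_pow_add (z : Fin N → ℂ) {i j : Fin N} (h : z i ≠ z j) {m : ℕ} (hm : 0 < m) :
    cot z i j * z i ^ m + cot z j i * z j ^ m =
      z i ^ m + z j ^ m + 2 * ∑ t ∈ Finset.Ico 1 m, z i ^ t * z j ^ (m - t) := by
  have h0 : z i - z j ≠ 0 := sub_ne_zero.2 h
  have h1 := (Commute.all (z i) (z j)).geom_sum₂_mul m
  have h2 : ∀ x y : ℂ, (∑ t ∈ Finset.range m, x ^ t * y ^ (m - 1 - t)) * y =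
      y ^ m + ∑ t ∈ Finset.Ico 1 m, x ^ t * y ^ (m - t) := by
    intro x y
    rw [Finset.sum_mul, Finset.range_eq_Ico, Finset.sum_eq_sum_Ico_succ_bot hm]
    congr 1
    · rw [pow_zero, one_mul, ← pow_succ]
      congr 1; omega
    · refine Finset.sum_congr rfl fun t ht => ?_
      rw [Finset.mem_Ico] at ht
      rw [mul_assoc, ← pow_succ]
      congr 2; omega
  have h3 : ∀ x y : ℂ, (∑ t ∈ Finset.range m, x ^ t * y ^ (m - 1 - t)) * x =
      x ^ m + ∑ t ∈ Finset.Ico 1 m, x ^ t * y ^ (m - t) := by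
    intro x y
    rw [Finset.sum_mul]
    obtain ⟨k, rfl⟩ : ∃ k, m = k + 1 := ⟨m - 1, by omega⟩
    rw [Finset.sum_range_succ, add_comm, Finset.sum_Ico_eq_sum_range]
    congr 1
    · simp [← pow_succ]
    · refine Finset.sum_congr (by simp) fun t ht => ?_
      rw [mul_right_comm, ← pow_succ, add_comm 1 t]
      congr 2; omega
  rw [cot_swap z i j, cot]
  have h4 := h2 (z i) (z j)
  have h5 := h3 (z i) (z j)
  set G := ∑ t ∈ Finset.range m, z i ^ t * z j ^ (m - 1 - t)
  have : (z i + z j) / (z i - z j) * z i ^ m + -((z i + z j) / (z i - z j)) * z j ^ m =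
      G * (z i + z j) := by
    field_simp
    linear_combination -(z i + z j) * h1
  rw [this]
  linear_combination h4 + h5

theorem sum_cotSum_mul_pow {z : Fin N → ℂ} (hz : Function.Injective z) {m : ℕ} (hm : 0 < m) :
    ∑ i, cotSum z i * z i ^ m = ((N : ℂ) - m) * ∑ i, z i ^ m +
      ∑ t ∈ Finset.Ico 1 m, (∑ i, z i ^ t) * ∑ i, z i ^ (m - t) := by
  -- At `i = j` the left side is 0, whereas the geometric expression would give `2 * m * z i ^ m`.
  -- This correction is the origin of `-m` in the result.
  have h1 : ∀ i j, cot z i j * z i ^ m + cot z j i * z j ^ m =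
      z i ^ m + z j ^ m + 2 * ∑ t ∈ Finset.Ico 1 m, z i ^ t * z j ^ (m - t) -
        if i = j then 2 * m * z i ^ m else 0 := by
    intro i j
    split_ifs with hij
    · subst hij
      have : ∑ t ∈ Finset.Ico 1 m, z i ^ t * z i ^ (m - t) = (m - 1) * z i ^ m := by
        rw [Finset.sum_congr rfl (g := fun _ => z i ^ m)]
        · simp [Nat.cast_sub hm]
        · intro t ht
          rw [Finset.mem_Ico] at ht
          rw [← pow_add]
          congr 1; omega
      rw [cot_self, this]
      ring
    · rw [cot_mul_pow_add z (hz.ne hij) hm, sub_zero]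
  have h2 : ∑ i, ∑ j, (cot z i j * z i ^ m + cot z j i * z j ^ m) =
      2 * ∑ i, cotSum z i * z i ^ m := by
    simp only [Finset.sum_add_distrib]
    rw [Finset.sum_comm (f := fun i j => cot z j i * z j ^ m)]
    simp only [cotSum, Finset.sum_mul]
    ring
  have h3 : ∑ i, ∑ j, ∑ t ∈ Finset.Ico 1 m, z i ^ t * z j ^ (m - t) =
      ∑ t ∈ Finset.Ico 1 m, (∑ i, z i ^ t) * ∑ i, z i ^ (m - t) := by
    simp only [Finset.sum_mul_sum]
    rw [Finset.sum_congr rfl fun i _ => Finset.sum_comm (s := Finset.univ) (t := Finset.Ico 1 m)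
      (f := fun j t => z i ^ t * z j ^ (m - t)), Finset.sum_comm]
  simp only [h1, Finset.sum_sub_distrib, Finset.sum_add_distrib, ← Finset.mul_sum, h3,
    Finset.sum_const, Finset.card_univ, Fintype.card_fin, Finset.sum_ite_eq, Finset.mem_univ,
    if_true, nsmul_eq_mul] at h2
  linear_combination -h2 / 2

/-- The two-body drift is a derivation, so it suffices to know it on power sums. There it gives `k
(N - k) p_k + k ∑ p_t p_{k-t}`, that is, `N k p_k` minus the commutators of `quadratic` and
`cubicUp` combined in `interaction`. -/
theorem interactionAt_powerSumEval {z : Fin N → ℂ} (hz : Function.Injective z) (g : BosonFock) :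
    interactionAt z (powerSumEval N g) =
      eval z (N * ∑ i, theta i (powerSumEval N g) - powerSumEval N (interaction g)) := by
  have hadd : ∀ P Q : MvPolynomial (Fin N) ℂ,
      interactionAt z (P + Q) = interactionAt z P + interactionAt z Q := by
    intro P Q
    simp [interactionAt, mul_add, Finset.sum_add_distrib]
  induction g using MvPolynomial.induction_on with
  | C a =>
    rw [interaction, LinearMap.sub_apply, quadratic_C, cubicUp_C, powerSumEval_C]
    simp [interactionAt]
  | add p q hp hq =>
    simp only [map_add, hadd, hp, hq, Finset.sum_add_distrib, map_sub, map_mul]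
    ring
  | mul_X g k hg =>
    have h1 : interactionAt z (psum (Fin N) ℂ k) = k * ∑ i, cotSum z i * z i ^ (k : ℕ) := by
      rw [interactionAt, Finset.mul_sum]
      refine Finset.sum_congr rfl fun i _ => ?_
      rw [theta_psum, smul_eval, map_pow, eval_X]
      ring
    have h2 : ∑ i, theta i (psum (Fin N) ℂ k * powerSumEval N g) =
        psum (Fin N) ℂ k * ∑ i, theta i (powerSumEval N g) +
          (k : ℂ) • (psum (Fin N) ℂ k * powerSumEval N g) := by
      simp only [theta_mul, Finset.sum_add_distrib, theta_psum, ← Finset.mul_sum,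
        ← Finset.smul_sum, mul_smul_comm]
      rw [← psum, mul_comm (powerSumEval N g)]
    have h3 : ∀ t ∈ Finset.Ico 1 (k : ℕ), eval z (psum (Fin N) ℂ t.toPNat') *
        eval z (psum (Fin N) ℂ ((k : ℕ) - t).toPNat') =
        (∑ i, z i ^ t) * ∑ i, z i ^ ((k : ℕ) - t) := by
      intro t ht
      rw [Finset.mem_Ico] at ht
      simp only [psum, map_sum, map_pow, eval_X, Nat.toPNat'_coe]
      rw [if_pos (by omega), if_pos (by omega)]
    rw [mul_comm, map_mul, interactionAt_mul, powerSumEval_X, hg, h1, h2,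
      sum_cotSum_mul_pow hz k.pos, ← Finset.sum_congr rfl h3]
    simp only [interaction, LinearMap.sub_apply, quadratic_X_mul, cubicUp_X_mul, map_add, map_sub,
      map_mul, map_smul, map_sum, powerSumEval_X, smul_eval, map_natCast]
    have h4 : eval z (psum (Fin N) ℂ k) = ∑ i, z i ^ (k : ℕ) := by simp [psum]
    rw [← h4]
    ring

end

/-! ### Conjugation by the Vandermonde determinant and squeezing of exponents. -/

section

/-! ### The Vandermonde determinant -/

variable {N : ℕ}

/-- The alternant of the zero sequence. -/
def delta (N : ℕ) : MvPolynomial (Fin N) ℂ := alternant N fun _ => 0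

/-- The exponents of the alternant decrease along the columns, so the usual Vandermonde matrix
appears with its columns reversed. Only the nonvanishing of the resulting sign is used. -/
theorem delta_eq (N : ℕ) : ∃ κ : ℂ, κ ≠ 0 ∧
    delta N = C κ * ∏ i : Fin N, ∏ j ∈ Finset.Ioi i, (X j - X i) := by
  refine ⟨((Equiv.Perm.sign (Fin.revPerm : Equiv.Perm (Fin N)) : ℤ) : ℂ), ?_, ?_⟩
  · exact Int.cast_ne_zero.2 (Units.ne_zero _)
  · rw [delta, alternant, if_pos rfl, ← Matrix.det_vandermonde]
    have : (Matrix.of fun i j : Fin N => (X i : MvPolynomial (Fin N) ℂ) ^ (0 + (N - 1 - (j : ℕ))))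
        = (Matrix.vandermonde X).submatrix id (Fin.revPerm : Equiv.Perm (Fin N)) := by
      ext1 i j
      simp only [Matrix.of_apply, Matrix.submatrix_apply, Matrix.vandermonde_apply, id_eq,
        Fin.revPerm_apply, Fin.val_rev]
      congr 1
      omega
    rw [this, Matrix.det_permute']
    simp

theorem eval_delta_ne_zero {z : Fin N → ℂ} (hz : Function.Injective z) :
    eval z (delta N) ≠ 0 := by
  obtain ⟨κ, hκ, h⟩ := delta_eq N
  rw [h, map_mul, eval_C]
  refine mul_ne_zero hκ ?_
  simp only [map_prod, map_sub, eval_X]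
  refine Finset.prod_ne_zero_iff.2 fun i _ => Finset.prod_ne_zero_iff.2 fun j hj => ?_
  rw [sub_ne_zero]
  exact hz.ne (Finset.mem_Ioi.1 hj).ne'

theorem eval_delta_eq_zero {z : Fin N → ℂ} (hz : ¬ Function.Injective z) :
    eval z (delta N) = 0 := by
  obtain ⟨κ, hκ, h⟩ := delta_eq N
  rw [Function.not_injective_iff] at hz
  obtain ⟨i, j, hij, hne⟩ := hz
  wlog hlt : i < j generalizing i j
  · exact this j i hij.symm hne.symm (lt_of_le_of_ne (not_lt.1 hlt) hne.symm)
  rw [h, map_mul, map_prod]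
  refine mul_eq_zero_of_right _ (Finset.prod_eq_zero (Finset.mem_univ i) ?_)
  rw [map_prod]
  exact Finset.prod_eq_zero (Finset.mem_Ioi.2 hlt) (by simp [hij])

theorem delta_ne_zero : delta N ≠ 0 := by
  intro h
  have : Function.Injective fun i : Fin N => ((i : ℕ) : ℂ) := fun i j hij => by
    simpa [Fin.ext_iff] using hij
  exact eval_delta_ne_zero this (by rw [h, map_zero])

/-- Polynomials are determined by their values at points with distinct coordinates. -/
theorem eq_of_eval_eq {P Q : MvPolynomial (Fin N) ℂ}
    (h : ∀ z : Fin N → ℂ, Function.Injective z → eval z P = eval z Q) : P = Q := by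
  have : (P - Q) * delta N = 0 := by
    refine MvPolynomial.funext fun z => ?_
    rw [map_mul, map_zero]
    by_cases hz : Function.Injective z
    · rw [map_sub, h z hz, sub_self, zero_mul]
    · rw [eval_delta_eq_zero hz, mul_zero]
  exact sub_eq_zero.1 ((mul_eq_zero.1 this).resolve_right delta_ne_zero)

theorem eval_derivation_prod {ι : Type*}
    (D : Derivation ℂ (MvPolynomial (Fin N) ℂ) (MvPolynomial (Fin N) ℂ)) (z : Fin N → ℂ)
    (s : Finset ι) (f : ι → MvPolynomial (Fin N) ℂ) (h : ∀ e ∈ s, eval z (f e) ≠ 0) :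
    eval z (D (∏ e ∈ s, f e)) =
      eval z (∏ e ∈ s, f e) * ∑ e ∈ s, eval z (D (f e)) / eval z (f e) := by
  classical
  induction s using Finset.induction_on with
  | empty => simp
  | insert a s ha ih =>
    have h1 := ih fun e he => h e (Finset.mem_insert_of_mem he)
    have h2 := h a (Finset.mem_insert_self a s)
    rw [Finset.prod_insert ha, Finset.sum_insert ha, Derivation.leibniz, smul_eq_mul, smul_eq_mul,
      map_add, map_mul, map_mul, map_mul, h1]
    field_simp
    ring

/-- The logarithmic derivative of the product of differences is the sum of `z_i/(z_i - z_l)` over `l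
≠ i`. -/
theorem eval_theta_delta {z : Fin N → ℂ} (hz : Function.Injective z) (i : Fin N) :
    eval z (theta i (delta N)) = eval z (delta N) * ((N - 1 + cotSum z i) / 2) := by
  obtain ⟨κ, hκ, h⟩ := delta_eq N
  have h1 : ∀ k : Fin N, ∀ l ∈ Finset.Ioi k,
      eval z (X l - X k : MvPolynomial (Fin N) ℂ) ≠ 0 := by
    intro k l hl
    rw [map_sub, eval_X, eval_X, sub_ne_zero]
    exact hz.ne (Finset.mem_Ioi.1 hl).ne'
  rw [h, Derivation.leibniz, theta_C, smul_zero, add_zero, smul_eq_mul, map_mul, map_mul,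
    eval_derivation_prod]
  · rw [← mul_assoc]
    congr 1
    have h2 : ∀ k : Fin N, eval z (theta i (∏ l ∈ Finset.Ioi k, (X l - X k))) /
        eval z (∏ l ∈ Finset.Ioi k, (X l - X k)) = ∑ l ∈ Finset.Ioi k, (1 / (z k - z l)) *
          ((if i = k then z i else 0) - (if i = l then z i else 0)) := by
      intro k
      rw [eval_derivation_prod _ _ _ _ (h1 k), mul_div_cancel_left₀]
      · refine Finset.sum_congr rfl fun l hl => ?_
        have := h1 k l hl
        rw [map_sub, eval_X, eval_X] at this
        have h3 : z k - z l ≠ 0 := by rw [← neg_sub]; exact neg_ne_zero.2 this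
        rw [map_sub, theta_X, theta_X, map_sub, map_sub, eval_X, eval_X, ← neg_sub (z k),
          div_neg, ← neg_div, neg_sub, div_eq_inv_mul, one_div]
        congr 2 <;> split_ifs <;> simp
      · rw [map_prod]
        exact Finset.prod_ne_zero_iff.2 (h1 k)
    rw [Finset.sum_congr rfl fun k _ => h2 k,
      sum_sum_Ioi_eq (fun k l => 1 / (z k - z l)) fun k l => by rw [← neg_sub, div_neg]]
    simp only [mul_ite, mul_zero, Finset.sum_ite_eq, Finset.mem_univ, if_true]
    -- At `l = i` the left side and `cot` are both 0 by the convention for division by zero, so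
    -- `1/2` has to be subtracted.
    have h4 : ∀ l, 1 / (z i - z l) * z i = (1 + cot z i l) / 2 - if i = l then 1 / 2 else 0 := by
      intro l
      split_ifs with hil
      · rw [hil, cot_self]; simp
      · have : z i - z l ≠ 0 := sub_ne_zero.2 (hz.ne hil)
        rw [cot]
        field_simp
        ring
    rw [Finset.sum_mul, Finset.sum_congr rfl fun l _ => h4 l, Finset.sum_sub_distrib,
      ← Finset.sum_div, Finset.sum_add_distrib]
    simp only [Finset.sum_const, Finset.card_univ, Fintype.card_fin, Finset.sum_ite_eq,
      Finset.mem_univ, if_true, nsmul_eq_mul, mul_one, cotSum]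
    ring
  · intro k _
    rw [map_prod]
    exact Finset.prod_ne_zero_iff.2 (h1 k)

/-- The number of triples of distinct indices. -/
def tripleCount (N : ℕ) : ℂ :=
  ∑ i : Fin N, ∑ j : Fin N, ∑ k : Fin N, if i ≠ j ∧ j ≠ k ∧ i ≠ k then 1 else 0

/-- For distinct indices this is the addition theorem for cotangents with the three differences
adding up to zero. If two indices coincide, one square remains. -/
theorem cot_cyclic {z : Fin N → ℂ} (hz : Function.Injective z) (i j k : Fin N) :
    cot z i j * cot z i k + cot z j k * cot z j i + cot z k i * cot z k j =
      (if i ≠ j ∧ j ≠ k ∧ i ≠ k then 1 else 0) + (if j = k then cot z i j ^ 2 else 0) +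
        (if k = i then cot z j k ^ 2 else 0) + (if i = j then cot z k i ^ 2 else 0) := by
  by_cases hij : i = j
  · subst hij
    by_cases hik : i = k
    · subst hik; simp [cot_self]
    · simp [cot_self, hik, Ne.symm hik, sq]
  · by_cases hik : i = k
    · subst hik; simp [cot_self, hij, Ne.symm hij, sq]
    · by_cases hjk : j = k
      · subst hjk; simp [cot_self, hij, Ne.symm hij, sq]
      · have h1 : z i - z j ≠ 0 := sub_ne_zero.2 (hz.ne hij)
        have h2 : z i - z k ≠ 0 := sub_ne_zero.2 (hz.ne hik)
        have h3 : z j - z k ≠ 0 := sub_ne_zero.2 (hz.ne hjk)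
        have h4 : z j - z i ≠ 0 := sub_ne_zero.2 (hz.ne (Ne.symm hij))
        rw [cot_swap z i j, cot_swap z i k, cot_swap z j k]
        simp only [ne_eq, hij, hik, hjk, Ne.symm hik, not_false_eq_true, and_self, if_true,
          if_false, cot]
        field_simp
        ring

/-- Cyclic symmetrization of the triple sum turns the genuine three-body part into a constant,
leaving two-body terms only. -/
theorem sum_cotSum_sq {z : Fin N → ℂ} (hz : Function.Injective z) :
    ∑ i, cotSum z i ^ 2 = ∑ i, ∑ j, cot z i j ^ 2 + tripleCount N / 3 := by
  have h0 : ∀ i, cotSum z i ^ 2 = ∑ j, ∑ k, cot z i j * cot z i k := fun i => by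
    rw [sq, cotSum, Finset.sum_mul_sum]
  have h1 : ∑ i, ∑ j, ∑ k, (cot z i j * cot z i k + cot z j k * cot z j i +
      cot z k i * cot z k j) = 3 * ∑ i, cotSum z i ^ 2 := by
    simp only [Finset.sum_add_distrib, h0]
    have e1 : ∑ i, ∑ j, ∑ k, cot z j k * cot z j i = ∑ i, ∑ j, ∑ k, cot z i j * cot z i k := by
      rw [Finset.sum_comm]
      exact Finset.sum_congr rfl fun i _ => Finset.sum_comm
    have e2 : ∑ i, ∑ j, ∑ k, cot z k i * cot z k j = ∑ i, ∑ j, ∑ k, cot z i j * cot z i k := by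
      rw [Finset.sum_congr rfl fun i _ => Finset.sum_comm, Finset.sum_comm]
    rw [e1, e2]
    ring
  simp only [cot_cyclic hz, Finset.sum_add_distrib, Finset.sum_ite_eq, Finset.mem_univ,
    if_true] at h1
  have e3 : ∑ i, ∑ j, ∑ k, (if k = i then cot z j k ^ 2 else 0) = ∑ i, ∑ j, cot z i j ^ 2 := by
    simp only [Finset.sum_ite_eq', Finset.mem_univ, if_true]
    exact Finset.sum_comm
  have e4 : ∑ i, ∑ j, ∑ k, (if i = j then cot z k i ^ 2 else 0) = ∑ i, ∑ j, cot z i j ^ 2 := by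
    rw [Finset.sum_congr rfl fun i _ => Finset.sum_comm]
    simp only [Finset.sum_ite_eq, Finset.mem_univ, if_true]
    exact Finset.sum_comm
  rw [e3, e4] at h1
  rw [tripleCount]
  linear_combination -h1 / 3

theorem sum_cotSum (z : Fin N → ℂ) : ∑ i, cotSum z i = 0 := by
  have h : ∑ i, cotSum z i = -∑ i, cotSum z i := by
    simp only [cotSum]
    conv_lhs => rw [Finset.sum_comm]
    rw [← Finset.sum_neg_distrib]
    refine Finset.sum_congr rfl fun i _ => ?_
    rw [← Finset.sum_neg_distrib]
    exact Finset.sum_congr rfl fun j _ => cot_swap z i j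
  linear_combination h / 2

theorem interactionAt_delta {z : Fin N → ℂ} (hz : Function.Injective z) :
    interactionAt z (delta N) = eval z (delta N) *
      ((∑ i, ∑ j, cot z i j ^ 2) / 2 + tripleCount N / 6) := by
  have h : ∀ i, cotSum z i * (eval z (delta N) * ((N - 1 + cotSum z i) / 2)) =
      eval z (delta N) * ((N - 1) / 2 * cotSum z i + cotSum z i ^ 2 / 2) := fun i => by ring
  simp only [interactionAt, eval_theta_delta hz, h, ← Finset.mul_sum, Finset.sum_add_distrib,
    sum_cotSum, ← Finset.sum_div, sum_cotSum_sq hz]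
  ring

/-! ### Squeezing of exponents -/

/-- The value at `z` of the interaction of the particles `i` and `j` on antisymmetric functions. -/
def twoBody (z : Fin N → ℂ) (i j : Fin N) (F : MvPolynomial (Fin N) ℂ) : ℂ :=
  cot z i j * (eval z (theta i F) - eval z (theta j F)) - cot z i j ^ 2 * eval z F

theorem sum_twoBody (z : Fin N → ℂ) (F : MvPolynomial (Fin N) ℂ) :
    ∑ i, ∑ j ∈ Finset.Ioi i, twoBody z i j F =
      interactionAt z F - (∑ i, ∑ j, cot z i j ^ 2) / 2 * eval z F := by
  have h1 := sum_sum_Ioi_eq (cot z) (cot_swap z) fun i => eval z (theta i F)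
  have h2 : ∑ i, ∑ j, cot z i j ^ 2 = 2 * ∑ i, ∑ j ∈ Finset.Ioi i, cot z i j ^ 2 := by
    have := sum_sum_Ioi_eq (fun i j => cot z i j ^ 2 * if i < j then 1 else -1) (fun i j => by
      rcases lt_trichotomy i j with h | h | h
      · simp [h, h.not_gt, cot_swap z i j]
      · simp [h, cot_self]
      · simp [h, h.not_gt, cot_swap z i j]) fun i => -((i : ℕ) : ℂ)
    have h3 : ∀ i, ∑ j, cot z i j ^ 2 = ∑ j ∈ Finset.Ioi i, cot z i j ^ 2 +
        ∑ j ∈ Finset.Iio i, cot z i j ^ 2 := fun i => by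
      rw [← Finset.sum_union (by
        rw [Finset.disjoint_left]
        intro a ha hb
        simp only [Finset.mem_Ioi, Finset.mem_Iio] at ha hb
        exact lt_asymm ha hb)]
      symm
      refine Finset.sum_subset (Finset.subset_univ _) fun j _ hj => ?_
      simp only [Finset.mem_union, Finset.mem_Ioi, Finset.mem_Iio, not_or, not_lt] at hj
      rw [le_antisymm hj.1 hj.2, cot_self]
      simp
    have h4 : ∑ i, ∑ j ∈ Finset.Iio i, cot z i j ^ 2 = ∑ i, ∑ j ∈ Finset.Ioi i, cot z i j ^ 2 := by
      rw [Finset.sum_comm' (t' := Finset.univ) (s' := fun j => Finset.Ioi j) (by simp)]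
      refine Finset.sum_congr rfl fun i _ => Finset.sum_congr rfl fun j _ => ?_
      rw [cot_swap z i j, neg_sq]
    simp only [h3, Finset.sum_add_distrib, h4]
    ring
  simp only [twoBody, Finset.sum_sub_distrib, h1, h2, interactionAt, cotSum, ← Finset.sum_mul]
  ring

/-- Pairs `t` with `d - t`. For even `d` the middle term has no partner and has to vanish. -/
theorem sum_range_succ_eq_fold (d : ℕ) (f : ℕ → ℂ) (hf : ∀ k, d = 2 * k → f k = 0) :
    ∑ t ∈ Finset.range (d + 1), f t = ∑ t ∈ Finset.range ((d + 1) / 2), (f t + f (d - t)) := by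
  rw [Finset.sum_add_distrib]
  rcases Nat.even_or_odd' d with ⟨k, rfl | rfl⟩
  · rw [show 2 * k + 1 = k + (k + 1) by omega, Finset.sum_range_add, Finset.sum_range_succ',
      add_zero, hf k rfl, add_zero, show (k + (k + 1)) / 2 = k by omega,
      ← Finset.sum_range_reflect (fun t => f (k + (t + 1)))]
    congr 1
    refine Finset.sum_congr rfl fun t ht => ?_
    rw [Finset.mem_range] at ht
    congr 1; omega
  · rw [show 2 * k + 1 + 1 = (k + 1) + (k + 1) by omega, Finset.sum_range_add,
      show ((k + 1) + (k + 1)) / 2 = k + 1 by omega,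
      ← Finset.sum_range_reflect (fun t => f (k + 1 + t))]
    congr 1
    refine Finset.sum_congr rfl fun t ht => ?_
    rw [Finset.mem_range] at ht
    congr 1; omega

/-- A closed form with denominators cleared, so that it can be proved by induction on `d` from the
geometric sum. -/
theorem sq_mul_sum_weighted (x y : ℂ) (d : ℕ) :
    2 * (x - y) ^ 2 * ∑ t ∈ Finset.range (d + 1), ((d : ℂ) - 2 * t) * x ^ (d - t) * y ^ t =
      (x ^ 2 - y ^ 2) * d * (x ^ d + y ^ d) - (x + y) ^ 2 * (x ^ d - y ^ d) +
        (d + 1) * (x - y) ^ 2 * (x ^ d - y ^ d) := by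
  have hh : ∀ d : ℕ, (∑ t ∈ Finset.range (d + 1), x ^ (d - t) * y ^ t) * (x - y) =
      x ^ (d + 1) - y ^ (d + 1) := by
    intro d
    have := (Commute.all y x).geom_sum₂_mul (d + 1)
    rw [← neg_sub, mul_neg, neg_eq_iff_eq_neg, neg_sub] 
    rw [← this]
    congr 1
    refine Finset.sum_congr rfl fun t _ => ?_
    rw [mul_comm]
    congr 2
  induction d with
  | zero => simp
  | succ d ih =>
    have hrec : ∑ t ∈ Finset.range (d + 1 + 1), (((d + 1 : ℕ) : ℂ) - 2 * t) * x ^ (d + 1 - t) *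
        y ^ t = x * ∑ t ∈ Finset.range (d + 1), ((d : ℂ) - 2 * t) * x ^ (d - t) * y ^ t +
        x * ∑ t ∈ Finset.range (d + 1), x ^ (d - t) * y ^ t - (d + 1) * y ^ (d + 1) := by
      rw [Finset.sum_range_succ, Finset.mul_sum, Finset.mul_sum, ← Finset.sum_add_distrib]
      have : ∀ t ∈ Finset.range (d + 1), (((d + 1 : ℕ) : ℂ) - 2 * t) * x ^ (d + 1 - t) * y ^ t =
          x * (((d : ℂ) - 2 * t) * x ^ (d - t) * y ^ t) + x * (x ^ (d - t) * y ^ t) := by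
        intro t ht
        rw [Finset.mem_range] at ht
        rw [show d + 1 - t = (d - t) + 1 by omega, pow_succ]
        push_cast
        ring
      rw [Finset.sum_congr rfl this]
      push_cast
      simp
      ring
    rw [hrec]
    push_cast
    linear_combination x * ih + 2 * x * (x - y) * hh d

/-- The two-particle problem. After extracting `(x * y) ^ q` everything depends on `d = p - q`. The
double pole of the squared cotangent cancels because the function is antisymmetric, and the quotient
expands in more squeezed antisymmetric pairs. -/
theorem twoBody_identity {x y : ℂ} (h : x ≠ y) (p q : ℕ) (hpq : q < p) :
    (x + y) / (x - y) * (((p : ℂ) - q) * (x ^ p * y ^ q + x ^ q * y ^ p)) -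
      ((x + y) / (x - y)) ^ 2 * (x ^ p * y ^ q - x ^ q * y ^ p) =
    ((p : ℂ) - q - 1) * (x ^ p * y ^ q - x ^ q * y ^ p) +
      ∑ t ∈ Finset.Ico 1 ((p - q + 1) / 2), 2 * ((p : ℂ) - q - 2 * t) *
        (x ^ (p - t) * y ^ (q + t) - x ^ (q + t) * y ^ (p - t)) := by
  obtain ⟨d, rfl⟩ : ∃ d, p = q + d := ⟨p - q, by omega⟩
  have hd : 0 < d := by omega
  have hxy : x - y ≠ 0 := sub_ne_zero.2 h
  -- The weighted sum runs over all `t` from 0 to `d`. Folding collects antisymmetric pairs, and the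
  -- pair `t = 0`, worth `2 * d * (x ^ d - y ^ d)` after doubling, is split off.
  have h1 : ∑ t ∈ Finset.Ico 1 ((q + d - q + 1) / 2), 2 * (((q + d : ℕ) : ℂ) - q - 2 * t) *
        (x ^ (q + d - t) * y ^ (q + t) - x ^ (q + t) * y ^ (q + d - t)) =
      (x * y) ^ q * (2 * ∑ t ∈ Finset.range (d + 1), ((d : ℂ) - 2 * t) * x ^ (d - t) * y ^ t -
        2 * d * (x ^ d - y ^ d)) := by
    rw [sum_range_succ_eq_fold d _ fun k hk => by rw [hk]; push_cast; ring, Finset.range_eq_Ico,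
      Finset.sum_eq_sum_Ico_succ_bot (show 0 < (d + 1) / 2 by omega), Nat.add_sub_cancel_left,
      zero_add]
    have : ∀ s : ℂ, 2 * (((d : ℂ) - 2 * (0 : ℕ)) * x ^ (d - 0) * y ^ 0 +
        ((d : ℂ) - 2 * (d - 0 : ℕ)) * x ^ (d - (d - 0)) * y ^ (d - 0) + s) -
        2 * d * (x ^ d - y ^ d) = 2 * s := by
      intro s
      simp
      ring
    rw [this, Finset.mul_sum, Finset.mul_sum]
    refine Finset.sum_congr rfl fun t ht => ?_
    rw [Finset.mem_Ico] at ht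
    have ht' : t ≤ d := by omega
    rw [Nat.cast_sub ht', show q + d - t = q + (d - t) by omega, Nat.sub_sub_self ht', mul_pow,
      pow_add, pow_add, pow_add, pow_add]
    push_cast
    ring
  rw [h1]
  have h2 := sq_mul_sum_weighted x y d
  set T := ∑ t ∈ Finset.range (d + 1), ((d : ℂ) - 2 * t) * x ^ (d - t) * y ^ t
  rw [pow_add, pow_add, mul_pow]
  push_cast
  field_simp
  linear_combination -(x ^ q * y ^ q) * h2

/-- The image of a monomial under the squeezing operator. -/
def squeezeTerm (i j : Fin N) (α : Fin N →₀ ℕ) : MvPolynomial (Fin N) ℂ :=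
  if α j < α i then ((α i : ℂ) - α j - 1) • monomial α 1 +
    ∑ t ∈ Finset.Ico 1 ((α i - α j + 1) / 2), (2 * ((α i : ℂ) - α j - 2 * t)) •
      monomial (α - Finsupp.single i t + Finsupp.single j t) 1
  else 0

/-- The operator that squeezes the exponents of the variables `i` and `j`. -/
def squeeze (i j : Fin N) : Module.End ℂ (MvPolynomial (Fin N) ℂ) :=
  (basisMonomials (Fin N) ℂ).constr ℂ (squeezeTerm i j)

theorem squeeze_monomial (i j : Fin N) (α : Fin N →₀ ℕ) :
    squeeze i j (monomial α 1) = squeezeTerm i j α :=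
  Module.Basis.constr_basis _ _ _ _

theorem squeezeTerm_add {i j : Fin N} (hij : i ≠ j) {β : Fin N →₀ ℕ} (hi : β i = 0) (hj : β j = 0)
    (p q : ℕ) : squeezeTerm i j (β + Finsupp.single i p + Finsupp.single j q) =
      if q < p then ((p : ℂ) - q - 1) •
        monomial (β + Finsupp.single i p + Finsupp.single j q) 1 +
        ∑ t ∈ Finset.Ico 1 ((p - q + 1) / 2), (2 * ((p : ℂ) - q - 2 * t)) •
          monomial (β + Finsupp.single i (p - t) + Finsupp.single j (q + t)) 1 else 0 := by
  have h1 : (β + Finsupp.single i p + Finsupp.single j q) i = p := by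
    simp [hi, hij.symm]
  have h2 : (β + Finsupp.single i p + Finsupp.single j q) j = q := by
    simp [hj, hij]
  rw [squeezeTerm, h1, h2]
  split_ifs with h
  · congr 1
    refine Finset.sum_congr rfl fun t ht => ?_
    rw [Finset.mem_Ico] at ht
    have : β + Finsupp.single i p + Finsupp.single j q - Finsupp.single i t + Finsupp.single j t =
        β + Finsupp.single i (p - t) + Finsupp.single j (q + t) := by
      ext k
      by_cases hki : k = i
      · subst hki
        simp [hi, hij.symm]
      · by_cases hkj : k = j
        · subst hkj
          simp [hj, hij]
        · simp [Ne.symm hki, Ne.symm hkj]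
    rw [this]
  · rfl

theorem theta_monomial (i : Fin N) (α : Fin N →₀ ℕ) :
    theta i (monomial α 1) = (α i : ℂ) • monomial α 1 := by
  rw [theta_apply, X_mul_pderiv_monomial, Nat.cast_smul_eq_nsmul]

/-- Written with an explicit antisymmetrization so that linearity reduces it to one monomial. The
exponents of the other variables factor out as `β`. Equal exponents give 0, and the order `p < q`
follows from `q < p` by a change of sign. -/
theorem twoBody_antisymmetrized {z : Fin N → ℂ} (hz : Function.Injective z) {i j : Fin N}
    (hij : i ≠ j) (Q : MvPolynomial (Fin N) ℂ) :
    twoBody z i j (Q - rename (Equiv.swap i j) Q) =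
      eval z (squeeze i j (Q - rename (Equiv.swap i j) Q) +
        squeeze j i (Q - rename (Equiv.swap i j) Q)) := by
  induction Q using MvPolynomial.induction_on' with
  | add P Q hP hQ =>
    have e : P + Q - rename (Equiv.swap i j) (P + Q) =
        (P - rename (Equiv.swap i j) P) + (Q - rename (Equiv.swap i j) Q) := by
      rw [map_add]; ring
    have h1 : ∀ A B : MvPolynomial (Fin N) ℂ,
        twoBody z i j (A + B) = twoBody z i j A + twoBody z i j B := by
      intro A B
      simp only [twoBody, map_add]
      ring
    rw [e, h1, hP, hQ]
    simp only [map_add]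
    ring
  | monomial α a =>
    set β := (α.erase i).erase j with hβ
    have hi : β i = 0 := by simp [hβ, hij]
    have hj : β j = 0 := by simp [hβ]
    have hα : α = β + Finsupp.single i (α i) + Finsupp.single j (α j) := by
      ext k
      by_cases hki : k = i
      · subst hki; simp [hi, hij.symm]
      · by_cases hkj : k = j
        · subst hkj; simp [hj, hij]
        · simp [hβ, hki, hkj]
    generalize α i = p at hα
    generalize α j = q at hα
    have hsw : ∀ p q : ℕ, rename (Equiv.swap i j)
        (monomial (β + Finsupp.single i p + Finsupp.single j q) (1 : ℂ)) =
        monomial (β + Finsupp.single i q + Finsupp.single j p) 1 := by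
      intro p q
      rw [rename_monomial]
      refine congrArg (fun γ => monomial γ (1 : ℂ)) (Finsupp.ext fun k => ?_)
      rw [show k = Equiv.swap i j (Equiv.swap i j k) by simp,
        Finsupp.mapDomain_apply (Equiv.injective _)]
      by_cases hki : k = i
      · subst hki; simp [hi, hj, hij, hij.symm]
      · by_cases hkj : k = j
        · subst hkj; simp [hi, hj, hij, hij.symm]
        · simp [Equiv.swap_apply_of_ne_of_ne hki hkj, Ne.symm hki, Ne.symm hkj]
    have hsmul : monomial α a - rename (Equiv.swap i j) (monomial α a) =
        a • (monomial (β + Finsupp.single i p + Finsupp.single j q) 1 -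
          monomial (β + Finsupp.single i q + Finsupp.single j p) 1) := by
      have : monomial α a = a • monomial α (1 : ℂ) := by
        rw [smul_monomial, smul_eq_mul, mul_one]
      rw [this, map_smul, ← smul_sub, hα, hsw]
    have hev : ∀ p q : ℕ, eval z
        (monomial (β + Finsupp.single i p + Finsupp.single j q) (1 : ℂ)) =
        eval z (monomial β 1) * (z i ^ p * z j ^ q) := by
      intro p q
      rw [← mul_one (1 : ℂ), ← mul_one (1 : ℂ), ← monomial_mul, ← monomial_mul, map_mul, map_mul]
      simp [eval_monomial]
      ring
    have htb : ∀ A : MvPolynomial (Fin N) ℂ, twoBody z i j (a • A) = a * twoBody z i j A := by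
      intro A
      simp only [twoBody, Derivation.map_smul, smul_eval]
      ring
    have key : ∀ p q : ℕ, q < p → twoBody z i j
        (monomial (β + Finsupp.single i p + Finsupp.single j q) 1 -
          monomial (β + Finsupp.single i q + Finsupp.single j p) 1) =
        eval z (squeeze i j (monomial (β + Finsupp.single i p + Finsupp.single j q) 1 -
          monomial (β + Finsupp.single i q + Finsupp.single j p) 1) +
          squeeze j i (monomial (β + Finsupp.single i p + Finsupp.single j q) 1 -
          monomial (β + Finsupp.single i q + Finsupp.single j p) 1)) := by
      intro p q hqp
      have hsw' : ∀ p q : ℕ, β + Finsupp.single i p + Finsupp.single j q =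
        β + Finsupp.single j q + Finsupp.single i p := fun p q => by
          rw [add_right_comm]
      simp only [map_sub, squeeze_monomial]
      rw [squeezeTerm_add hij hi hj, squeezeTerm_add hij hi hj, hsw' p q, hsw' q p,
        squeezeTerm_add hij.symm hj hi, squeezeTerm_add hij.symm hj hi, if_pos hqp, if_pos hqp,
        if_neg hqp.not_gt, if_neg hqp.not_gt, ← hsw', ← hsw']
      simp only [← hsw']
      rw [twoBody]
      simp only [map_sub, theta_monomial, smul_eval, hev, map_add, map_sum, sub_zero, zero_sub,
        map_neg]
      have v1 : (β + Finsupp.single i p + Finsupp.single j q) i = p := by simp [hi, hij.symm]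
      have v2 : (β + Finsupp.single i p + Finsupp.single j q) j = q := by simp [hj, hij]
      have v3 : (β + Finsupp.single i q + Finsupp.single j p) i = q := by simp [hi, hij.symm]
      have v4 : (β + Finsupp.single i q + Finsupp.single j p) j = p := by simp [hj, hij]
      rw [v1, v2, v3, v4, cot]
      have := twoBody_identity (hz.ne hij) p q hqp
      have hs : ∑ t ∈ Finset.Ico 1 ((p - q + 1) / 2), 2 * ((p : ℂ) - q - 2 * t) *
          (z i ^ (p - t) * z j ^ (q + t) - z i ^ (q + t) * z j ^ (p - t)) *
            eval z (monomial β (1 : ℂ)) =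
          ∑ t ∈ Finset.Ico 1 ((p - q + 1) / 2), 2 * ((p : ℂ) - q - 2 * t) *
            (eval z (monomial β (1 : ℂ)) * (z i ^ (p - t) * z j ^ (q + t))) -
          ∑ t ∈ Finset.Ico 1 ((p - q + 1) / 2), 2 * ((p : ℂ) - q - 2 * t) *
            (eval z (monomial β (1 : ℂ)) * (z i ^ (q + t) * z j ^ (p - t))) := by
        rw [← Finset.sum_sub_distrib]
        exact Finset.sum_congr rfl fun t _ => by ring
      rw [← Finset.sum_mul] at hs
      linear_combination (eval z (monomial β (1 : ℂ))) * this + hs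
    rw [hsmul, htb, map_smul, map_smul, ← smul_add, smul_eval]
    congr 1
    rcases lt_trichotomy q p with h | h | h
    · exact key p q h
    · subst h
      simp [twoBody]
    · have := key q p h
      rw [← neg_sub (monomial (β + Finsupp.single i p + Finsupp.single j q) (1 : ℂ))] at this
      simp only [map_neg, ← neg_add] at this
      rw [← neg_inj, ← this]
      simp only [twoBody, map_neg]
      ring

/-- An antisymmetric polynomial is the antisymmetrization of its half. -/
theorem twoBody_eq {z : Fin N → ℂ} (hz : Function.Injective z) {i j : Fin N} (hij : i ≠ j)
    {F : MvPolynomial (Fin N) ℂ} (hF : rename (Equiv.swap i j) F = -F) :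
    twoBody z i j F = eval z (squeeze i j F + squeeze j i F) := by
  have h := twoBody_antisymmetrized hz hij ((1 / 2 : ℂ) • F)
  have e : (1 / 2 : ℂ) • F - rename (Equiv.swap i j) ((1 / 2 : ℂ) • F) = F := by
    rw [map_smul, hF]
    module
  rwa [e] at h

end

/-! ### Coefficients of antisymmetric polynomials and conjugated Hamiltonians. -/

section

variable {N : ℕ}

/-! ### Eigenvalue equations on antisymmetric polynomials -/

theorem coeff_theta (i : Fin N) (Q : MvPolynomial (Fin N) ℂ) (α : Fin N →₀ ℕ) :
    coeff α (theta i Q) = α i * coeff α Q := by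
  induction Q using MvPolynomial.induction_on' with
  | add P Q hP hQ => rw [map_add, coeff_add, coeff_add, hP, hQ, mul_add]
  | monomial β a =>
    have : monomial β a = a • monomial β (1 : ℂ) := by rw [smul_monomial, smul_eq_mul, mul_one]
    rw [this, Derivation.map_smul, theta_monomial]
    simp only [coeff_smul, coeff_monomial, smul_eq_mul]
    split_ifs with h
    · rw [h]; ring
    · simp

theorem coeff_laplacian (Q : MvPolynomial (Fin N) ℂ) (α : Fin N →₀ ℕ) :
    coeff α (laplacian Q) = (∑ i, (α i : ℂ) ^ 2) * coeff α Q := by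
  rw [laplacian, coeff_sum, Finset.sum_mul]
  refine Finset.sum_congr rfl fun i _ => ?_
  rw [coeff_theta, coeff_theta]
  ring

/-- The monomials squeezed into `γ` are those whose exponents at `i` and `j` lie `t` further apart
on each side. Their gap is that of `γ` plus `2 * t`, so the weight `2 * (gap - 2 * t)` is always
twice the gap of `γ`. This independence of `t` is what matches the coefficient of `Ht`. -/
theorem coeff_squeeze {i j : Fin N} (hij : i ≠ j) (F : MvPolynomial (Fin N) ℂ)
    {γ : Fin N →₀ ℕ} (hγ : γ j < γ i) : coeff γ (squeeze i j F + squeeze j i F) =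
      ((γ i : ℂ) - γ j - 1) * coeff γ F + 2 * ((γ i : ℂ) - γ j) *
        ∑ t ∈ Finset.Ico 1 (γ j + 1),
          coeff (γ + Finsupp.single i t - Finsupp.single j t) F := by
  induction F using MvPolynomial.induction_on' with
  | add P Q hP hQ =>
    simp only [map_add, coeff_add, Finset.sum_add_distrib] at hP hQ ⊢
    linear_combination hP + hQ
  | monomial α a =>
    have : monomial α a = a • monomial α (1 : ℂ) := by rw [smul_monomial, smul_eq_mul, mul_one]
    rw [this, map_smul, map_smul, ← smul_add, coeff_smul, squeeze_monomial, squeeze_monomial]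
    simp only [coeff_smul, smul_eq_mul]
    rw [← Finset.mul_sum, mul_left_comm _ a (coeff γ _), mul_left_comm (2 * ((γ i : ℂ) - γ j)), ← mul_add]
    congr 1
    -- Squeezing stops strictly before the middle, so it never reverses the order of the two
    -- exponents.
    have h1 : coeff γ (squeezeTerm j i α) = 0 := by
      rw [squeezeTerm]
      split_ifs with h
      · have hne : α ≠ γ := fun h' => by rw [h'] at h; omega
        rw [coeff_add, coeff_smul, coeff_monomial, if_neg hne, smul_zero, zero_add, coeff_sum]
        refine Finset.sum_eq_zero fun t ht => ?_
        rw [Finset.mem_Ico] at ht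
        rw [coeff_smul, coeff_monomial, if_neg, smul_zero]
        intro h'
        have e1 := DFunLike.congr_fun h' i
        have e2 := DFunLike.congr_fun h' j
        simp [hij, hij.symm] at e1 e2
        omega
      · rfl
    rw [coeff_add, h1, add_zero, squeezeTerm]
    have hshift : ∀ t ∈ Finset.Ico 1 (γ j + 1), γ + Finsupp.single i t - Finsupp.single j t = α →
        α i = γ i + t ∧ α j = γ j - t := by
      intro t _ h'
      have e1 := DFunLike.congr_fun h' i
      have e2 := DFunLike.congr_fun h' j
      simp [hij, hij.symm] at e1 e2
      omega
    by_cases h : α j < α i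
    · rw [if_pos h, coeff_add, coeff_smul, coeff_monomial, coeff_sum, smul_eq_mul]
      congr 1
      · split_ifs with h'
        · rw [h']
        · simp
      · simp only [coeff_smul, coeff_monomial, smul_eq_mul, mul_ite, mul_one, mul_zero,
          Finset.mul_sum]
        rw [← Finset.sum_filter, ← Finset.sum_filter]
        refine Finset.sum_congr ?_ fun t ht => ?_
        · ext t
          simp only [Finset.mem_filter, Finset.mem_Ico]
          constructor
          · rintro ⟨ht, h'⟩
            have e1 := DFunLike.congr_fun h' i
            have e2 := DFunLike.congr_fun h' j
            simp [hij, hij.symm] at e1 e2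
            refine ⟨by omega, ?_⟩
            ext k
            have e3 := DFunLike.congr_fun h' k
            by_cases hki : k = i
            · subst hki; simp [hij.symm]; omega
            · by_cases hkj : k = j
              · subst hkj; simp [hij]; omega
              · simp [Ne.symm hki, Ne.symm hkj] at e3 ⊢
                omega
          · rintro ⟨ht, h'⟩
            have := hshift t (by simpa using ht) h'.symm
            refine ⟨by omega, ?_⟩
            ext k
            have e3 := DFunLike.congr_fun h' k
            by_cases hki : k = i
            · subst hki; simp [hij.symm]; omega
            · by_cases hkj : k = j
              · subst hkj; simp [hij]; omega
              · simp [Ne.symm hki, Ne.symm hkj] at e3 ⊢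
                omega
        · simp only [Finset.mem_filter] at ht
          have := hshift t ht.1 ht.2.symm
          have h2 := Finset.mem_Ico.1 ht.1
          rw [this.1, this.2, Nat.cast_sub (by omega)]
          push_cast
          ring
    · rw [if_neg h, coeff_zero, coeff_monomial, if_neg (fun h' => h (by rw [h']; exact hγ)),
        mul_zero, zero_add]
      symm
      refine mul_eq_zero_of_right _ (Finset.sum_eq_zero fun t ht => ?_)
      rw [coeff_monomial, if_neg]
      intro h'
      have := hshift t ht h'.symm
      omega

/-! ### Alternants -/

theorem alternant_eq_sum {ρ : ℕ → ℕ} (h : ρ N = 0) : alternant N ρ =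
    ∑ σ : Equiv.Perm (Fin N), monomial (Finsupp.equivFunOnFinite.symm
      fun i : Fin N => ρ (σ.symm i) + (N - 1 - (σ.symm i : ℕ)))
        (((Equiv.Perm.sign σ : ℤ) : ℂ)) := by
  rw [alternant, if_pos h, Matrix.det_apply]
  refine Finset.sum_congr rfl fun σ _ => ?_
  simp only [Matrix.of_apply]
  have h1 : ∏ i, (X (σ i) : MvPolynomial (Fin N) ℂ) ^ (ρ i + (N - 1 - (i : ℕ))) =
      monomial (Finsupp.equivFunOnFinite.symm
        fun i : Fin N => ρ (σ.symm i) + (N - 1 - (σ.symm i : ℕ))) 1 := by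
    rw [monomial_eq, C_1, one_mul, Finsupp.prod_fintype _ _ (by simp)]
    refine Eq.trans ?_ (Equiv.prod_comp σ _)
    simp
  rw [h1]
  rcases Int.units_eq_one_or (Equiv.Perm.sign σ) with h2 | h2 <;> simp [h2]

theorem coeff_alternant {ρ : ℕ → ℕ} (h : ρ N = 0) (α : Fin N →₀ ℕ) : coeff α (alternant N ρ) =
    ∑ σ : Equiv.Perm (Fin N), if ∀ i, α (σ i) = ρ i + (N - 1 - (i : ℕ)) then
      ((Equiv.Perm.sign σ : ℤ) : ℂ) else 0 := by
  rw [alternant_eq_sum h, coeff_sum]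
  refine Finset.sum_congr rfl fun σ _ => ?_
  rw [coeff_monomial]
  refine if_congr ?_ rfl rfl
  rw [DFunLike.ext_iff, ← σ.forall_congr_right]
  simp [eq_comm]

theorem rename_alternant (e : Equiv.Perm (Fin N)) (ρ : ℕ → ℕ) :
    rename e (alternant N ρ) = ((Equiv.Perm.sign e : ℤ) : ℂ) • alternant N ρ := by
  rw [alternant]
  split_ifs with h
  · rw [AlgHom.map_det]
    have : (rename e).mapMatrix (Matrix.of fun i j : Fin N =>
        (X i : MvPolynomial (Fin N) ℂ) ^ (ρ j + (N - 1 - (j : ℕ)))) =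
        (Matrix.of fun i j : Fin N =>
          (X i : MvPolynomial (Fin N) ℂ) ^ (ρ j + (N - 1 - (j : ℕ)))).submatrix e id := by
      ext1 i j
      simp
    rw [this, Matrix.det_permute, smul_eq_C_mul]
    simp
  · simp

theorem rename_powerSumEval (e : Equiv.Perm (Fin N)) (g : BosonFock) :
    rename e (powerSumEval N g) = powerSumEval N g := by
  have : (rename e).comp (powerSumEval N) = powerSumEval N := by
    refine MvPolynomial.algHom_ext fun k => ?_
    rw [AlgHom.comp_apply, powerSumEval_X]
    exact psum_isSymmetric _ _ _ e
  exact DFunLike.congr_fun this g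

/-- All monomials of `delta N` are permutations of the staircase and have the same sum of squared
exponents. -/
theorem laplacian_delta :
    laplacian (delta N) = (∑ i : Fin N, ((N - 1 - (i : ℕ) : ℕ) : ℂ) ^ 2) • delta N := by
  ext α
  rw [coeff_laplacian, coeff_smul, smul_eq_mul]
  by_cases h : ∃ σ : Equiv.Perm (Fin N), ∀ i, α (σ i) = 0 + (N - 1 - (i : ℕ))
  · obtain ⟨σ, hσ⟩ := h
    rw [← Equiv.sum_comp σ]
    simp only [hσ, zero_add]
  · push Not at h
    have h0 : coeff α (delta N) = 0 := by
      rw [delta, coeff_alternant rfl]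
      refine Finset.sum_eq_zero fun σ _ => ?_
      obtain ⟨i, hi⟩ := h σ
      exact if_neg fun h' => hi (h' i)
    rw [h0, mul_zero, mul_zero]

/-! ### Conjugation with the Vandermonde determinant -/

/-- Apply the drift to `g * delta` by the Leibniz rule. Its value on `delta` contains half the sum
of all squared cotangents, which is exactly what `twoBody` subtracts. Only the constant from the
triples and the squeezing operators survive. -/
theorem powerSumEval_interaction_mul_delta {g : BosonFock} {n : ℂ}
    (hg : ∑ i, theta i (powerSumEval N g) = n • powerSumEval N g) :
    powerSumEval N (interaction g) * delta N =
      (N * n + tripleCount N / 6) • (powerSumEval N g * delta N) -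
        ∑ i, ∑ j ∈ Finset.Ioi i, (squeeze i j (powerSumEval N g * delta N) +
          squeeze j i (powerSumEval N g * delta N)) := by
  refine eq_of_eval_eq fun z hz => ?_
  have h1 := interactionAt_powerSumEval hz g
  have h2 := interactionAt_mul z (powerSumEval N g) (delta N)
  have h3 := interactionAt_delta hz
  have h4 := sum_twoBody z (powerSumEval N g * delta N)
  have h5 : ∑ i, ∑ j ∈ Finset.Ioi i, twoBody z i j (powerSumEval N g * delta N) =
      eval z (∑ i, ∑ j ∈ Finset.Ioi i, (squeeze i j (powerSumEval N g * delta N) +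
          squeeze j i (powerSumEval N g * delta N))) := by
    rw [map_sum]
    refine Finset.sum_congr rfl fun i _ => ?_
    rw [map_sum]
    refine Finset.sum_congr rfl fun j hj => ?_
    have hij : i ≠ j := (Finset.mem_Ioi.1 hj).ne
    refine twoBody_eq hz hij ?_
    rw [map_mul, rename_powerSumEval, delta, rename_alternant, Equiv.Perm.sign_swap hij]
    simp
  rw [hg] at h1
  simp only [map_mul, map_sub, map_natCast, smul_eval] at h1 h2 h4 ⊢
  rw [← h5]
  rw [h3] at h2
  linear_combination eval z (delta N) * h1 + h2 + h4

/-- The free point of the model. In the Laplacian of `g * delta` the cross term is the drift of `g`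
plus `N - 1` times its degree. The drift contributes `N * n` minus `interaction`, and `quadratic`
cancels, leaving the two cubic operators. -/
theorem powerSumEval_cubic_mul_delta {g : BosonFock} {n : ℂ}
    (hg : ∑ i, theta i (powerSumEval N g) = n • powerSumEval N g) :
    powerSumEval N (cubicUp g + cubicDown g) * delta N =
      laplacian (powerSumEval N g * delta N) -
        ((2 * N - 1) * n + ∑ i : Fin N, ((N - 1 - (i : ℕ) : ℕ) : ℂ) ^ 2) •
          (powerSumEval N g * delta N) := by
  refine eq_of_eval_eq fun z hz => ?_
  have h1 := interactionAt_powerSumEval hz g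
  have h2 := laplacian_powerSumEval (N := N) g
  have h3 : eval z (∑ i, theta i (powerSumEval N g) * theta i (delta N)) =
      eval z (delta N) * (((N : ℂ) - 1) * (n * eval z (powerSumEval N g)) +
        interactionAt z (powerSumEval N g)) / 2 := by
    rw [← smul_eval, ← hg, interactionAt, map_sum, map_sum, Finset.mul_sum,
      ← Finset.sum_add_distrib, Finset.mul_sum, Finset.sum_div]
    refine Finset.sum_congr rfl fun i _ => ?_
    rw [map_mul, eval_theta_delta hz]
    ring
  have h4 := congrArg (eval z) h2
  rw [hg] at h1
  rw [laplacian_mul, laplacian_delta]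
  simp only [interaction, LinearMap.sub_apply, map_mul, map_sub, map_add, map_natCast,
    smul_eval, h3, map_ofNat] at h1 h4 ⊢
  linear_combination -eval z (delta N) * h1 + -eval z (delta N) * h4

end

/-! ### The dictionary between Fock states and antisymmetric polynomials. -/

section

/-! ### Strings of removal operators -/

/-- The product of the operators that empty the sites `m 0, m 1, …`. -/
def delString {K : ℕ} (m : Fin K → ℤ) : Module.End ℂ Fock := (List.ofFn fun i => del (m i)).prod

theorem delString_succ {K : ℕ} (m : Fin (K + 1) → ℤ) :
    delString m = del (m 0) * delString (Fin.tail m) := by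
  rw [delString, List.ofFn_succ, List.prod_cons]
  rfl

theorem delString_succ_last {K : ℕ} (m : Fin (K + 1) → ℤ) :
    delString m = delString (fun i : Fin K => m i.castSucc) * del (m (Fin.last K)) := by
  rw [delString, List.ofFn_succ_last, List.prod_append, List.prod_singleton]
  rfl

/-- The square-zero condition of the exterior algebra. Through its universal property the sign of a
permutation of removal operators is that of an alternating map. -/
theorem linearCombination_del_mul_self (x : ℤ →₀ ℂ) :
    Finsupp.linearCombination ℂ del x * Finsupp.linearCombination ℂ del x = 0 := by
  have key : ∀ x y : ℤ →₀ ℂ,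
      Finsupp.linearCombination ℂ del x * Finsupp.linearCombination ℂ del y +
        Finsupp.linearCombination ℂ del y * Finsupp.linearCombination ℂ del x = 0 := by
    intro x y
    induction x using Finsupp.induction_linear with
    | zero => simp
    | add x x' hx hx' =>
      rw [map_add, add_mul, mul_add, add_add_add_comm, hx, hx', add_zero]
    | single a c =>
      induction y using Finsupp.induction_linear with
      | zero => simp
      | add y y' hy hy' =>
        rw [map_add, add_mul, mul_add, add_add_add_comm, hy, hy', add_zero]
      | single a' c' =>
        rw [Finsupp.linearCombination_single, Finsupp.linearCombination_single,
          smul_mul_smul_comm, smul_mul_smul_comm, mul_comm c', ← smul_add, del_mul_del, smul_zero]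
  have := key x x
  rw [← two_smul ℂ] at this
  exact (smul_eq_zero.1 this).resolve_left two_ne_zero

/-- `delString` as an alternating map. -/
def delAlternating (K : ℕ) : (ℤ →₀ ℂ) [⋀^Fin K]→ₗ[ℂ] Module.End ℂ Fock :=
  (ExteriorAlgebra.lift ℂ ⟨Finsupp.linearCombination ℂ del,
    linearCombination_del_mul_self⟩).toLinearMap.compAlternatingMap (ExteriorAlgebra.ιMulti ℂ K)

theorem delAlternating_single {K : ℕ} (m : Fin K → ℤ) :
    delAlternating K (fun i => Finsupp.single (m i) 1) = delString m := by
  rw [delAlternating, LinearMap.compAlternatingMap_apply, ExteriorAlgebra.ιMulti_apply,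
    AlgHom.toLinearMap_apply, map_list_prod, List.map_ofFn, delString]
  congr 2
  funext i
  simp

theorem delString_comp_perm {K : ℕ} (m : Fin K → ℤ) (σ : Equiv.Perm (Fin K)) :
    delString (m ∘ σ) = ((Equiv.Perm.sign σ : ℤ) : ℂ) • delString m := by
  have := (delAlternating K).map_perm (fun i => Finsupp.single (m i) 1) σ
  rw [delAlternating_single] at this
  have h2 := delAlternating_single (m ∘ σ)
  rw [← h2]
  refine Eq.trans ?_ (this.trans ?_)
  · rfl
  · rcases Int.units_eq_one_or (Equiv.Perm.sign σ) with h | h <;> simp [h]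

theorem exists_prod_map_del_eq {b : ℤ} {L : List ℤ} (h : b ∈ L) :
    ∃ X, (L.map del).prod = del b * X := by
  induction L with
  | nil => simp at h
  | cons a L ih =>
    rw [List.map_cons, List.prod_cons]
    rcases List.mem_cons.1 h with rfl | h
    · exact ⟨_, rfl⟩
    · obtain ⟨X, hX⟩ := ih h
      exact ⟨-(del a * X), by rw [hX, ← mul_assoc, del_mul_del_swap, mul_neg, neg_mul, mul_assoc]⟩

/-- A Leibniz rule: moving `X` to the left through the string alters one removal operator at a time.
-/
theorem delString_mul {X : Module.End ℂ Fock} {κ : ℤ → ℂ} {τ : ℤ → ℤ}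
    (h : ∀ c, del c * X = X * del c + κ c • del (τ c)) {K : ℕ} (m : Fin K → ℤ) :
    delString m * X = X * delString m +
      ∑ j, κ (m j) • delString (Function.update m j (τ (m j))) := by
  induction K with
  | zero => simp [delString]
  | succ K ih =>
    rw [delString_succ, mul_assoc, ih (Fin.tail m), mul_add, ← mul_assoc, h, add_mul, mul_assoc,
      add_assoc, Fin.sum_univ_succ, Finset.mul_sum]
    congr 1
    congr 1
    · rw [delString_succ, Fin.tail_update_zero, Function.update_self, smul_mul_assoc]
    · refine Finset.sum_congr rfl fun j _ => ?_
      rw [delString_succ, Fin.tail_update_succ, Function.update_of_ne (Fin.succ_ne_zero j).symm,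
        mul_smul_comm]
      rfl

/-! ### Correlators -/

theorem coord_sea_ψ {N : ℕ} {a : ℤ} (h : a < N) (v : Fock) :
    fockBasis.coord (Finset.Ico 0 (N : ℤ)) (ψ a v) = 0 := by
  rcases lt_or_ge a 0 with h0 | h0
  · rw [ψ_of_neg h0, coord_create, if_neg (by simp [h0])]
  · rw [ψ_of_nonneg h0, coord_annihilate, if_pos (by simp [h0, h])]

theorem coord_sea_del {N : ℕ} {a : ℤ} (h : N ≤ a) (v : Fock) :
    fockBasis.coord (Finset.Ico 0 (N : ℤ)) (del a v) = 0 := by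
  rw [del_of_nonneg (by omega), coord_create, if_neg (by simp; omega)]

/-- The projection is onto a shifted vacuum. Each summand, suitably ordered, finally either fills a
site below `N` or empties a site from `N` on, and neither result can meet the projected state. -/
theorem coord_sea_osc {N : ℕ} {k : ℤ} (h : 0 < k) (v : Fock) :
    fockBasis.coord (Finset.Ico 0 (N : ℤ)) (osc (-k) v) = 0 := by
  rw [osc, (locFin_osc _).map_locSum_apply]
  refine finsum_eq_zero_of_forall_eq_zero fun i => ?_
  have h1 : normalOrder [.psi (-k - i - 1), .psiStar i] = ψ (-k - i - 1) * del (-i - 1) := by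
    rw [normalOrder_psi_psiStar]
    split_ifs
    · rfl
    · rw [del_mul_ψ_of_ne (by omega), neg_neg]
  rw [h1]
  rcases lt_or_ge (-k - i - 1) (N : ℤ) with h2 | h2
  · rw [Module.End.mul_apply, coord_sea_ψ h2]
  · rw [← neg_neg (ψ _ * del _), ← del_mul_ψ_of_ne (by omega), LinearMap.neg_apply, map_neg,
      Module.End.mul_apply, coord_sea_del (by omega), neg_zero]

/-- The matrix element of a state that is obtained by emptying the sites `m` and projecting to the
state with all sites below `N` empty and all others occupied. -/
def correlator {N : ℕ} (m : Fin N → ℤ) : Fock →ₗ[ℂ] ℂ :=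
  fockBasis.coord (Finset.Ico 0 (N : ℤ)) ∘ₗ delString m

variable {N : ℕ}

theorem correlator_apply (m : Fin N → ℤ) (v : Fock) :
    correlator m v = fockBasis.coord (Finset.Ico 0 (N : ℤ)) (delString m v) := rfl

theorem correlator_comp_perm (m : Fin N → ℤ) (σ : Equiv.Perm (Fin N)) (v : Fock) :
    correlator (m ∘ σ) v = ((Equiv.Perm.sign σ : ℤ) : ℂ) * correlator m v := by
  rw [correlator_apply, delString_comp_perm, LinearMap.smul_apply, map_smul, smul_eq_mul,
    correlator_apply]

theorem correlator_eq_zero {m : Fin N → ℤ} {j : Fin N} (h : N ≤ m j) (v : Fock) :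
    correlator m v = 0 := by
  obtain ⟨X, hX⟩ := exists_prod_map_del_eq (b := m j) (L := List.ofFn m) (by simp [List.mem_ofFn])
  have : delString m = del (m j) * X := by
    rw [← hX, delString, List.map_ofFn]
    rfl
  rw [correlator_apply, this, Module.End.mul_apply, coord_sea_del h]

theorem correlator_osc {k : ℤ} (hk : 0 < k) (m : Fin N → ℤ) (v : Fock) :
    correlator m (osc (-k) v) = ∑ j, correlator (Function.update m j (m j + k)) v := by
  have h : ∀ c, del c * osc (-k) = osc (-k) * del c + (fun _ => (1 : ℂ)) c • del (c + k) := by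
    intro c
    rw [osc_mul_del, one_smul]
    simp
  have := LinearMap.congr_fun (delString_mul (τ := (· + k)) h m) v
  rw [Module.End.mul_apply] at this
  rw [correlator_apply, this, LinearMap.add_apply, map_add, Module.End.mul_apply,
    coord_sea_osc hk, zero_add, LinearMap.sum_apply, map_sum]
  simp only [one_smul]
  rfl

/-- A hop from `b` to `a` followed by emptying `a` amounts to emptying `b`. The condition on `a` and
`b` removes the term in which the hop comes last. -/
theorem correlator_ψ_mul_del {a b : ℤ} (hab : a ≠ b) (h : a < N ∨ N ≤ b) (m : Fin N → ℤ)
    (v : Fock) : correlator m (ψ a (del b v)) =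
      ∑ j, if m j = a then correlator (Function.update m j b) v else 0 := by
  have h1 : ∀ c, del c * (ψ a * del b) =
      (ψ a * del b) * del c + (fun c => if c = a then (1 : ℂ) else 0) c • del ((fun _ => b) c) := by
    intro c
    have h2 := ψ_mul_del a c
    have h3 : del c * ψ a = (if a = c then 1 else 0) - ψ a * del c := by rw [← h2]; abel
    rw [← mul_assoc, h3, sub_mul, mul_assoc, del_mul_del_swap c b, mul_neg, ← mul_assoc]
    by_cases h4 : a = c
    · simp [h4, add_comm]
    · simp [h4, Ne.symm h4]
  have := LinearMap.congr_fun (delString_mul h1 m) v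
  simp only [Module.End.mul_apply] at this
  have h0 : fockBasis.coord (Finset.Ico 0 (N : ℤ)) (ψ a (del b (delString m v))) = 0 := by
    rcases h with h | h
    · exact coord_sea_ψ h _
    · rw [← Module.End.mul_apply, ← neg_neg (ψ _ * del _), ← del_mul_ψ_of_ne hab,
        LinearMap.neg_apply, map_neg, Module.End.mul_apply, coord_sea_del h, neg_zero]
  rw [correlator_apply, this, LinearMap.add_apply, map_add, Module.End.mul_apply,
    Module.End.mul_apply, h0, zero_add, LinearMap.sum_apply, map_sum]
  refine Finset.sum_congr rfl fun j _ => ?_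
  split_ifs with hj
  · rw [one_smul]; rfl
  · rw [zero_smul, LinearMap.zero_apply, map_zero]

theorem neg_one_pow_card_symmDiff (A B : Finset ℤ) :
    (-1 : ℂ) ^ (symmDiff A B).card = (-1) ^ (A.card + B.card) := by
  have h1 : (symmDiff A B).card + 2 * (A ∩ B).card = A.card + B.card := by
    rw [symmDiff_def, Finset.sup_eq_union, Finset.card_union_of_disjoint disjoint_sdiff_sdiff]
    have h1 := Finset.card_sdiff_add_card_inter A B
    have h2 := Finset.card_sdiff_add_card_inter B A
    rw [Finset.inter_comm] at h2
    omega
  rw [← h1, pow_add, pow_mul]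
  simp

/-- The largest site acts first on the state. Below it, modulo 2, lie the `K` other sites of the
string and the `x.toNat` holes of the sea; this is the sign contributed at each step. -/
theorem coord_sea_delString {K : ℕ} {m : Fin K → ℤ} (hm : StrictMono m) (hN : ∀ i, m i < N)
    (v : Fock) : fockBasis.coord (Finset.Ico 0 (N : ℤ)) (delString m v) =
      (-1) ^ (∑ i : Fin K, ((i : ℕ) + (m i).toNat)) *
        fockBasis.coord (symmDiff (Finset.Ico 0 (N : ℤ)) (Finset.univ.image m)) v := by
  induction K generalizing v with
  | zero =>
    rw [Finset.univ_eq_empty, Finset.sum_empty, Finset.image_empty, pow_zero, one_mul,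
      ← Finset.bot_eq_empty, symmDiff_bot]
    rfl
  | succ K ih =>
    set x := m (Fin.last K) with hx
    set I : Finset ℤ := Finset.univ.image fun i : Fin K => m i.castSucc with hI
    have hlt : ∀ y ∈ I, y < x := by
      intro y hy
      obtain ⟨i, -, rfl⟩ := Finset.mem_image.1 hy
      exact hm (Fin.castSucc_lt_last i)
    have hcard : I.card = K := by
      rw [hI, Finset.card_image_of_injective, Finset.card_univ, Fintype.card_fin]
      exact hm.injective.comp (Fin.castSucc_injective K)
    have himage : Finset.univ.image m = insert x I := by
      rw [Fin.univ_castSuccEmb, Finset.cons_eq_insert, Finset.image_insert, hI, hx,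
        Finset.map_eq_image, Finset.image_image]
      rfl
    have hxI : x ∉ I := fun h => lt_irrefl _ (hlt x h)
    have hxN : x < N := hN _
    rw [delString_succ_last, Module.End.mul_apply,
      ih (fun i j hij => hm (Fin.castSucc_lt_castSucc_iff.2 hij)) (fun i => hN _), ← hI, ← hx,
      Fin.sum_univ_castSucc, pow_add, mul_assoc]
    have hsgn : sgn x (symmDiff (Finset.Ico 0 (N : ℤ)) I) = (-1) ^ (K + x.toNat) := by
      have : (symmDiff (Finset.Ico 0 (N : ℤ)) I).filter (· < x) =
          symmDiff (Finset.Ico 0 x) I := by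
        ext y
        have := hlt y
        simp only [Finset.mem_filter, Finset.mem_symmDiff, Finset.mem_Ico]
        constructor
        · rintro ⟨h | h, h2⟩
          · left; exact ⟨by omega, h.2⟩
          · right; exact ⟨h.1, by omega⟩
        · rintro (h | h)
          · exact ⟨Or.inl ⟨by omega, h.2⟩, by omega⟩
          · have h3 := this h.1
            exact ⟨Or.inr ⟨h.1, by omega⟩, h3⟩
      rw [sgn, this, neg_one_pow_card_symmDiff, hcard, Int.card_Ico, sub_zero, add_comm]
    congr 1
    simp only [Fin.val_last, ← hx]
    rw [← hsgn, himage]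
    rcases lt_or_ge x 0 with h0 | h0
    · have hmem : x ∉ symmDiff (Finset.Ico 0 (N : ℤ)) I := by
        simp [Finset.mem_symmDiff, hxI, h0]
      rw [del_of_neg h0, coord_annihilate, if_neg hmem]
      have : insert x (symmDiff (Finset.Ico 0 (N : ℤ)) I) =
          symmDiff (Finset.Ico 0 (N : ℤ)) (insert x I) := by
        ext y
        by_cases hy : y = x
        · rw [hy]; simp [Finset.mem_symmDiff, h0]
        · simp [Finset.mem_symmDiff, hy]
      rw [this]
    · have hmem : x ∈ symmDiff (Finset.Ico 0 (N : ℤ)) I := by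
        simp [Finset.mem_symmDiff, hxI, h0, hxN]
      rw [del_of_nonneg h0, coord_create, if_pos hmem]
      have : (symmDiff (Finset.Ico 0 (N : ℤ)) I).erase x =
          symmDiff (Finset.Ico 0 (N : ℤ)) (insert x I) := by
        ext y
        by_cases hy : y = x
        · rw [hy]; simp [Finset.mem_symmDiff, h0, hxN]
        · simp [Finset.mem_symmDiff, hy]
      rw [this]

end

section

/-! ### Schur states as basis vectors -/

/-- The positions of the particles and holes of the Schur state of a partition. -/
def stateSet {n : ℕ} (lam : n.Partition) : Finset ℤ :=
  (Finset.range (durfee lam)).image (fun i : ℕ => (i : ℤ) - row lam i) ∪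
    (Finset.range (durfee lam)).image (fun j : ℕ => (col lam j : ℤ) - j - 1)

variable {n N : ℕ}

/-- Pairs are added from the innermost outwards. The new hole lies above an even number of earlier
modes and the new particle below all of them, so no sign arises. -/
theorem prod_range'_vac (lam : n.Partition) (k s : ℕ) (h : s + k = durfee lam) :
    ((List.range' s k).map fun i : ℕ =>
      ψ ((i : ℤ) - row lam i) * ψs ((i : ℤ) - col lam i)).prod vac =
    fockBasis ((Finset.Ico s (durfee lam)).image (fun i : ℕ => (i : ℤ) - row lam i) ∪
      (Finset.Ico s (durfee lam)).image (fun j : ℕ => (col lam j : ℤ) - j - 1)) := by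
  induction k generalizing s with
  | zero =>
    rw [← h]
    simp [vac]
  | succ k ih =>
    have hs : s < durfee lam := by omega
    have h1 := (lt_durfee_iff lam s).1 hs
    have h2 := (lt_durfee_iff_col lam s).1 hs
    rw [List.range'_succ, List.map_cons, List.prod_cons, Module.End.mul_apply, ih (s + 1) (by omega),
      ← Finset.insert_Ico_add_one_left_eq_Ico hs, Finset.image_insert, Finset.image_insert]
    set P := (Finset.Ico (s + 1) (durfee lam)).image (fun i : ℕ => (i : ℤ) - row lam i) with hP
    set Q := (Finset.Ico (s + 1) (durfee lam)).image (fun j : ℕ => (col lam j : ℤ) - j - 1) with hQ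
    have hPlt : ∀ x ∈ P, (s : ℤ) - row lam s < x ∧ x < 0 := by
      intro x hx
      obtain ⟨i, hi, rfl⟩ := Finset.mem_image.1 hx
      rw [Finset.mem_Ico] at hi
      have := (lt_durfee_iff lam i).1 hi.2
      exact ⟨strictMono_sub_row lam (show s < i by omega), by omega⟩
    have hQlt : ∀ x ∈ Q, x < (col lam s : ℤ) - s - 1 ∧ 0 ≤ x := by
      intro x hx
      obtain ⟨i, hi, rfl⟩ := Finset.mem_image.1 hx
      rw [Finset.mem_Ico] at hi
      have := (lt_durfee_iff_col lam i).1 hi.2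
      exact ⟨strictAnti_col_sub lam (show s < i by omega), by omega⟩
    have hcardP : P.card = durfee lam - (s + 1) := by
      rw [hP, Finset.card_image_of_injective _ (strictMono_sub_row lam).injective, Nat.card_Ico]
    have hcardQ : Q.card = durfee lam - (s + 1) := by
      rw [hQ, Finset.card_image_of_injective _ (strictAnti_col_sub lam).injective, Nat.card_Ico]
    have hdisj : Disjoint P Q := by
      rw [Finset.disjoint_left]
      intro x hx hx'
      have := hPlt x hx
      have := hQlt x hx'
      omega
    have hq : (col lam s : ℤ) - s - 1 ∉ P ∪ Q := by
      rw [Finset.mem_union]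
      rintro (h | h)
      · have := hPlt _ h
        omega
      · exact lt_irrefl _ (hQlt _ h).1
    have hp : (s : ℤ) - row lam s ∉ insert ((col lam s : ℤ) - s - 1) (P ∪ Q) := by
      rw [Finset.mem_insert, Finset.mem_union]
      rintro (h | h | h)
      · omega
      · exact lt_irrefl _ (hPlt _ h).1
      · have := hQlt _ h
        omega
    have hsq : sgn ((col lam s : ℤ) - s - 1) (P ∪ Q) = 1 := by
      rw [sgn, Finset.filter_true_of_mem, Finset.card_union_of_disjoint hdisj, hcardP, hcardQ,
        ← two_mul, pow_mul]
      · simp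
      · intro x hx
        rcases Finset.mem_union.1 hx with h | h
        · have := hPlt _ h
          omega
        · exact (hQlt _ h).1
    have hsp : sgn ((s : ℤ) - row lam s) (insert ((col lam s : ℤ) - s - 1) (P ∪ Q)) = 1 := by
      rw [sgn, Finset.filter_false_of_mem, Finset.card_empty, pow_zero]
      intro x hx
      rw [Finset.mem_insert, Finset.mem_union] at hx
      rcases hx with rfl | h | h
      · omega
      · exact not_lt.2 (hPlt _ h).1.le
      · have := hQlt _ h
        omega
    rw [Module.End.mul_apply, ψs_eq_del,
      show -((s : ℤ) - col lam s) - 1 = (col lam s : ℤ) - s - 1 by ring,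
      del_of_nonneg (by omega), create_apply, if_neg hq, hsq, one_smul, ψ_of_neg (by omega),
      create_apply, if_neg hp, hsp, one_smul, Finset.insert_union, Finset.union_insert]

theorem schurState_eq (lam : n.Partition) : schurState lam =
    ((-1 : ℂ) ^ ∑ i ∈ Finset.range (durfee lam), (col lam i - i - 1)) •
      fockBasis (stateSet lam) := by
  rw [schurState, List.range_eq_range', prod_range'_vac lam _ _ (zero_add _), stateSet,
    Finset.range_eq_Ico]

theorem stateSet_eq_symmDiff (lam : n.Partition) (h : row lam N = 0) : stateSet lam =
    symmDiff (Finset.Ico 0 (N : ℤ))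
      ((Finset.range N).image fun i : ℕ => (i : ℤ) - row lam i) := by
  have hd : durfee lam ≤ N := by
    by_contra hlt
    have := (lt_durfee_iff lam N).1 (not_le.1 hlt)
    omega
  have hsplit : Finset.range N = Finset.range (durfee lam) ∪ Finset.Ico (durfee lam) N := by
    ext i
    simp only [Finset.mem_range, Finset.mem_union, Finset.mem_Ico]
    omega
  rw [range_eq_particles_union_holes lam h, hsplit, Finset.image_union, stateSet]
  set P := (Finset.range (durfee lam)).image (fun i : ℕ => (i : ℤ) - row lam i)
  set P' := (Finset.Ico (durfee lam) N).image (fun i : ℕ => (i : ℤ) - row lam i)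
  set Q := (Finset.range (durfee lam)).image (fun j : ℕ => (col lam j : ℤ) - j - 1)
  have h1 : ∀ x ∈ P, x ∉ P' := by
    intro x hx hx'
    obtain ⟨i, hi, rfl⟩ := Finset.mem_image.1 hx
    obtain ⟨j, hj, hij⟩ := Finset.mem_image.1 hx'
    rw [Finset.mem_range] at hi
    rw [Finset.mem_Ico] at hj
    have := (strictMono_sub_row lam).injective hij
    omega
  have h2 : ∀ x, x ∈ P ∨ x ∈ P' → x ∉ Q := by
    intro x hx hx'
    obtain ⟨j, hj, rfl⟩ := Finset.mem_image.1 hx'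
    rcases hx with hx | hx <;> obtain ⟨i, hi, hij⟩ := Finset.mem_image.1 hx <;>
      exact row_add_col_ne lam i j hij
  ext x
  have h1 := h1 x
  have h2 := h2 x
  simp only [Finset.mem_symmDiff, Finset.mem_union]
  tauto

theorem eq_of_image_range_eq {f g : ℕ → ℤ} (hf : StrictMono f) (hg : StrictMono g) {K : ℕ}
    (h : (Finset.range K).image f = (Finset.range K).image g) {i : ℕ} (hi : i < K) :
    f i = g i := by
  have hc : ((Finset.range K).image f).card = K := by
    rw [Finset.card_image_of_injective _ hf.injective, Finset.card_range]
  have h1 := Finset.orderEmbOfFin_unique hc (f := fun i : Fin K => f i)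
    (fun x => Finset.mem_image_of_mem _ (Finset.mem_range.2 x.2)) (fun x y hxy => hf hxy)
  have h2 := Finset.orderEmbOfFin_unique hc (f := fun i : Fin K => g i)
    (fun x => h ▸ Finset.mem_image_of_mem _ (Finset.mem_range.2 x.2)) (fun x y hxy => hg hxy)
  exact congrFun (h1.trans h2.symm) ⟨i, hi⟩

theorem image_univ_fin {A : Type*} [DecidableEq A] (f : ℕ → A) (K : ℕ) :
    (Finset.univ.image fun i : Fin K => f i) = (Finset.range K).image f := by
  ext x
  simp [Fin.exists_iff]

/-- Continue `m` by the identity from `N` on. Both sets then come from strictly increasing sequences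
of occupied sites, which are determined by their images up to a common cutoff. -/
theorem symmDiff_eq_stateSet_iff (lam : n.Partition) {m : Fin N → ℤ} (hm : StrictMono m)
    (hN : ∀ i, m i < N) : symmDiff (Finset.Ico 0 (N : ℤ)) (Finset.univ.image m) = stateSet lam ↔
      (∀ i, m i = i - row lam i) ∧ row lam N = 0 := by
  constructor
  · intro h
    let f : ℕ → ℤ := fun i => if h : i < N then m ⟨i, h⟩ else i
    have hf : StrictMono f := by
      intro i j hij
      simp only [f]
      by_cases hj : j < N
      · rw [dif_pos hj, dif_pos (hij.trans hj)]
        exact hm hij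
      · rw [dif_neg hj]
        split_ifs with hi
        · have := hN ⟨i, hi⟩
          omega
        · omega
    -- The extra 1 puts `N` itself below the cutoff, so that the comparison at index `N` yields `row
    -- lam N = 0`.
    set K := max N n + 1 with hK
    have e : symmDiff (Finset.Ico 0 (N : ℤ)) (Finset.univ.image m) =
        symmDiff (Finset.Ico 0 (K : ℤ)) ((Finset.range K).image f) := by
      have hs : Finset.range K = Finset.range N ∪ Finset.Ico N K := by
        ext i
        simp only [Finset.mem_range, Finset.mem_union, Finset.mem_Ico]
        omega
      have h1 : (Finset.range N).image f = Finset.univ.image m := by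
        rw [← image_univ_fin]
        congr 1
        funext i
        simp [f]
      have h2 : (Finset.Ico N K).image f = Finset.Ico (N : ℤ) K := by
        ext x
        simp only [Finset.mem_image, Finset.mem_Ico]
        constructor
        · rintro ⟨i, hi, rfl⟩
          simp only [f, dif_neg (not_lt.2 hi.1)]
          omega
        · intro hx
          refine ⟨x.toNat, by omega, ?_⟩
          simp only [f]
          rw [dif_neg (by omega)]
          omega
      rw [hs, Finset.image_union, h1, h2]
      ext x
      have : x ∈ Finset.univ.image m → x < N := by
        intro hx
        obtain ⟨i, -, rfl⟩ := Finset.mem_image.1 hx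
        exact hN i
      simp only [Finset.mem_symmDiff, Finset.mem_union, Finset.mem_Ico]
      constructor
      · rintro (⟨h1, h2⟩ | ⟨h1, h2⟩)
        · left; exact ⟨by omega, by rintro (h3 | h3); exacts [h2 h3, by omega]⟩
        · have := this h1
          right; exact ⟨Or.inl h1, by omega⟩
      · rintro (⟨h1, h2⟩ | ⟨h1 | h1, h2⟩)
        · push Not at h2
          left; refine ⟨?_, h2.1⟩
          have := h2.2
          omega
        · right; exact ⟨h1, by omega⟩
        · omega
    rw [e, stateSet_eq_symmDiff lam (row_eq_zero lam (show n ≤ K by omega))] at h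
    have h3 := fun i (hi : i < K) =>
      eq_of_image_range_eq hf (strictMono_sub_row lam) (symmDiff_right_injective _ h) hi
    constructor
    · intro i
      have := h3 i (by omega)
      simpa [f] using this
    · have := h3 N (by omega)
      simp only [f, dif_neg (lt_irrefl N)] at this
      omega
  · rintro ⟨h1, h2⟩
    rw [stateSet_eq_symmDiff lam h2, ← image_univ_fin]
    congr 2
    exact funext h1

/-- The sign in the definition of the Schur state is chosen to make this matrix element 1 rather
than a sign. -/
theorem correlator_schurState (lam : n.Partition) {m : Fin N → ℤ} (hm : StrictMono m)
    (hN : ∀ i, m i < N) : correlator m (schurState lam) =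
      if (∀ i, m i = i - row lam i) ∧ row lam N = 0 then 1 else 0 := by
  rw [correlator_apply, coord_sea_delString hm hN, schurState_eq, map_smul, smul_eq_mul,
    Module.Basis.coord_apply, Module.Basis.repr_self, Finsupp.single_apply]
  split_ifs with h1 h2 h2
  · obtain ⟨h2, h3⟩ := h2
    rw [mul_one, ← pow_add]
    -- Particles have `Int.toNat` equal to 0. So the hole sum plus the sum over the sites of `lam`
    -- is `∑ i`, and the total exponent of `-1` is `2 * ∑ i`.
    have h4 := sum_particles_sub_sum_holes lam h3 fun x : ℤ => (x.toNat : ℤ)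
    have h5 : ∑ i ∈ Finset.range (durfee lam), (((i : ℤ) - row lam i).toNat : ℤ) = 0 := by
      refine Finset.sum_eq_zero fun i hi => ?_
      have := (lt_durfee_iff lam i).1 (Finset.mem_range.1 hi)
      omega
    have h6 : ∑ j ∈ Finset.range (durfee lam), (((col lam j : ℤ) - j - 1).toNat : ℤ) =
        ((∑ j ∈ Finset.range (durfee lam), (col lam j - j - 1) : ℕ) : ℤ) := by
      push_cast
      refine Finset.sum_congr rfl fun i hi => ?_
      omega
    have h7 : ∑ i : Fin N, ((i : ℕ) + (m i).toNat) =
        ∑ i ∈ Finset.range N, (i + ((i : ℤ) - row lam i).toNat) := by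
      rw [Finset.sum_range]
      simp only [h2]
    rw [h5, h6] at h4
    rw [h7]
    refine Even.neg_one_pow ⟨∑ i ∈ Finset.range N, i, ?_⟩
    rw [Finset.sum_add_distrib]
    simp only [Int.toNat_natCast, Nat.cast_sum] at h4
    zify
    linarith
  · exact absurd ((symmDiff_eq_stateSet_iff lam hm hN).1 h1.symm) h2
  · exact absurd ((symmDiff_eq_stateSet_iff lam hm hN).2 h2).symm h1
  · rw [mul_zero, mul_zero]

end

section

variable {n N : ℕ}

/-! ### Alternating functions of exponents -/

/-- The function changes sign under odd permutations of the exponents. -/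
def IsAlternating (A : (Fin N →₀ ℕ) → ℂ) : Prop :=
  ∀ (e : Equiv.Perm (Fin N)) (α : Fin N →₀ ℕ),
    A (α.mapDomain e) = ((Equiv.Perm.sign e : ℤ) : ℂ) * A α

theorem IsAlternating.eq_zero {A : (Fin N →₀ ℕ) → ℂ} (hA : IsAlternating A) {α : Fin N →₀ ℕ}
    {i j : Fin N} (hij : i ≠ j) (h : α i = α j) : A α = 0 := by
  have h1 := hA (Equiv.swap i j) α
  have h2 : α.mapDomain (Equiv.swap i j) = α := by
    ext k
    rw [Finsupp.mapDomain_equiv_apply, Equiv.symm_swap]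
    by_cases hi : k = i
    · rw [hi, Equiv.swap_apply_left, h]
    · by_cases hj : k = j
      · rw [hj, Equiv.swap_apply_right, h]
      · rw [Equiv.swap_apply_of_ne_of_ne hi hj]
  rw [h2, Equiv.Perm.sign_swap hij] at h1
  simp only [Units.val_neg, Units.val_one, Int.cast_neg, Int.cast_one, neg_mul, one_mul] at h1
  linear_combination h1 / 2

theorem exists_antitone_mapDomain (α : Fin N →₀ ℕ) :
    ∃ e : Equiv.Perm (Fin N), Antitone (α.mapDomain e) := by
  refine ⟨(Tuple.sort fun i => OrderDual.toDual (α i)).symm, fun i j hij => ?_⟩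
  rw [Finsupp.mapDomain_equiv_apply, Finsupp.mapDomain_equiv_apply, Equiv.symm_symm]
  exact Tuple.monotone_sort (fun i => OrderDual.toDual (α i)) hij

/-- An alternating function vanishes on exponents with a repetition. Distinct exponents can be
sorted at the cost of a sign. -/
theorem IsAlternating.ext {A B : (Fin N →₀ ℕ) → ℂ} (hA : IsAlternating A) (hB : IsAlternating B)
    (h : ∀ α : Fin N →₀ ℕ, StrictAnti α → A α = B α) : A = B := by
  funext α
  by_cases hα : Function.Injective α
  · obtain ⟨e, he⟩ := exists_antitone_mapDomain α
    have hs : StrictAnti (α.mapDomain e) := by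
      refine he.strictAnti_of_injective fun i j hij => ?_
      rw [Finsupp.mapDomain_equiv_apply, Finsupp.mapDomain_equiv_apply] at hij
      exact e.symm.injective (hα hij)
    have h1 := h _ hs
    rw [hA, hB] at h1
    refine mul_left_cancel₀ ?_ h1
    rcases Int.units_eq_one_or (Equiv.Perm.sign e) with h | h <;> simp [h]
  · simp only [Function.Injective, not_forall] at hα
    obtain ⟨i, j, h1, h2⟩ := hα
    rw [hA.eq_zero h2 h1, hB.eq_zero h2 h1]

theorem isAlternating_coeff {F : MvPolynomial (Fin N) ℂ}
    (hF : ∀ e : Equiv.Perm (Fin N), rename e F = ((Equiv.Perm.sign e : ℤ) : ℂ) • F) :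
    IsAlternating fun α => coeff α F := by
  intro e α
  have h1 := coeff_rename_mapDomain e e.injective F α
  rw [hF, coeff_smul, smul_eq_mul] at h1
  beta_reduce
  rw [← h1, ← mul_assoc]
  rcases Int.units_eq_one_or (Equiv.Perm.sign e) with h | h <;> simp [h]

theorem coeff_alternant_of_strictAnti {ρ : ℕ → ℕ} (hρ : Antitone ρ) (h : ρ N = 0)
    {α : Fin N →₀ ℕ} (hα : StrictAnti α) : coeff α (alternant N ρ) =
      if ∀ i : Fin N, α i = ρ i + (N - 1 - (i : ℕ)) then 1 else 0 := by
  rw [coeff_alternant h, Finset.sum_eq_single 1]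
  · simp
  · intro σ _ hσ
    refine if_neg fun h' => hσ ?_
    have hm : StrictMono σ := by
      intro i j hij
      refine hα.lt_iff_gt.1 ?_
      have := hρ hij.le
      have h3 : (i : ℕ) < j := hij
      rw [h', h']
      have : ρ (j : ℕ) ≤ ρ (i : ℕ) := hρ h3.le
      omega
    have h4 := Subsingleton.elim (hm.orderIsoOfSurjective _ σ.surjective) (OrderIso.refl _)
    ext i
    have := DFunLike.congr_fun h4 i
    simp only [StrictMono.coe_orderIsoOfSurjective, OrderIso.refl_apply] at this
    simp [this]
  · simp

/-! ### Correlators and polynomials -/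

/-- The sites that correspond to the exponents of a monomial in `N` variables. -/
def sites (α : Fin N →₀ ℕ) (i : Fin N) : ℤ := N - 1 - α i

theorem isAlternating_correlator (v : Fock) :
    IsAlternating fun α : Fin N →₀ ℕ => correlator (sites α) v := by
  intro e α
  have : sites (α.mapDomain e) = sites α ∘ e.symm := by
    funext i
    rw [sites, Finsupp.mapDomain_equiv_apply]
    rfl
  beta_reduce
  rw [this, correlator_comp_perm, Equiv.Perm.sign_symm]

theorem sites_strictMono {α : Fin N →₀ ℕ} (h : StrictAnti α) : StrictMono (sites α) := by
  intro i j hij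
  have := h hij
  simp only [sites]
  omega

theorem correlator_sites_schurState (lam : n.Partition) (α : Fin N →₀ ℕ) :
    correlator (sites α) (schurState lam) = coeff α (alternant N (row lam)) := by
  refine congrFun ((isAlternating_correlator (schurState lam)).ext
    (isAlternating_coeff fun e => rename_alternant e _) fun α hα => ?_) α
  rw [correlator_schurState lam (sites_strictMono hα) fun i => by rw [sites]; omega]
  by_cases h : row lam N = 0
  · rw [coeff_alternant_of_strictAnti (row_antitone lam) h hα]
    refine if_congr ?_ rfl rfl
    simp only [h, and_true, sites]
    refine forall_congr' fun i => ?_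
    have := i.2
    omega
  · rw [alternant, if_neg h, coeff_zero, if_neg fun h' => h h'.2]

theorem schurState_zero (lam : Nat.Partition 0) : schurState lam = vac := by
  have : durfee lam = 0 := by
    by_contra h
    have := (lt_durfee_iff lam 0).1 (Nat.pos_of_ne_zero h)
    rw [row_eq_zero lam le_rfl] at this
    omega
  rw [schurState, this]
  simp

/-- The vacuum is the Schur state of the empty partition, hence corresponds to `delta`. An
oscillator adds `k` to one site, and multiplication by a power sum adds `k` to one exponent, so its
coefficient at `α` involves `α j - k`. If `k > α j` the shifted site lies outside the window and the
correlator vanishes, in agreement with the missing monomial. -/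
theorem correlator_sites_bosonize (g : BosonFock) (α : Fin N →₀ ℕ) :
    correlator (sites α) (bosonize g) = coeff α (powerSumEval N g * delta N) := by
  induction g using MvPolynomial.induction_on generalizing α with
  | C a =>
    have h : row (default : Nat.Partition 0) = fun _ => 0 :=
      funext fun i => row_eq_zero _ (Nat.zero_le i)
    rw [bosonize_C, map_smul, ← schurState_zero default, correlator_sites_schurState,
      powerSumEval_C, coeff_C_mul, smul_eq_mul, delta, h]
  | add p q hp hq =>
    rw [map_add, map_add, map_add, add_mul, coeff_add, hp, hq]
  | mul_X p k hp =>
    rw [mul_comm, bosonize_X_mul, correlator_osc (by exact_mod_cast k.pos), map_mul, powerSumEval_X,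
      mul_assoc, psum, Finset.sum_mul, coeff_sum]
    refine Finset.sum_congr rfl fun j _ => ?_
    rw [X_pow_eq_monomial, coeff_monomial_mul', one_mul]
    by_cases h : (k : ℕ) ≤ α j
    · rw [if_pos (Finsupp.single_le_iff.2 h), ← hp]
      congr 2
      funext i
      by_cases hi : i = j
      · subst hi
        rw [Function.update_self, sites, sites]
        simp
        omega
      · rw [Function.update_of_ne hi, sites, sites]
        simp [Ne.symm hi]
    · rw [if_neg (fun h' => h (Finsupp.single_le_iff.1 h'))]
      refine correlator_eq_zero (j := j) ?_ _
      rw [Function.update_self, sites]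
      omega

end

/-! ### Matrix elements of `Ht`. -/

section

variable {N : ℕ}

/-! ### The triangular part of the Hamiltonian -/

theorem mul_prod_of_anticommute {R : Type*} [Ring R] {a : R} {L : List R}
    (h : ∀ b ∈ L, a * b = -(b * a)) : a * L.prod = (-1) ^ L.length * (L.prod * a) := by
  induction L with
  | nil => simp
  | cons b L ih =>
    rw [List.prod_cons, ← mul_assoc, h b (by simp), neg_mul, mul_assoc,
      ih fun c hc => h c (by simp [hc]), List.length_cons, pow_succ, mul_neg_one, neg_mul,
      ← mul_assoc b, ← ((Commute.neg_one_left b).pow_left _).eq]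
    noncomm_ring

theorem normalOrder_of_anticommute {L : List Mode}
    (h : L.Pairwise fun a b => a.op * b.op = -(b.op * a.op)) :
    normalOrder L = (L.map Mode.op).prod := by
  induction L with
  | nil => rfl
  | cons a L ih =>
    rw [List.pairwise_cons] at h
    rw [normalOrder, ih h.2, List.map_cons, List.prod_cons]
    split_ifs
    · rfl
    · rw [mul_prod_of_anticommute (L := L.map Mode.op), List.length_map]
      · rcases neg_one_pow_eq_or ℂ L.length with h1 | h1 <;>
          rcases Nat.even_or_odd L.length with h2 | h2 <;>
          simp [h2.neg_one_pow]
      · intro b hb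
        obtain ⟨c, hc, rfl⟩ := List.mem_map.1 hb
        exact h.1 c hc

/-- No creation operator is paired with its own annihilator, so all four modes anticommute and
normal ordering changes nothing. In `Ht` the conditions on `k + l` and `k + s`, with total index
zero, guarantee this. -/
theorem normalOrder_hop {r s k l : ℤ} (h1 : r + s + 1 ≠ 0) (h2 : r + l + 1 ≠ 0)
    (h3 : k + s + 1 ≠ 0) (h4 : k + l + 1 ≠ 0) :
    normalOrder [.psi r, .psiStar s, .psi k, .psiStar l] =
      ψ r * del (-s - 1) * (ψ k * del (-l - 1)) := by
  have hr : (Mode.psi r).op = ψ r := rfl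
  have hk : (Mode.psi k).op = ψ k := rfl
  have hs : (Mode.psiStar s).op = del (-s - 1) := ψs_eq_del s
  have hl : (Mode.psiStar l).op = del (-l - 1) := ψs_eq_del l
  have hψd : ∀ {a b : ℤ}, a ≠ b → ψ a * del b = -(del b * ψ a) := fun h => by
    rw [del_mul_ψ_of_ne h, neg_neg]
  rw [normalOrder_of_anticommute]
  · simp only [List.map_cons, List.map_nil, List.prod_cons, List.prod_nil, mul_one, hr, hk, hs, hl]
    noncomm_ring
  · simp only [List.pairwise_cons, List.mem_cons, List.not_mem_nil, or_false, forall_eq_or_imp,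
      forall_eq, hr, hk, hs, hl]
    refine ⟨⟨hψd (by omega), ψ_mul_ψ_swap _ _, hψd (by omega)⟩,
      ⟨del_mul_ψ_of_ne (by omega), del_mul_del_swap _ _⟩, hψd (by omega), ?_, List.Pairwise.nil⟩
    simp

/-- A summand of `Ht`. -/
def hopTerm (p : ℤ × ℤ × ℤ) : Module.End ℂ Fock :=
  if 0 < p.2.1 + p.2.2 + 1 ∧ p.2.1 + p.1 + 1 < 0 ∧ -p.1 - p.2.1 - p.2.2 - 2 < p.2.1 then
    (2 * ((p.2.1 : ℂ) - (-p.1 - p.2.1 - p.2.2 - 2 : ℤ))) •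
      (ψ (-p.1 - p.2.1 - p.2.2 - 2) * del (-p.1 - 1) * (ψ p.2.1 * del (-p.2.2 - 1)))
  else 0

theorem Ht_eq : Ht = locSum fockBasis hopTerm := by
  rw [Ht]
  congr 1
  funext p
  rw [hopTerm]
  refine if_ctx_congr Iff.rfl (fun h => ?_) fun _ => rfl
  rw [normalOrder_hop (by omega) (by omega) (by omega) (by omega), half, half]
  congr 2
  ring

/-- The vacuum structure outside `[-B, B)` bounds `l` above and `k` above; the inequalities of the
hop then confine all indices. -/
theorem locFin_hopTerm : LocFin fockBasis hopTerm := by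
  intro S
  obtain ⟨B, hB⟩ := exists_boundedBy S
  have h0 := hB.1
  refine ((Set.finite_Icc (-(3 * B) - 1) B).prod ((Set.finite_Icc (-B) B).prod
    (Set.finite_Icc (-B) B))).subset fun p hp => ?_
  obtain ⟨s, k, l⟩ := p
  simp only [Set.mem_ofPred_eq, hopTerm, Set.mem_prod, Set.mem_Icc] at hp ⊢
  split_ifs at hp with h
  · rw [LinearMap.smul_apply] at hp
    have hp := right_ne_zero_of_smul hp
    have h1 : -B ≤ -l - 1 := by
      by_contra hc
      refine hp ?_
      rw [Module.End.mul_apply, Module.End.mul_apply (ψ k), hB.del_apply (by omega), map_zero,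
        map_zero]
    have h2 : k < B := by
      by_contra hc
      refine hp ?_
      rw [← neg_neg (ψ k * _), ← del_mul_ψ_of_ne (by omega), Module.End.mul_apply,
        LinearMap.neg_apply, Module.End.mul_apply (del _) (ψ k), hB.ψ_apply (by omega), map_zero,
        neg_zero, map_zero]
    omega
  · exact absurd (LinearMap.zero_apply _) hp

theorem update_update_eq_comp_swap {A : Type*} (m : Fin N → A) {i j : Fin N} (hij : i ≠ j)
    (p q : A) : Function.update (Function.update m j q) i p =
      Function.update (Function.update m j p) i q ∘ Equiv.swap i j := by
  funext x
  rw [Function.comp_apply]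
  by_cases hi : x = i
  · subst hi
    rw [Function.update_self, Equiv.swap_apply_left, Function.update_of_ne hij.symm,
      Function.update_self]
  · by_cases hj : x = j
    · subst hj
      rw [Function.update_of_ne hi, Function.update_self, Equiv.swap_apply_right,
        Function.update_self]
    · rw [Equiv.swap_apply_of_ne_of_ne hi hj, Function.update_of_ne hi, Function.update_of_ne hj,
        Function.update_of_ne hi, Function.update_of_ne hj]

/-- Two particles at the outer sites `p` and `q` move to the inner sites `r` and `k`. The hops as
written cross, and assigning each inner site to the nearer outer one costs a transposition, hence
the minus sign. -/
theorem correlator_hop {r q k p : ℤ} (h1 : p < r) (h2 : r < k) (h3 : k < q) (m : Fin N → ℤ)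
    (v : Fock) : correlator m ((ψ r * del q * (ψ k * del p)) v) =
      ∑ j, ∑ i, if m j = r ∧ m i = k then
        -correlator (Function.update (Function.update m j p) i q) v else 0 := by
  simp only [Module.End.mul_apply]
  rw [correlator_ψ_mul_del (by omega) (by omega)]
  refine Finset.sum_congr rfl fun j _ => ?_
  split_ifs with hj
  · have hne : ∀ i, m i = k → i ≠ j := fun i hi hij => by rw [hij] at hi; omega
    have h4 : ∀ i, (if m j = r ∧ m i = k then
        -correlator (Function.update (Function.update m j p) i q) v else 0) =
        if Function.update m j q i = k then
          correlator (Function.update (Function.update m j q) i p) v else 0 := by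
      intro i
      by_cases hi : i = j
      · subst hi
        rw [Function.update_self, if_neg (by omega), if_neg (by omega)]
      · rw [Function.update_of_ne hi]
        refine if_ctx_congr (by simp [hj]) (fun _ => ?_) fun _ => rfl
        rw [update_update_eq_comp_swap m hi, correlator_comp_perm, Equiv.Perm.sign_swap hi]
        simp
    rw [Finset.sum_congr rfl fun i _ => h4 i]
    by_cases hk : k < N
    · rw [correlator_ψ_mul_del (by omega) (Or.inl hk)]
    · rw [correlator_eq_zero (j := j) (by rw [Function.update_self]; omega)]
      symm
      refine Finset.sum_eq_zero fun i _ => ?_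
      split_ifs with hi
      · refine correlator_eq_zero (j := j) ?_ _
        have : i ≠ j := fun h => by rw [h, Function.update_self] at hi; omega
        rw [Function.update_of_ne this.symm, Function.update_self]
        omega
      · rfl
  · symm
    exact Finset.sum_eq_zero fun i _ => if_neg fun h => hj h.1

theorem sites_update {α : Fin N →₀ ℕ} {i j : Fin N} (hij : i ≠ j) {t : ℕ} (ht : t ≤ α j) :
    Function.update (Function.update (sites α) i (sites α i - t)) j (sites α j + t) =
      sites (α + Finsupp.single i t - Finsupp.single j t) := by
  funext x
  by_cases hj : x = j
  · subst hj
    rw [Function.update_self, sites, sites]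
    simp [hij]
    omega
  · rw [Function.update_of_ne hj]
    by_cases hi : x = i
    · subst hi
      rw [Function.update_self, sites, sites]
      simp [Ne.symm hij]
      omega
    · rw [Function.update_of_ne hi, sites, sites]
      simp [Ne.symm hi, Ne.symm hj]

/-- The inner sites must be `sites α i` and `sites α j`, and the outer ones lie at a distance `t`
beyond them. In exponents this is `α` with `t` moved from `j` to `i`, and the factor `2 * (k - r)`
is `2 * (α i - α j)`. -/
theorem correlator_Ht {α : Fin N →₀ ℕ} (hα : StrictAnti α) (v : Fock) :
    correlator (sites α) (Ht v) = -∑ i, ∑ j ∈ Finset.Ioi i, 2 * ((α i : ℂ) - α j) *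
      ∑ t ∈ Finset.Ico 1 (α j + 1),
        correlator (sites (α + Finsupp.single i t - Finsupp.single j t)) v := by
  set m := sites α with hm
  have hmono := sites_strictMono hα
  let g : Fin N → Fin N → ℤ × ℤ × ℤ → ℂ := fun i j p =>
    if (0 < p.2.1 + p.2.2 + 1 ∧ p.2.1 + p.1 + 1 < 0 ∧ -p.1 - p.2.1 - p.2.2 - 2 < p.2.1) ∧
      m i = -p.1 - p.2.1 - p.2.2 - 2 ∧ m j = p.2.1 then
        -(2 * ((m j : ℂ) - m i) *
          correlator (Function.update (Function.update m i (-p.2.2 - 1)) j (-p.1 - 1)) v)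
    else 0
  have hg : ∀ p, correlator m (hopTerm p v) = ∑ i, ∑ j, g i j p := by
    intro p
    rw [hopTerm]
    split_ifs with h
    · rw [LinearMap.smul_apply, map_smul, correlator_hop (by omega) (by omega) (by omega),
        Finset.smul_sum]
      refine Finset.sum_congr rfl fun i _ => ?_
      rw [Finset.smul_sum]
      refine Finset.sum_congr rfl fun j _ => ?_
      simp only [g]
      by_cases h' : m i = -p.1 - p.2.1 - p.2.2 - 2 ∧ m j = p.2.1
      · rw [if_pos h', if_pos ⟨h, h'⟩, h'.1, h'.2, smul_eq_mul]
        ring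
      · rw [if_neg h', if_neg fun h'' => h' h''.2, smul_zero]
    · rw [LinearMap.zero_apply, map_zero]
      symm
      refine Finset.sum_eq_zero fun i _ => Finset.sum_eq_zero fun j _ => ?_
      exact if_neg fun h' => h h'.1
  -- For fixed inner sites the conservation law leaves one free parameter, the squeezing distance
  -- `t`.
  let φ : Fin N → Fin N → ℕ → ℤ × ℤ × ℤ := fun i j t => (-(m j + t) - 1, m j, -(m i - t) - 1)
  have hφ : ∀ i j, Function.Injective (φ i j) := by
    intro i j t t' h
    have := congrArg Prod.fst h
    simp only [φ] at this
    omega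
  have hsupp : ∀ i j, Function.support (g i j) ⊆ ↑((Finset.Ico 1 (α j + 1)).image (φ i j)) := by
    rintro i j ⟨s, k, l⟩ hp
    simp only [g, Function.mem_support, ne_eq, ite_eq_right_iff, not_forall] at hp
    obtain ⟨⟨h1, h2, h3⟩, h4⟩ := hp
    -- A site outside the window kills the correlator, which gives the bound `t ≤ α j`.
    have h5 : -s - 1 < N := by
      by_contra hc
      rw [correlator_eq_zero (j := j) (by rw [Function.update_self]; omega), mul_zero] at h4
      simp at h4
    simp only [Finset.coe_image, Set.mem_image, Finset.coe_Ico, Set.mem_Ico]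
    have h6 : m j = N - 1 - α j := rfl
    refine ⟨(-s - 1 - k).toNat, by omega, ?_⟩
    simp only [φ, Prod.mk.injEq]
    omega
  have hsum : ∀ i j, ∑ᶠ p, g i j p = if i < j then -(2 * ((α i : ℂ) - α j) *
      ∑ t ∈ Finset.Ico 1 (α j + 1),
        correlator (sites (α + Finsupp.single i t - Finsupp.single j t)) v) else 0 := by
    intro i j
    rw [finsum_eq_sum_of_support_subset _ (hsupp i j),
      Finset.sum_image fun _ _ _ _ h => hφ i j h]
    split_ifs with hij
    · rw [Finset.mul_sum, ← Finset.sum_neg_distrib]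
      refine Finset.sum_congr rfl fun t ht => ?_
      rw [Finset.mem_Ico] at ht
      have h1 : m i < m j := hmono hij
      simp only [g, φ]
      rw [if_pos ⟨⟨by omega, by omega, by omega⟩, by omega, trivial⟩,
        ← sites_update hij.ne (by omega)]
      have h2 : (m j : ℂ) - m i = α i - α j := by
        simp only [m, sites]
        push_cast
        ring
      rw [h2, show -(-(m i - t) - 1) - 1 = m i - t by ring,
        show -(-(m j + t) - 1) - 1 = m j + t by ring]
    · refine Finset.sum_eq_zero fun t ht => ?_
      simp only [g, φ]
      refine if_neg fun h => hij (hmono.lt_iff_lt.1 ?_)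
      change m i < m j
      omega
  rw [Ht_eq, locFin_hopTerm.map_locSum_apply, finsum_congr hg, finsum_sum_comm, ←
    Finset.sum_neg_distrib]
  · refine Finset.sum_congr rfl fun i _ => ?_
    rw [finsum_sum_comm _ _ fun j _ => (Finset.finite_toSet _).subset (hsupp i j),
      Finset.sum_congr rfl fun j _ => hsum i j, ← Finset.sum_filter, Finset.filter_lt_eq_Ioi,
      Finset.sum_neg_distrib]
  · intro i _
    refine (Set.finite_iUnion fun j => (Finset.finite_toSet _).subset (hsupp i j)).subset ?_
    intro p hp
    obtain ⟨j, -, hj⟩ := Finset.exists_ne_zero_of_sum_ne_zero hp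
    exact Set.mem_iUnion.2 ⟨j, hj⟩

end

/-! ### Grading by charge and level; Schur states as a basis of the charge-zero part. -/

section

/-! ### Charge and energy -/

/-- The charge of a basis state. -/
def charge (S : Finset ℤ) : ℤ := ∑ x ∈ S, if x < 0 then 1 else -1

/-- The sum of the energies of the particles and holes of a basis state, for the charge zero
normalization. -/
def level (S : Finset ℤ) : ℤ := ∑ x ∈ S, |x|

/-- The span of the basis states of given charge and level. -/
def graded (q e : ℤ) : Submodule ℂ Fock :=
  Submodule.span ℂ (fockBasis '' {S | charge S = q ∧ level S = e})

theorem fockBasis_mem_graded (S : Finset ℤ) : fockBasis S ∈ graded (charge S) (level S) :=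
  Submodule.subset_span ⟨S, ⟨rfl, rfl⟩, rfl⟩

/-- The operator shifts charge by `c` and level by `d`. -/
def Shifts (c d : ℤ) (T : Module.End ℂ Fock) : Prop :=
  ∀ q e v, v ∈ graded q e → T v ∈ graded (q + c) (e + d)

theorem shifts_of_basis {c d : ℤ} {T : Module.End ℂ Fock}
    (h : ∀ S, T (fockBasis S) ∈ graded (charge S + c) (level S + d)) : Shifts c d T := by
  intro q e v hv
  induction hv using Submodule.span_induction with
  | mem x hx =>
    obtain ⟨S, ⟨rfl, rfl⟩, rfl⟩ := hx
    exact h S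
  | zero => rw [map_zero]; exact Submodule.zero_mem _
  | add x y _ _ hx hy => rw [map_add]; exact Submodule.add_mem _ hx hy
  | smul a x _ hx => rw [map_smul]; exact Submodule.smul_mem _ _ hx

theorem Shifts.mul {c d c' d' : ℤ} {T T' : Module.End ℂ Fock} (h : Shifts c d T)
    (h' : Shifts c' d' T') : Shifts (c' + c) (d' + d) (T * T') := by
  intro q e v hv
  rw [← add_assoc, ← add_assoc]
  exact h _ _ _ (h' _ _ _ hv)

theorem Shifts.smul {c d : ℤ} {T : Module.End ℂ Fock} (h : Shifts c d T) (a : ℂ) :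
    Shifts c d (a • T) := fun q e v hv => Submodule.smul_mem _ _ (h q e v hv)

theorem Shifts.neg {c d : ℤ} {T : Module.End ℂ Fock} (h : Shifts c d T) : Shifts c d (-T) :=
  fun q e v hv => Submodule.neg_mem _ (h q e v hv)

theorem Shifts.add {c d : ℤ} {T T' : Module.End ℂ Fock} (h : Shifts c d T) (h' : Shifts c d T') :
    Shifts c d (T + T') := fun q e v hv => Submodule.add_mem _ (h q e v hv) (h' q e v hv)

theorem shifts_zero (c d : ℤ) : Shifts c d 0 := fun _ _ _ _ => Submodule.zero_mem _

theorem Shifts.locSum {ι : Type*} {c d : ℤ} {T : ι → Module.End ℂ Fock} (hT : LocFin fockBasis T)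
    (h : ∀ i, Shifts c d (T i)) : Shifts c d (locSum fockBasis T) := by
  intro q e v hv
  rw [hT.locSum_apply]
  exact finsum_induction (· ∈ graded (q + c) (e + d)) (Submodule.zero_mem _)
    (fun _ _ hx hy => Submodule.add_mem _ hx hy) fun i => h i q e v hv

theorem charge_insert {x : ℤ} {S : Finset ℤ} (h : x ∉ S) :
    charge (insert x S) = charge S + if x < 0 then 1 else -1 := by
  rw [charge, Finset.sum_insert h, add_comm, charge]

theorem level_insert {x : ℤ} {S : Finset ℤ} (h : x ∉ S) :
    level (insert x S) = level S + |x| := by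
  rw [level, Finset.sum_insert h, add_comm, level]

theorem shifts_create (x : ℤ) : Shifts (if x < 0 then 1 else -1) |x| (create x) := by
  refine shifts_of_basis fun S => ?_
  rw [create_apply]
  by_cases h : x ∈ S
  · rw [if_pos h]
    exact Submodule.zero_mem _
  · rw [if_neg h]
    exact Submodule.smul_mem _ _
      (Submodule.subset_span ⟨insert x S, ⟨charge_insert h, level_insert h⟩, rfl⟩)

theorem shifts_annihilate (x : ℤ) : Shifts (-if x < 0 then 1 else -1) (-|x|) (annihilate x) := by
  refine shifts_of_basis fun S => ?_
  rw [annihilate_apply]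
  by_cases h : x ∈ S
  · rw [if_pos h]
    have h1 := charge_insert (Finset.notMem_erase x S)
    have h2 := level_insert (Finset.notMem_erase x S)
    rw [Finset.insert_erase h] at h1 h2
    exact Submodule.smul_mem _ _ (Submodule.subset_span ⟨S.erase x, ⟨by omega, by omega⟩, rfl⟩)
  · rw [if_neg h]
    exact Submodule.zero_mem _

theorem shifts_ψ (a : ℤ) : Shifts 1 (-a) (ψ a) := by
  rcases lt_or_ge a 0 with h | h
  · have := shifts_create a
    rwa [if_pos h, abs_of_neg h, ← ψ_of_neg h] at this
  · have := shifts_annihilate a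
    rwa [if_neg (not_lt.2 h), abs_of_nonneg h, ← ψ_of_nonneg h, neg_neg] at this

theorem shifts_del (a : ℤ) : Shifts (-1) a (del a) := by
  rcases lt_or_ge a 0 with h | h
  · have := shifts_annihilate a
    rwa [if_pos h, abs_of_neg h, ← del_of_neg h, neg_neg] at this
  · have := shifts_create a
    rwa [if_neg (not_lt.2 h), abs_of_nonneg h, ← del_of_nonneg h] at this

theorem Shifts.congr {c d c' d' : ℤ} {T : Module.End ℂ Fock} (h : Shifts c d T) (hc : c = c')
    (hd : d = d') : Shifts c' d' T := hc ▸ hd ▸ h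

theorem shifts_osc (n : ℤ) : Shifts 0 (-n) (osc n) := by
  refine Shifts.locSum (locFin_osc n) fun k => ?_
  rw [normalOrder_psi_psiStar]
  split_ifs
  · exact ((shifts_ψ _).mul (shifts_del _)).congr (by ring) (by ring)
  · exact ((shifts_del _).mul (shifts_ψ _)).neg.congr (by ring) (by ring)

theorem shifts_Ht : Shifts 0 0 Ht := by
  rw [Ht_eq]
  refine Shifts.locSum locFin_hopTerm fun p => ?_
  rw [hopTerm]
  split_ifs
  · exact ((((shifts_ψ _).mul (shifts_del _)).mul ((shifts_ψ _).mul (shifts_del _))).smul _).congr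
      (by ring) (by ring)
  · exact shifts_zero _ _

/-! ### Schur states span the charge zero states of a given level -/

variable {n N : ℕ}

theorem sum_stateSet (lam : n.Partition) {A : Type*} [AddCommMonoid A] (φ : ℤ → A) :
    ∑ x ∈ stateSet lam, φ x = ∑ i ∈ Finset.range (durfee lam), φ (i - row lam i) +
      ∑ j ∈ Finset.range (durfee lam), φ (col lam j - j - 1) := by
  rw [stateSet, Finset.sum_union, Finset.sum_image fun _ _ _ _ h =>
    (strictMono_sub_row lam).injective h, Finset.sum_image fun _ _ _ _ h =>
    (strictAnti_col_sub lam).injective h]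
  rw [Finset.disjoint_left]
  intro x hx hx'
  obtain ⟨i, _, rfl⟩ := Finset.mem_image.1 hx
  obtain ⟨j, _, hij⟩ := Finset.mem_image.1 hx'
  exact row_add_col_ne lam i j hij.symm

theorem particle_neg (lam : n.Partition) {i : ℕ} (h : i ∈ Finset.range (durfee lam)) :
    (i : ℤ) - row lam i < 0 := by
  have := (lt_durfee_iff lam i).1 (Finset.mem_range.1 h)
  omega

theorem hole_nonneg (lam : n.Partition) {j : ℕ} (h : j ∈ Finset.range (durfee lam)) :
    0 ≤ (col lam j : ℤ) - j - 1 := by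
  have := (lt_durfee_iff_col lam j).1 (Finset.mem_range.1 h)
  omega

theorem charge_stateSet (lam : n.Partition) : charge (stateSet lam) = 0 := by
  rw [charge, sum_stateSet, Finset.sum_congr rfl fun i hi => if_pos (particle_neg lam hi),
    Finset.sum_congr rfl fun i hi => if_neg (not_lt.2 (hole_nonneg lam hi))]
  simp

theorem level_stateSet (lam : n.Partition) : level (stateSet lam) = n := by
  have h := sum_particles_sub_sum_holes lam (row_eq_zero lam le_rfl) fun x => x
  rw [level, sum_stateSet, Finset.sum_congr rfl fun i hi => abs_of_neg (particle_neg lam hi),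
    Finset.sum_congr rfl fun i hi => abs_of_nonneg (hole_nonneg lam hi), Finset.sum_neg_distrib]
  have h2 : ∑ i ∈ Finset.range n, (row lam i : ℤ) = n := by
    exact_mod_cast sum_row_of_le lam le_rfl
  have h3 := Finset.sum_sub_distrib (s := Finset.range n) (fun i => (i : ℤ)) fun i => (row lam i : ℤ)
  rw [h3, h2] at h
  linarith

theorem exists_strictMono_extension {m : Fin N → ℤ} (hm : StrictMono m) (hN : ∀ i, m i < N) :
    ∃ f : ℕ → ℤ, StrictMono f ∧ (∀ i : Fin N, f i = m i) ∧ ∀ i, N ≤ i → f i = i := by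
  refine ⟨fun i => if h : i < N then m ⟨i, h⟩ else i, ?_, fun i => dif_pos i.2,
    fun i hi => dif_neg (not_lt.2 hi)⟩
  intro i j hij
  beta_reduce
  by_cases hj : j < N
  · rw [dif_pos hj, dif_pos (hij.trans hj)]
    exact hm hij
  · rw [dif_neg hj]
    split_ifs with hi
    · have := hN ⟨i, hi⟩
      omega
    · omega

theorem sum_symmDiff_Ico {S : Finset ℤ} (hS : ∀ x ∈ S, x < N) (φ : ℤ → ℤ) :
    ∑ x ∈ symmDiff (Finset.Ico 0 (N : ℤ)) S, φ x =
      ∑ x ∈ Finset.Ico 0 (N : ℤ), φ x + ∑ x ∈ S, (if x < 0 then 1 else -1) * φ x := by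
  have h1 : S \ Finset.Ico 0 (N : ℤ) = S.filter (· < 0) := by
    ext x
    have := hS x
    simp only [Finset.mem_sdiff, Finset.mem_Ico, Finset.mem_filter, not_and, not_lt]
    constructor
    · rintro ⟨h, h'⟩
      exact ⟨h, by by_contra hc; have := this h; have := h' (not_lt.1 hc); omega⟩
    · rintro ⟨h, h'⟩
      exact ⟨h, fun _ => by omega⟩
  have h2 : Finset.Ico 0 (N : ℤ) ∩ S = S.filter fun x => ¬x < 0 := by
    ext x
    have := hS x
    simp only [Finset.mem_inter, Finset.mem_Ico, Finset.mem_filter, not_lt]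
    tauto
  have h3 := Finset.sum_inter_add_sum_sdiff (Finset.Ico 0 (N : ℤ)) S φ
  have h4 : ∑ x ∈ S, (if x < 0 then 1 else -1) * φ x =
      ∑ x ∈ S.filter (· < 0), φ x - ∑ x ∈ S.filter (fun x => ¬x < 0), φ x := by
    rw [Finset.sum_filter, Finset.sum_filter, ← Finset.sum_sub_distrib]
    refine Finset.sum_congr rfl fun x _ => ?_
    split_ifs <;> simp
  rw [symmDiff_def, Finset.sup_eq_union, Finset.sum_union disjoint_sdiff_sdiff, h1, ← h3, h2, h4]
  ring

/-- Among the sites below a large `N`, charge zero means that exactly `N` are occupied. Their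
increasing enumeration lags behind the identity by a decreasing sequence, which is the partition,
and the level is its size. -/
theorem exists_stateSet_eq {S : Finset ℤ} (hc : charge S = 0) (hl : level S = n) :
    ∃ lam : n.Partition, stateSet lam = S := by
  obtain ⟨B, hB⟩ := exists_boundedBy S
  obtain ⟨N, rfl⟩ := Int.eq_ofNat_of_zero_le hB.1
  have hS : ∀ x ∈ S, x < N := fun x hx => (hB.2 x hx).2
  set M := symmDiff (Finset.Ico 0 (N : ℤ)) S with hM
  have hcard : M.card = N := by
    have := sum_symmDiff_Ico hS fun _ => 1
    rw [← hM] at this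
    simp only [Finset.sum_const, nsmul_eq_mul, mul_one, Int.card_Ico] at this
    have h0 : ∑ x ∈ S, (if x < 0 then 1 else -1 : ℤ) = 0 := hc
    rw [h0] at this
    omega
  have hsum : ∑ x ∈ M, x = ∑ i ∈ Finset.range N, (i : ℤ) - n := by
    have := sum_symmDiff_Ico hS fun x => x
    rw [← hM] at this
    rw [this, ← hl, level, sub_eq_add_neg, ← Finset.sum_neg_distrib]
    congr 1
    · rw [← Finset.sum_image (f := fun x : ℤ => x) (g := fun i : ℕ => (i : ℤ)) (by simp)]
      congr 1
      ext x
      simp only [Finset.mem_Ico, Finset.mem_image, Finset.mem_range]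
      constructor
      · intro h
        exact ⟨x.toNat, by omega, by omega⟩
      · rintro ⟨i, hi, rfl⟩
        omega
    · refine Finset.sum_congr rfl fun x _ => ?_
      split_ifs with h
      · rw [abs_of_neg h]; ring
      · rw [abs_of_nonneg (not_lt.1 h)]; ring
  set m : Fin N → ℤ := fun i => M.orderEmbOfFin hcard i with hm
  have himage : Finset.univ.image m = M := Finset.image_orderEmbOfFin_univ M hcard
  have hmono : StrictMono m := (M.orderEmbOfFin hcard).strictMono
  have hN : ∀ i, m i < N := by
    intro i
    have : m i ∈ M := Finset.orderEmbOfFin_mem M hcard i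
    rw [hM, Finset.mem_symmDiff, Finset.mem_Ico] at this
    rcases this with h | h
    · exact h.1.2
    · exact hS _ h.1
  obtain ⟨f, hf, hf1, hf2⟩ := exists_strictMono_extension hmono hN
  have hanti : Antitone fun i : ℕ => (i : ℤ) - f i := by
    refine antitone_nat_of_succ_le fun i => ?_
    have := hf (Nat.lt_succ_self i)
    push_cast
    simp only [Nat.succ_eq_add_one] at this
    omega
  have hnonneg : ∀ i : ℕ, f i ≤ i := by
    intro i
    rcases le_total N i with h | h
    · exact (hf2 i h).le
    · have := hanti h
      simp only [hf2 N le_rfl] at this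
      omega
  obtain ⟨lam, hlam, -⟩ := exists_partition_row_eq (n := n)
    (ρ := fun i => ((i : ℤ) - f i).toNat) (fun i j hij => by
      have := hanti hij
      simp only at this ⊢
      omega) (N := N) (by simp [hf2 N le_rfl]) (by
      have h1 : ∑ i ∈ Finset.range N, f i = ∑ x ∈ M, x := by
        rw [← himage, Finset.sum_image fun _ _ _ _ h => hmono.injective h, Finset.sum_range]
        exact Finset.sum_congr rfl fun i _ => hf1 i
      zify
      rw [Finset.sum_congr rfl fun i _ => Int.toNat_of_nonneg (sub_nonneg.2 (hnonneg i)),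
        Finset.sum_sub_distrib, h1, hsum]
      ring)
  refine ⟨lam, ?_⟩
  rw [← (symmDiff_eq_stateSet_iff lam hmono hN).2, himage, hM, symmDiff_symmDiff_cancel_left]
  rw [hlam]
  refine ⟨fun i => ?_, by simp [hf2 N le_rfl]⟩
  have := hnonneg i
  rw [hf1] at this
  simp only [hf1]
  omega

theorem schurState_mem_graded (lam : n.Partition) : schurState lam ∈ graded 0 n := by
  rw [schurState_eq]
  exact Submodule.smul_mem _ _
    (Submodule.subset_span ⟨_, ⟨charge_stateSet lam, level_stateSet lam⟩, rfl⟩)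

theorem graded_zero_eq_span :
    graded 0 n = Submodule.span ℂ (Set.range (schurState : n.Partition → Fock)) := by
  apply le_antisymm
  · refine Submodule.span_le.2 ?_
    rintro _ ⟨S, ⟨hc, hl⟩, rfl⟩
    obtain ⟨lam, rfl⟩ := exists_stateSet_eq hc hl
    have : fockBasis (stateSet lam) =
        ((-1 : ℂ) ^ ∑ i ∈ Finset.range (durfee lam), (col lam i - i - 1)) • schurState lam := by
      rw [schurState_eq, smul_smul, ← mul_pow]
      simp
    rw [this]
    exact Submodule.smul_mem _ _ (Submodule.subset_span ⟨lam, rfl⟩)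
  · refine Submodule.span_le.2 ?_
    rintro _ ⟨lam, rfl⟩
    exact schurState_mem_graded lam

/-! ### Schur coefficients -/

/-- The exponents of the leading monomial of the alternant of a partition. -/
def exponents (N : ℕ) (lam : n.Partition) : Fin N →₀ ℕ :=
  Finsupp.equivFunOnFinite.symm fun i => row lam i + (N - 1 - (i : ℕ))

theorem exponents_apply (lam : n.Partition) (i : Fin N) :
    exponents N lam i = row lam i + (N - 1 - (i : ℕ)) := rfl

theorem exponents_strictAnti (lam : n.Partition) : StrictAnti (exponents N lam) := by
  intro i j hij
  have := row_antitone lam (show (i : ℕ) ≤ j from hij.le)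
  have : (i : ℕ) < j := hij
  rw [exponents_apply, exponents_apply]
  omega

/-- The coefficient of the Schur state of a partition. -/
def schurCoeff (lam : n.Partition) : Fock →ₗ[ℂ] ℂ := correlator (sites (exponents n lam))

theorem coeff_alternant_exponents {lam mu : n.Partition} (h : row lam N = 0) (h' : row mu N = 0) :
    coeff (exponents N lam) (alternant N (row mu)) = if mu = lam then 1 else 0 := by
  rw [coeff_alternant_of_strictAnti (row_antitone mu) h' (exponents_strictAnti lam)]
  refine if_congr ⟨fun h1 => row_injective (funext fun i => ?_), fun h1 => ?_⟩ rfl rfl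
  · rcases lt_or_ge i N with hi | hi
    · have := h1 ⟨i, hi⟩
      rw [exponents_apply] at this
      simp only at this
      omega
    · have := row_antitone lam hi
      have := row_antitone mu hi
      omega
  · rw [h1]
    exact fun i => rfl

/-- A partition of `n` has at most `n` parts, so `n` variables separate all Schur states of level
`n`. -/
theorem schurCoeff_schurState (lam mu : n.Partition) :
    schurCoeff lam (schurState mu) = if mu = lam then 1 else 0 := by
  rw [schurCoeff, correlator_sites_schurState,
    coeff_alternant_exponents (row_eq_zero _ le_rfl) (row_eq_zero _ le_rfl)]

theorem eq_sum_schurCoeff {v : Fock} (h : v ∈ graded 0 n) :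
    v = ∑ lam : n.Partition, schurCoeff lam v • schurState lam := by
  rw [graded_zero_eq_span] at h
  induction h using Submodule.span_induction with
  | mem x hx =>
    obtain ⟨mu, rfl⟩ := hx
    simp [schurCoeff_schurState]
  | zero => simp
  | add x y _ _ hx hy =>
    conv_lhs => rw [hx, hy]
    simp only [map_add, add_smul, Finset.sum_add_distrib]
  | smul a x _ hx =>
    conv_lhs => rw [hx]
    simp only [map_smul, smul_eq_mul, mul_smul, Finset.smul_sum]

theorem eq_of_schurCoeff_eq {v w : Fock} (hv : v ∈ graded 0 n) (hw : w ∈ graded 0 n)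
    (h : ∀ lam : n.Partition, schurCoeff lam v = schurCoeff lam w) : v = w := by
  rw [eq_sum_schurCoeff hv, eq_sum_schurCoeff hw]
  simp only [h]

end

/-! ### Spectrum of `Hd` on occupation-number states. -/

section

/-! ### The diagonal part of the Hamiltonian -/

theorem create_annihilate_apply (x : ℤ) (S : Finset ℤ) :
    (create x * annihilate x) (fockBasis S) = if x ∈ S then fockBasis S else 0 := by
  rw [Module.End.mul_apply, annihilate_apply]
  split_ifs with h
  · rw [map_smul, create_apply, if_neg (Finset.notMem_erase x S), smul_smul, Finset.insert_erase h,
      sgn_erase h, if_neg (lt_irrefl x), sgn_mul_self, one_smul]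
  · rw [map_zero]

/-- The charge of the particle or hole at a site. -/
def siteSign (x : ℤ) : ℂ := if x < 0 then 1 else -1

theorem siteSign_mul_self (x : ℤ) : siteSign x * siteSign x = 1 := by
  rw [siteSign]
  split_ifs <;> simp

theorem create_annihilate_swap {x y : ℤ} (h : x ≠ y) :
    create y * create x * (annihilate y * annihilate x) =
      -(create y * annihilate y * (create x * annihilate x)) := by
  have h1 := create_mul_annihilate x y
  rw [if_neg h] at h1
  rw [mul_assoc, ← mul_assoc (create x), eq_neg_of_add_eq_zero_left h1]
  noncomm_ring

/-- For distinct sites the four modes form two number operators. Bringing them together costs one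
transposition, and each nonnegative site contributes a sign because there its hole is counted. -/
theorem normalOrder_density {x y : ℤ} (h : y < x) (S : Finset ℤ) :
    normalOrder [.psi y, .psiStar (-x - 1), .psi x, .psiStar (-y - 1)] (fockBasis S) =
      if x ∈ S ∧ y ∈ S then (-(siteSign x * siteSign y)) • fockBasis S else 0 := by
  have hψ : ∀ a, (Mode.psi a).op = ψ a := fun _ => rfl
  have hd : ∀ a, (Mode.psiStar (-a - 1)).op = del a := fun a => by
    change ψs _ = _
    rw [ψs_eq_del]
    congr 1
    ring
  have key : normalOrder [.psi y, .psiStar (-x - 1), .psi x, .psiStar (-y - 1)] =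
      (-(siteSign x * siteSign y)) • (create y * annihilate y * (create x * annihilate x)) := by
    have h1 := create_annihilate_swap h.ne'
    have h2 := create_mul_create x y
    have h3 := annihilate_mul_annihilate x y
    simp only [normalOrder, Mode.index, hψ, hd, siteSign, List.length_cons, List.length_nil]
    rcases lt_or_ge x 0 with hx | hx
    · have hy : y < 0 := by omega
      simp only [if_pos hx, if_pos hy, if_neg (show ¬(-x - 1 < 0) by omega),
        if_neg (show ¬(-y - 1 < 0) by omega), ψ_of_neg hx, ψ_of_neg hy, del_of_neg hx,
        del_of_neg hy]
      rw [mul_one (1 : ℂ), neg_smul, one_smul, ← h1]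
      simp [mul_assoc]
    · rcases lt_or_ge y 0 with hy | hy
      · simp only [if_neg (not_lt.2 hx), if_pos hy, if_pos (show -x - 1 < 0 by omega),
          if_neg (show ¬(-y - 1 < 0) by omega), ψ_of_nonneg hx, ψ_of_neg hy, del_of_nonneg hx,
          del_of_neg hy]
        rw [mul_one, neg_neg, one_smul, ← neg_eq_iff_eq_neg.2 h1]
        simp [mul_assoc]
      · simp only [if_neg (not_lt.2 hx), if_neg (not_lt.2 hy), if_pos (show -x - 1 < 0 by omega),
          if_pos (show -y - 1 < 0 by omega), ψ_of_nonneg hx, ψ_of_nonneg hy, del_of_nonneg hx,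
          del_of_nonneg hy]
        rw [neg_mul_neg, mul_one (1 : ℂ), neg_smul, one_smul, ← h1,
          eq_neg_of_add_eq_zero_right h2, eq_neg_of_add_eq_zero_right h3]
        simp [mul_assoc, pow_succ]
  rw [key, LinearMap.smul_apply, Module.End.mul_apply, create_annihilate_apply]
  by_cases hx : x ∈ S
  · rw [if_pos hx, create_annihilate_apply]
    by_cases hy : y ∈ S <;> simp [hx, hy]
  · simp [hx]

/-- The eigenvalue of `Hd` on a basis state. -/
def diagonalValue (S : Finset ℤ) : ℂ :=
  ∑ x ∈ S, siteSign x * (if x < 0 then (-(x : ℂ) - 1) / 3 else -((x : ℂ) * (x + 2 / 3))) -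
    ∑ x ∈ S, ∑ y ∈ S, siteSign x * siteSign y *
      (if y < x then 2 / 3 * (2 * (x : ℂ) - y + 1 / 2) else 0)

theorem sum_range_neg {S : Finset ℤ} {B : ℕ} (hB : BoundedBy B S) (f : ℕ → ℂ) :
    ∑ k ∈ Finset.range B, (if (-k - 1 : ℤ) ∈ S then f k else 0) =
      ∑ x ∈ S, if x < 0 then f (-x - 1).toNat else 0 := by
  rw [← Finset.sum_filter, ← Finset.sum_filter]
  refine Finset.sum_nbij' (fun k => -k - 1) (fun x => (-x - 1).toNat) ?_ ?_ ?_ ?_ ?_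
  · intro k hk
    rw [Finset.mem_filter] at hk ⊢
    exact ⟨hk.2, by omega⟩
  · intro x hx
    rw [Finset.mem_filter] at hx ⊢
    have := hB.2 x hx.1
    rw [Finset.mem_range]
    refine ⟨by omega, ?_⟩
    rw [show -((-x - 1).toNat : ℤ) - 1 = x by omega]
    exact hx.1
  · intro k _
    omega
  · intro x hx
    rw [Finset.mem_filter] at hx
    omega
  · intro k _
    congr 1
    omega

theorem sum_range_nonneg {S : Finset ℤ} {B : ℕ} (hB : BoundedBy B S) (f : ℕ → ℂ) :
    ∑ k ∈ Finset.range B, (if (k : ℤ) ∈ S then f k else 0) =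
      ∑ x ∈ S, if x < 0 then 0 else f x.toNat := by
  simp only [← ite_not (_ < (0 : ℤ))]
  rw [← Finset.sum_filter, ← Finset.sum_filter]
  refine Finset.sum_nbij' (fun k => (k : ℤ)) (fun x => x.toNat) ?_ ?_ ?_ ?_ ?_
  · intro k hk
    rw [Finset.mem_filter] at hk ⊢
    exact ⟨hk.2, by omega⟩
  · intro x hx
    rw [Finset.mem_filter] at hx ⊢
    have := hB.2 x hx.1
    rw [Finset.mem_range]
    refine ⟨by omega, ?_⟩
    rw [show (x.toNat : ℤ) = x by omega]
    exact hx.1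
  · intro k _
    omega
  · intro x hx
    rw [Finset.mem_filter] at hx
    omega
  · intro k _
    congr 1

theorem Hd_fockBasis (S : Finset ℤ) : Hd (fockBasis S) = diagonalValue S • fockBasis S := by
  obtain ⟨B, hB⟩ := exists_boundedBy S
  obtain ⟨B, rfl⟩ := Int.eq_ofNat_of_zero_le hB.1
  have h1 : ∀ k : ℕ, ((1 / 3 * (half k - 1 / 2)) • (ψ (-k - 1) * ψs k) +
      ((half k - 1 / 2) * (half k + 1 / 6)) • (ψs (-k - 1) * ψ k)) (fockBasis S) =
      ((if (-k - 1 : ℤ) ∈ S then (k : ℂ) / 3 else 0) +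
        if (k : ℤ) ∈ S then (k : ℂ) * (k + 2 / 3) else 0) • fockBasis S := by
    intro k
    have e1 : ψ (-k - 1) * ψs k = create (-k - 1) * annihilate (-k - 1) := by
      rw [ψs_eq_del, ψ_of_neg (by omega), del_of_neg (by omega)]
    have e2 : ψs (-k - 1) * ψ k = create k * annihilate k := by
      rw [ψs_eq_del, show -(-(k : ℤ) - 1) - 1 = k by ring, ψ_of_nonneg (by omega),
        del_of_nonneg (by omega)]
    rw [e1, e2, LinearMap.add_apply, LinearMap.smul_apply, LinearMap.smul_apply,
      create_annihilate_apply, create_annihilate_apply, add_smul, half]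
    congr 1
    · split_ifs
      · congr 1
        push_cast
        ring
      · simp
    · split_ifs
      · congr 1
        push_cast
        ring
      · simp
  have h2 : ∀ p : ℤ × ℤ, (if 0 < p.1 + p.2 + 1 then (2 / 3 * (2 * half p.1 + half p.2)) •
      normalOrder [.psi (-p.2 - 1), .psiStar (-p.1 - 1), .psi p.1, .psiStar p.2] else 0)
        (fockBasis S) = (if p.1 ∈ S ∧ -p.2 - 1 ∈ S then
          -(siteSign p.1 * siteSign (-p.2 - 1) * (if -p.2 - 1 < p.1 then
            2 / 3 * (2 * (p.1 : ℂ) - (-p.2 - 1 : ℤ) + 1 / 2) else 0)) else 0) • fockBasis S := by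
    rintro ⟨x, l⟩
    -- In terms of the sites `x` and `y` the condition `k + l > 0` reads `y < x`.
    obtain ⟨y, rfl⟩ : ∃ y, l = -y - 1 := ⟨-l - 1, by ring⟩
    simp only [show -(-y - 1) - 1 = y by ring]
    by_cases h : y < x
    · rw [if_pos (by omega), if_pos h, LinearMap.smul_apply, normalOrder_density h, smul_ite,
        smul_zero, ite_smul, zero_smul, smul_smul, half, half]
      congr 2
      push_cast
      ring
    · rw [if_neg (by omega), if_neg h, LinearMap.zero_apply, mul_zero, neg_zero, ite_self,
        zero_smul]
  have h3 : (fun p : ℤ × ℤ => (if p.1 ∈ S ∧ -p.2 - 1 ∈ S then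
      -(siteSign p.1 * siteSign (-p.2 - 1) * (if -p.2 - 1 < p.1 then
        2 / 3 * (2 * (p.1 : ℂ) - (-p.2 - 1 : ℤ) + 1 / 2) else 0)) else 0) • fockBasis S).support ⊆
      ↑((S ×ˢ S).image fun q : ℤ × ℤ => (q.1, -q.2 - 1)) := by
    rintro ⟨x, l⟩ hp
    simp only [Function.mem_support, ne_eq, smul_eq_zero, not_or, ite_eq_right_iff,
      not_forall] at hp
    obtain ⟨⟨hp, -⟩, -⟩ := hp
    simp only [Finset.coe_image, Set.mem_image, Finset.mem_coe, Finset.mem_product]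
    exact ⟨(x, -l - 1), hp, by simp⟩
  rw [Hd, LinearMap.add_apply, locSum, locSum, Module.Basis.constr_basis,
    Module.Basis.constr_basis, finsum_congr h1, finsum_congr h2,
    finsum_eq_sum_of_support_subset (s := Finset.range B),
    finsum_eq_sum_of_support_subset _ h3, Finset.sum_image, ← Finset.sum_smul, ← Finset.sum_smul,
    ← add_smul, diagonalValue, sub_eq_add_neg]
  · congr 2
    · rw [Finset.sum_add_distrib, sum_range_neg hB (fun k => (k : ℂ) / 3),
        sum_range_nonneg hB (fun k => (k : ℂ) * (k + 2 / 3)), ← Finset.sum_add_distrib]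
      refine Finset.sum_congr rfl fun x _ => ?_
      rw [siteSign]
      split_ifs with hx
      · have : (((-x - 1).toNat : ℤ) : ℂ) = ((-x - 1 : ℤ) : ℂ) := by
          rw [Int.toNat_of_nonneg (by omega)]
        rw [Int.cast_natCast] at this
        rw [this]
        push_cast
        ring
      · have : ((x.toNat : ℤ) : ℂ) = x := by
          rw [Int.toNat_of_nonneg (by omega)]
        rw [Int.cast_natCast] at this
        rw [this]
        ring
    · rw [Finset.sum_product, ← Finset.sum_neg_distrib]
      refine Finset.sum_congr rfl fun x hx => ?_
      rw [← Finset.sum_neg_distrib]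
      refine Finset.sum_congr rfl fun y hy => ?_
      rw [show -(-y - 1) - 1 = y by ring, if_pos ⟨hx, hy⟩]
  · intro p _ q _ hpq
    simp only [Prod.mk.injEq] at hpq
    exact Prod.ext hpq.1 (by omega)
  · intro k hk
    simp only [Function.mem_support] at hk
    by_contra hc
    refine hk ?_
    simp only [Finset.coe_range, Set.mem_Iio, not_lt] at hc
    rw [if_neg fun h => ?_, if_neg fun h => ?_, add_zero, zero_smul]
    · have := hB.2 _ h
      omega
    · have := hB.2 _ h
      omega

end

section

variable {n N : ℕ}

/-! ### Energies of the Schur states -/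

/-- Symmetrizing the pair weight gives the distance `|x - y|`, an additive term that vanishes at
charge zero, and a diagonal correction that combines with the one-body terms. The fractions in `Hd`
are tuned to this cancellation. -/
theorem diagonalValue_eq {S : Finset ℤ} (hS : ∑ x ∈ S, siteSign x = 0) :
    diagonalValue S = -∑ x ∈ S, siteSign x * (if x < 0 then 0 else (x : ℂ) ^ 2 + x) -
      (∑ x ∈ S, ∑ y ∈ S, siteSign x * siteSign y * (|x - y| : ℤ)) / 2 := by
  set G : ℤ → ℤ → ℂ := fun x y => if y < x then 2 / 3 * (2 * (x : ℂ) - y + 1 / 2) else 0 with hG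
  have h1 : ∀ x y, G x y + G y x = (|x - y| : ℤ) + ((x : ℂ) + y + 1) / 3 -
      if x = y then (2 * (x : ℂ) + 1) / 3 else 0 := by
    intro x y
    simp only [hG]
    rcases lt_trichotomy x y with h | rfl | h
    · rw [if_neg h.not_gt, if_pos h, if_neg h.ne, abs_of_neg (by omega)]
      push_cast
      ring
    · simp
      ring
    · rw [if_pos h, if_neg h.not_gt, if_neg h.ne', abs_of_pos (by omega)]
      push_cast
      ring
  have h2 : ∑ x ∈ S, ∑ y ∈ S, siteSign x * siteSign y * G x y =
      (∑ x ∈ S, ∑ y ∈ S, siteSign x * siteSign y * (G x y + G y x)) / 2 := by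
    have : ∑ x ∈ S, ∑ y ∈ S, siteSign x * siteSign y * G x y =
        ∑ x ∈ S, ∑ y ∈ S, siteSign x * siteSign y * G y x := by
      rw [Finset.sum_comm]
      exact Finset.sum_congr rfl fun x _ => Finset.sum_congr rfl fun y _ => by
        rw [mul_comm (siteSign y)]
    simp only [mul_add, Finset.sum_add_distrib]
    rw [← this]
    ring
  have h3 : ∑ x ∈ S, ∑ y ∈ S, siteSign x * siteSign y * (((x : ℂ) + y + 1) / 3) = 0 := by
    have e : ∀ x y : ℤ, siteSign x * siteSign y * (((x : ℂ) + y + 1) / 3) =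
        siteSign x * (((x : ℂ) + 1) / 3) * siteSign y + siteSign x * (siteSign y * (y / 3)) :=
      fun x y => by ring
    simp only [e, Finset.sum_add_distrib, ← Finset.mul_sum, hS, mul_zero,
      zero_add, ← Finset.sum_mul, zero_mul]
  have h4 : ∑ x ∈ S, ∑ y ∈ S, siteSign x * siteSign y *
      (if x = y then (2 * (x : ℂ) + 1) / 3 else 0) = ∑ x ∈ S, (2 * (x : ℂ) + 1) / 3 := by
    refine Finset.sum_congr rfl fun x hx => ?_
    rw [Finset.sum_eq_single x]
    · rw [if_pos rfl, siteSign_mul_self, one_mul]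
    · intro y _ hy
      rw [if_neg hy.symm, mul_zero]
    · exact fun h => absurd hx h
  have h5 : ∀ x y, siteSign x * siteSign y * (G x y + G y x) =
      siteSign x * siteSign y * (|x - y| : ℤ) + siteSign x * siteSign y * (((x : ℂ) + y + 1) / 3) -
        siteSign x * siteSign y * (if x = y then (2 * (x : ℂ) + 1) / 3 else 0) := fun x y => by
    rw [h1]
    ring
  have h6 : ∀ x : ℤ, siteSign x * (if x < 0 then (-(x : ℂ) - 1) / 3 else -((x : ℂ) * (x + 2 / 3))) =
      -(siteSign x * (if x < 0 then 0 else (x : ℂ) ^ 2 + x)) - (2 * (x : ℂ) + 1) / 3 / 2 -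
        siteSign x / 6 := fun x => by
    rw [siteSign]
    split_ifs <;> ring
  rw [diagonalValue, h2]
  simp only [h5, h6, Finset.sum_sub_distrib, Finset.sum_add_distrib, h3, h4, ← Finset.sum_div, hS,
    Finset.sum_neg_distrib]
  ring

theorem sum_stateSet_siteSign (lam : n.Partition) (h : row lam N = 0) (w : ℤ → ℂ) :
    ∑ x ∈ stateSet lam, siteSign x * w x =
      ∑ i ∈ Finset.range N, w (i - row lam i) - ∑ i ∈ Finset.range N, w i := by
  rw [← sum_particles_sub_sum_holes lam h, sum_stateSet, sub_eq_add_neg, ← Finset.sum_neg_distrib]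
  congr 1
  · refine Finset.sum_congr rfl fun i hi => ?_
    rw [siteSign, if_pos (particle_neg lam hi), one_mul]
  · refine Finset.sum_congr rfl fun i hi => ?_
    rw [siteSign, if_neg (not_lt.2 (hole_nonneg lam hi)), neg_one_mul]

theorem two_mul_sum_max (N : ℕ) {x : ℤ} (hx : x ≤ N) :
    2 * ∑ j ∈ Finset.range N, max (x - j) 0 = if x < 0 then 0 else x ^ 2 + x := by
  induction N generalizing x with
  | zero =>
    rcases lt_or_eq_of_le hx with h | rfl
    · rw [if_pos (by simpa using h)]; simp
    · simp
  | succ N ih =>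
    have h1 := ih (x := x - 1) (by push_cast at hx; omega)
    rw [Finset.sum_range_succ']
    have h2 : ∀ j : ℕ, x - ((j + 1 : ℕ) : ℤ) = x - 1 - j := fun j => by push_cast; ring
    simp only [h2, Nat.cast_zero, sub_zero]
    rw [mul_add, h1]
    rcases lt_trichotomy x 0 with h | rfl | h
    · rw [if_pos (by omega), if_pos h, max_eq_right h.le]; ring
    · simp
    · rw [if_neg (by omega), if_neg (by omega), max_eq_left h.le]; ring

theorem two_mul_sum_abs_sub (N : ℕ) {x : ℤ} (hx : x ≤ N) :
    2 * ∑ j ∈ Finset.range N, |x - j| =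
      N * (N - 1) - 2 * N * x + 2 * if x < 0 then 0 else x ^ 2 + x := by
  have h : ∀ j : ℕ, |x - j| = j - x + 2 * max (x - j) 0 := by
    intro j
    rcases le_total x j with h | h
    · rw [abs_of_nonpos (by omega), max_eq_right (by omega)]; ring
    · rw [abs_of_nonneg (by omega), max_eq_left (by omega)]; ring
  have h2 : (∑ j ∈ Finset.range N, (j : ℤ)) * 2 = N * (N - 1) := by
    have := Finset.sum_range_id_mul_two N
    rcases N with _ | N
    · simp
    · push_cast
      zify at this
      simpa using this
  rw [Finset.sum_congr rfl fun j _ => h j, Finset.sum_add_distrib, ← Finset.mul_sum, mul_add,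
    mul_left_comm, two_mul_sum_max N hx, Finset.sum_sub_distrib, mul_sub, mul_comm 2, h2]
  simp
  ring

theorem sum_sum_abs_sub {f : ℕ → ℤ} (hf : StrictMono f) (N : ℕ) :
    ∑ i ∈ Finset.range N, ∑ j ∈ Finset.range N, |f i - f j| =
      2 * ∑ i ∈ Finset.range N, (2 * i + 1 - N) * f i := by
  induction N with
  | zero => simp
  | succ N ih =>
    have h1 : ∑ i ∈ Finset.range N, |f i - f N| = N * f N - ∑ i ∈ Finset.range N, f i := by
      rw [Finset.sum_congr rfl fun i hi => by
        rw [abs_of_neg (sub_neg.2 (hf (Finset.mem_range.1 hi)))], Finset.sum_neg_distrib,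
        Finset.sum_sub_distrib]
      simp
    have h2 : ∑ i ∈ Finset.range N, |f N - f i| = N * f N - ∑ i ∈ Finset.range N, f i := by
      rw [← h1]
      exact Finset.sum_congr rfl fun i _ => abs_sub_comm _ _
    have h3 : ∑ i ∈ Finset.range N, (2 * (i : ℤ) + 1 - (N + 1 : ℕ)) * f i =
        ∑ i ∈ Finset.range N, (2 * i + 1 - N) * f i - ∑ i ∈ Finset.range N, f i := by
      rw [← Finset.sum_sub_distrib]
      refine Finset.sum_congr rfl fun i _ => ?_
      push_cast
      ring
    rw [Finset.sum_range_succ, Finset.sum_congr rfl fun i _ => Finset.sum_range_succ _ _,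
      Finset.sum_add_distrib, ih, Finset.sum_range_succ, h1, h2, Finset.sum_range_succ, h3, sub_self,
      abs_zero]
    push_cast
    ring

/-- Signed sums over the state set are sums over the sites of `lam` minus sums over the vacuum
sites. The double sum of distances thus splits into three. The two over a single increasing sequence
are linear in it, and the mixed one produces quadratic terms that cancel against the one-body part.
-/
theorem diagonalValue_stateSet (lam : n.Partition) (h : row lam N = 0) :
    diagonalValue (stateSet lam) = ∑ i ∈ Finset.range N, ((2 * i + 1) * row lam i : ℂ) := by
  have h0 : ∑ x ∈ stateSet lam, siteSign x = 0 := by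
    have := sum_stateSet_siteSign lam h fun _ => 1
    simpa using this
  set m : ℕ → ℤ := fun i => i - row lam i with hm
  set g : ℤ → ℤ := fun x => ∑ j ∈ Finset.range N, |x - j| with hg
  set u : ℤ → ℤ := fun x => if x < 0 then 0 else x ^ 2 + x with hu
  have hA := sum_sum_abs_sub (strictMono_sub_row lam) N
  have hB := sum_sum_abs_sub (f := fun i : ℕ => (i : ℤ)) (fun i j hij => by simpa using hij) N
  have hgi : ∀ i ∈ Finset.range N, 2 * g i = N * (N - 1) - 2 * N * i + 2 * ((i : ℤ) ^ 2 + i) := by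
    intro i hi
    have := two_mul_sum_abs_sub N (x := i) (by exact_mod_cast (Finset.mem_range.1 hi).le)
    rwa [if_neg (by omega)] at this
  have hgm : ∀ i ∈ Finset.range N, 2 * g (m i) = N * (N - 1) - 2 * N * m i + 2 * u (m i) := by
    intro i hi
    have := Finset.mem_range.1 hi
    exact two_mul_sum_abs_sub N (x := m i) (by simp only [hm]; omega)
  have h1 : ∑ x ∈ stateSet lam, siteSign x * (if x < 0 then 0 else (x : ℂ) ^ 2 + x) =
      ((∑ i ∈ Finset.range N, u (m i) - ∑ i ∈ Finset.range N, ((i : ℤ) ^ 2 + i) : ℤ) : ℂ) := by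
    have := sum_stateSet_siteSign lam h fun x => (u x : ℂ)
    have e : ∀ x : ℤ, ((u x : ℤ) : ℂ) = if x < 0 then 0 else (x : ℂ) ^ 2 + x := by
      intro x
      simp only [hu]
      split_ifs <;> push_cast <;> rfl
    simp only [← e]
    rw [this, Int.cast_sub, Int.cast_sum, Int.cast_sum]
    congr 1
  have h2 : ∑ x ∈ stateSet lam, ∑ y ∈ stateSet lam, siteSign x * siteSign y * (|x - y| : ℤ) =
      ((∑ i ∈ Finset.range N, ∑ j ∈ Finset.range N, |m i - m j| -
        2 * ∑ i ∈ Finset.range N, g (m i) + ∑ i ∈ Finset.range N, g i : ℤ) : ℂ) := by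
    have e1 : ∀ x : ℤ, ∑ y ∈ stateSet lam, siteSign x * siteSign y * (|x - y| : ℤ) =
        siteSign x * ((∑ j ∈ Finset.range N, |x - m j| - g x : ℤ) : ℂ) := by
      intro x
      have := sum_stateSet_siteSign lam h fun y => ((|x - y| : ℤ) : ℂ)
      simp only [mul_assoc, ← Finset.mul_sum]
      rw [this]
      push_cast [hg, hm]
      rfl
    have e2 : ∑ i ∈ Finset.range N, ∑ j ∈ Finset.range N, |(i : ℤ) - m j| =
        ∑ i ∈ Finset.range N, g (m i) := by
      rw [Finset.sum_comm]
      exact Finset.sum_congr rfl fun i _ => Finset.sum_congr rfl fun j _ => abs_sub_comm _ _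
    rw [Finset.sum_congr rfl fun x _ => e1 x, sum_stateSet_siteSign lam h, ← Int.cast_sum,
      ← Int.cast_sum, ← Int.cast_sub, Finset.sum_sub_distrib, Finset.sum_sub_distrib, e2]
    congr 1
    ring
  rw [diagonalValue_eq h0, h1, h2]
  have h3 : 2 * ∑ i ∈ Finset.range N, g i =
      ∑ i ∈ Finset.range N, (N * (N - 1) - 2 * N * i + 2 * ((i : ℤ) ^ 2 + i)) := by
    rw [Finset.mul_sum]
    exact Finset.sum_congr rfl hgi
  have h4 : 2 * ∑ i ∈ Finset.range N, g (m i) =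
      ∑ i ∈ Finset.range N, (N * (N - 1) - 2 * N * m i) + 2 * ∑ i ∈ Finset.range N, u (m i) := by
    rw [Finset.mul_sum, Finset.mul_sum, ← Finset.sum_add_distrib]
    exact Finset.sum_congr rfl hgm
  have h5 : 2 * (∑ i ∈ Finset.range N, ((2 * i + 1) * row lam i) : ℤ) =
      2 * (-(∑ i ∈ Finset.range N, u (m i) - ∑ i ∈ Finset.range N, ((i : ℤ) ^ 2 + i))) -
        (∑ i ∈ Finset.range N, ∑ j ∈ Finset.range N, |m i - m j| -
          2 * ∑ i ∈ Finset.range N, g (m i) + ∑ i ∈ Finset.range N, g i) := by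
    have e : 2 * (∑ i ∈ Finset.range N, ((2 * i + 1) * row lam i) : ℤ) =
        ∑ i ∈ Finset.range N, (N * (N - 1) - 2 * N * m i) -
          ∑ i ∈ Finset.range N, (N * (N - 1) - 2 * N * i + 2 * ((i : ℤ) ^ 2 + i)) +
            2 * ∑ i ∈ Finset.range N, ((i : ℤ) ^ 2 + i) -
              2 * ∑ i ∈ Finset.range N, (2 * i + 1 - N) * m i +
                2 * ∑ i ∈ Finset.range N, (2 * i + 1 - N) * (i : ℤ) := by
      simp only [Finset.mul_sum, ← Finset.sum_sub_distrib, ← Finset.sum_add_distrib]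
      refine Finset.sum_congr rfl fun i _ => ?_
      simp only [hm]
      ring
    change ∑ i ∈ Finset.range N, ∑ j ∈ Finset.range N, |m i - m j| =
      2 * ∑ i ∈ Finset.range N, (2 * i + 1 - N) * m i at hA
    change ∑ i ∈ Finset.range N, g i = _ at hB
    linarith
  have h6 := congrArg (Int.cast : ℤ → ℂ) h5
  push_cast at h6 ⊢
  linear_combination -h6 / 2

end

/-! ### Comparison of the fermionic and polynomial Hamiltonians. -/

section

variable {n N : ℕ}

/-! ### States of a given level as polynomials in the oscillators -/

/-- The power sum product of a partition, as a polynomial in the creation oscillators. -/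
def powerProduct (s : Multiset ℕ+) : BosonFock := (s.map X).prod

theorem powerProduct_eq_monomial (s : Multiset ℕ+) :
    powerProduct s = monomial (Multiset.toFinsupp s) 1 := by
  induction s using Multiset.induction_on with
  | empty => rw [powerProduct, Multiset.map_zero, Multiset.prod_zero, map_zero]; rfl
  | cons a s ih =>
    rw [powerProduct, Multiset.map_cons, Multiset.prod_cons, ← powerProduct, ih,
      ← Multiset.singleton_add, map_add, Multiset.toFinsupp_singleton, X, monomial_mul, mul_one]

theorem powerProduct_zero : powerProduct 0 = 1 := rfl

theorem powerProduct_cons (a : ℕ+) (s : Multiset ℕ+) :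
    powerProduct (a ::ₘ s) = X a * powerProduct s := by
  rw [powerProduct, Multiset.map_cons, Multiset.prod_cons, ← powerProduct]

theorem vac_mem_graded : vac ∈ graded 0 0 := fockBasis_mem_graded ∅

theorem bosonize_powerProduct_mem (s : Multiset ℕ+) :
    bosonize (powerProduct s) ∈ graded 0 ((s.map fun k : ℕ+ => (k : ℤ)).sum) := by
  induction s using Multiset.induction_on with
  | empty =>
    rw [powerProduct_zero, ← C_1, bosonize_C, one_smul]
    exact vac_mem_graded
  | cons a s ih =>
    rw [powerProduct_cons, bosonize_X_mul, Multiset.map_cons, Multiset.sum_cons]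
    have := shifts_osc (-(a : ℤ)) _ _ _ ih
    rwa [add_zero, neg_neg, add_comm] at this

theorem sum_theta_powerProduct (s : Multiset ℕ+) :
    ∑ i, theta i (powerSumEval N (powerProduct s)) =
      ((s.map fun k : ℕ+ => ((k : ℕ) : ℂ)).sum) • powerSumEval N (powerProduct s) := by
  induction s using Multiset.induction_on with
  | empty =>
    rw [powerProduct_zero, Multiset.map_zero, Multiset.sum_zero, zero_smul, ← C_1, powerSumEval_C]
    simp only [theta_C, Finset.sum_const_zero]
  | cons a s ih =>
    rw [powerProduct_cons, map_mul, powerSumEval_X, Multiset.map_cons, Multiset.sum_cons]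
    simp only [theta_mul, theta_psum, Finset.sum_add_distrib, ← Finset.mul_sum, ih,
      ← Finset.smul_sum]
    rw [← psum, add_smul]
    simp only [smul_eq_C_mul]
    ring

/-- The parts of a partition as positive integers. -/
def pparts (mu : n.Partition) : Multiset ℕ+ := mu.parts.map Nat.toPNat'

theorem map_coe_pparts (mu : n.Partition) : (pparts mu).map (fun k : ℕ+ => (k : ℕ)) = mu.parts := by
  rw [pparts, Multiset.map_map]
  conv_rhs => rw [← Multiset.map_id mu.parts]
  refine Multiset.map_congr rfl fun k hk => ?_
  rw [Function.comp_apply, Nat.toPNat'_coe, if_pos (mu.parts_pos hk), id]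

theorem sum_map_pparts (mu : n.Partition) {A : Type*} [AddCommMonoidWithOne A] :
    ((pparts mu).map fun k : ℕ+ => ((k : ℕ) : A)).sum = n := by
  have h := mu.parts_sum
  rw [← map_coe_pparts mu] at h
  conv_rhs => rw [← h]
  rw [Nat.cast_multiset_sum, Multiset.map_map]
  rfl

theorem pparts_injective : Function.Injective (pparts : n.Partition → Multiset ℕ+) := by
  intro mu nu h
  ext1
  rw [← map_coe_pparts mu, h, map_coe_pparts]

theorem linearIndependent_powerProduct :
    LinearIndependent ℂ fun mu : n.Partition => powerProduct (pparts mu) := by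
  have := (basisMonomials ℕ+ ℂ).linearIndependent.comp
    (fun mu : n.Partition => Multiset.toFinsupp (pparts mu))
    (Multiset.toFinsupp.injective.comp pparts_injective)
  have h : (fun mu : n.Partition => powerProduct (pparts mu)) =
      basisMonomials ℕ+ ℂ ∘ fun mu : n.Partition => Multiset.toFinsupp (pparts mu) := by
    funext mu
    rw [powerProduct_eq_monomial, Function.comp_apply, coe_basisMonomials]
  rw [h]
  exact this

/-- Surjectivity by counting: the power products of the partitions of `n` have independent images of
level `n`, and that level is spanned by equally many Schur states. The degree equation for every `N`
is kept for the conjugation formulas. -/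
theorem exists_bosonize_eq {v : Fock} (hv : v ∈ graded 0 n) : ∃ g : BosonFock, bosonize g = v ∧
    ∀ N, ∑ i, theta i (powerSumEval N g) = (n : ℂ) • powerSumEval N g := by
  set U := Submodule.span ℂ (Set.range fun mu : n.Partition => powerProduct (pparts mu)) with hU
  have hle : U.map bosonize ≤ graded 0 n := by
    rw [hU, Submodule.map_span, Submodule.span_le]
    rintro _ ⟨_, ⟨mu, rfl⟩, rfl⟩
    have := bosonize_powerProduct_mem (pparts mu)
    have h2 := sum_map_pparts mu (A := ℤ)
    rwa [h2] at this
  have hfin : FiniteDimensional ℂ (graded 0 n) := by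
    rw [graded_zero_eq_span]
    exact FiniteDimensional.span_of_finite ℂ (Set.finite_range _)
  have hrank : Module.finrank ℂ (graded 0 n) ≤ Module.finrank ℂ (U.map bosonize) := by
    rw [hU, Submodule.map_span, ← Set.range_comp, finrank_span_eq_card
      (linearIndependent_powerProduct.map' bosonize (LinearMap.ker_eq_bot.2 bosonize_injective)),
      graded_zero_eq_span]
    exact finrank_range_le_card _
  have heq := Submodule.eq_of_le_of_finrank_le hle hrank
  rw [← heq] at hv
  obtain ⟨g, hg, rfl⟩ := hv
  refine ⟨g, rfl, fun N => ?_⟩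
  induction hg using Submodule.span_induction with
  | mem x hx =>
    obtain ⟨mu, rfl⟩ := hx
    rw [sum_theta_powerProduct, sum_map_pparts]
  | zero => simp
  | add x y _ _ hx hy => simp only [map_add, Finset.sum_add_distrib, hx, hy, smul_add]
  | smul a x _ hx =>
    simp only [map_smul, Derivation.map_smul, ← Finset.smul_sum, hx]
    rw [smul_comm]

/-! ### The Hamiltonian on Schur states -/

theorem shifts_H0 : Shifts 0 0 H0 := by
  refine Shifts.locSum (locFin_osc_cubic_up.add locFin_osc_cubic_down) fun p => ?_
  refine Shifts.add ?_ ?_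
  · exact (((shifts_osc _).mul (shifts_osc _)).mul (shifts_osc _)).congr (by ring) (by ring)
  · exact (((shifts_osc _).mul (shifts_osc _)).mul (shifts_osc _)).congr (by ring) (by ring)

theorem bosonize_interaction_mem {g : BosonFock} (hg : bosonize g ∈ graded 0 n) :
    bosonize (interaction g) ∈ graded 0 n := by
  rw [interaction, LinearMap.sub_apply, map_sub, bosonize_cubicUp, bosonize_quadratic]
  refine Submodule.sub_mem _ ?_ ?_
  · have : Shifts 0 0 (locSum fockBasis fun n : ℕ+ => (n : ℂ) • (osc (-n) * osc n)) :=
      Shifts.locSum locFin_osc_quadratic fun k =>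
        (((shifts_osc _).mul (shifts_osc _)).smul _).congr (by ring) (by ring)
    simpa using this 0 n _ hg
  · have : Shifts 0 0 (locSum fockBasis fun p : ℕ+ × ℕ+ =>
        osc (-p.1) * osc (-p.2) * osc (p.1 + p.2)) :=
      Shifts.locSum locFin_osc_cubic_up fun p =>
        (((shifts_osc _).mul (shifts_osc _)).mul (shifts_osc _)).congr (by ring) (by ring)
    simpa using this 0 n _ hg

theorem sum_sum_Ioi_sub (a : Fin N → ℂ) : ∑ i, ∑ j ∈ Finset.Ioi i, (a i - a j) =
    ∑ i : Fin N, ((N : ℂ) - 1 - 2 * (i : ℕ)) * a i := by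
  induction N with
  | zero => simp
  | succ N ih =>
    rw [Fin.sum_univ_succ, Fin.sum_univ_succ, Fin.sum_Ioi_zero]
    simp only [Fin.sum_Ioi_succ]
    rw [ih fun i => a i.succ, Finset.sum_sub_distrib, sub_add_eq_add_sub, add_sub_assoc,
      ← Finset.sum_sub_distrib]
    congr 1
    · simp
    · refine Finset.sum_congr rfl fun i _ => ?_
      rw [Fin.val_succ]
      push_cast
      ring

theorem sum_fin_natCast (N : ℕ) : ∑ i : Fin N, ((i : ℕ) : ℂ) = N * (N - 1) / 2 := by
  rw [← Finset.sum_range fun i => (i : ℂ)]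
  induction N with
  | zero => simp
  | succ N ih => rw [Finset.sum_range_succ, ih]; push_cast; ring

theorem sum_fin_natCast_sq (N : ℕ) :
    ∑ i : Fin N, ((i : ℕ) : ℂ) ^ 2 = N * (N - 1) * (2 * N - 1) / 6 := by
  rw [← Finset.sum_range fun i => (i : ℂ) ^ 2]
  induction N with
  | zero => simp
  | succ N ih => rw [Finset.sum_range_succ, ih]; push_cast; ring

theorem sum_sum_Ioi_one (N : ℕ) : ∑ i : Fin N, ∑ _j ∈ Finset.Ioi i, (1 : ℂ) = N * (N - 1) / 2 := by
  induction N with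
  | zero => simp
  | succ N ih =>
    rw [Fin.sum_univ_succ, Fin.sum_Ioi_zero]
    simp only [Fin.sum_Ioi_succ]
    rw [ih]
    simp
    ring

theorem tripleCount_eq (N : ℕ) : tripleCount N = N * (N - 1) * (N - 2) := by
  have h1 : ∀ i j : Fin N, (∑ k : Fin N, if i ≠ j ∧ j ≠ k ∧ i ≠ k then (1 : ℂ) else 0) =
      (N - 2) * (1 - if i = j then 1 else 0) := by
    intro i j
    by_cases hij : i = j
    · simp [hij]
    · have : ∀ k : Fin N, (if i ≠ j ∧ j ≠ k ∧ i ≠ k then (1 : ℂ) else 0) =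
          1 - (if j = k then 1 else 0) - if i = k then 1 else 0 := by
        intro k
        by_cases h1 : j = k
        · have : i ≠ k := fun h => hij (h.trans h1.symm)
          simp [h1, this]
        · by_cases h2 : i = k <;> simp [h1, h2, hij]
      rw [Finset.sum_congr rfl fun k _ => this k, if_neg hij]
      simp
      ring
  rw [tripleCount, Finset.sum_congr rfl fun i _ => Finset.sum_congr rfl fun j _ => h1 i j]
  simp only [← Finset.mul_sum, Finset.sum_sub_distrib]
  simp
  ring

/-- The constants produced by the conjugation with the Vandermonde determinant combine into the
eigenvalue of `Hd`, with all dependence on `N` cancelling. -/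
theorem diagonal_constant (lam : n.Partition) (h : row lam N = 0) :
    (N : ℂ) * n + tripleCount N / 6 -
      ∑ i, ∑ j ∈ Finset.Ioi i, ((exponents N lam i : ℂ) - exponents N lam j - 1) =
    ∑ i ∈ Finset.range N, ((2 * i + 1) * row lam i : ℂ) := by
  have h1 : ∑ i ∈ Finset.range N, (row lam i : ℂ) = n := by exact_mod_cast sum_row lam h
  have h2 : ∀ i : Fin N, (exponents N lam i : ℂ) = row lam i + (N - 1 - (i : ℕ)) := by
    intro i
    rw [exponents_apply, Nat.sub_sub, Nat.cast_add, Nat.cast_sub (by omega)]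
    push_cast
    ring
  have h3 : ∀ i : Fin N, ((N : ℂ) - 1 - 2 * (i : ℕ)) * (row lam i + (N - 1 - (i : ℕ))) =
      N * row lam i - (2 * (i : ℕ) + 1) * row lam i + ((N - 1) ^ 2 - 3 * (N - 1) * (i : ℕ) +
        2 * (i : ℕ) ^ 2) := fun i => by ring
  rw [Finset.sum_range] at h1 ⊢
  have h4 : ∑ i, ∑ j ∈ Finset.Ioi i, ((exponents N lam i : ℂ) - exponents N lam j - 1) =
      ∑ i, ∑ j ∈ Finset.Ioi i, ((exponents N lam i : ℂ) - exponents N lam j) -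
        ∑ i : Fin N, ∑ _j ∈ Finset.Ioi i, (1 : ℂ) := by
    simp only [Finset.sum_sub_distrib]
  rw [h4, sum_sum_Ioi_sub, sum_sum_Ioi_one, tripleCount_eq]
  simp only [h2, h3, Finset.sum_add_distrib, Finset.sum_sub_distrib, ← Finset.mul_sum, h1,
    sum_fin_natCast, sum_fin_natCast_sq, Finset.sum_const, Finset.card_univ, Fintype.card_fin,
    nsmul_eq_mul]
  ring

end

/-! ### Action of the Hamiltonian on Schur states and its triangularity. -/

section

variable {n N : ℕ}

/-! ### Action on the Schur states -/

theorem sum_exponents_sq (lam : n.Partition) (h : row lam N = 0) :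
    ∑ i, (exponents N lam i : ℂ) ^ 2 -
      ((2 * N - 1) * n + ∑ i : Fin N, ((N - 1 - (i : ℕ) : ℕ) : ℂ) ^ 2) = freeEnergy lam := by
  have h1 : ∑ i ∈ Finset.range N, (row lam i : ℂ) = n := by exact_mod_cast sum_row lam h
  have h2 : ∀ i : Fin N, (exponents N lam i : ℂ) ^ 2 = ((row lam i : ℂ) ^ 2 -
      (2 * (i : ℕ) + 1) * row lam i) + (2 * N - 1) * row lam i +
        ((N - 1 - (i : ℕ) : ℕ) : ℂ) ^ 2 := by
    intro i
    rw [exponents_apply, Nat.sub_sub, Nat.cast_add, Nat.cast_sub (by omega)]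
    push_cast
    ring
  rw [Finset.sum_range] at h1
  rw [freeEnergy_eq lam h, Finset.sum_range, Finset.sum_congr rfl fun i _ => h2 i,
    Finset.sum_add_distrib, Finset.sum_add_distrib, ← Finset.mul_sum, h1]
  ring

theorem schurCoeff_bosonize (mu : n.Partition) (g : BosonFock) : schurCoeff mu (bosonize g) =
    coeff (exponents n mu) (powerSumEval n g * delta n) := correlator_sites_bosonize g _

/-- Both sides are compared by their coefficients at the leading exponents of all partitions. The
conjugated operator is a Laplacian minus a constant, hence multiplies each coefficient by a number.
-/
theorem H0_schurState (lam : n.Partition) :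
    H0 (schurState lam) = freeEnergy lam • schurState lam := by
  have hmem := schurState_mem_graded lam
  obtain ⟨f, hf, hθ⟩ := exists_bosonize_eq hmem
  refine eq_of_schurCoeff_eq (n := n) (by simpa using shifts_H0 _ _ _ hmem)
    (Submodule.smul_mem _ _ hmem) fun mu => ?_
  have h1 : coeff (exponents n mu) (powerSumEval n f * delta n) = if lam = mu then 1 else 0 := by
    rw [← schurCoeff_bosonize, hf, schurCoeff_schurState]
  rw [map_smul, schurCoeff_schurState, ← hf, H0_bosonize, schurCoeff_bosonize,
    powerSumEval_cubic_mul_delta (hθ n), coeff_sub, coeff_smul, coeff_laplacian, h1]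
  by_cases h : lam = mu
  · subst h
    rw [← sum_exponents_sq lam (row_eq_zero lam le_rfl)]
    simp
  · simp [h]

theorem Hd_schurState (lam : n.Partition) : Hd (schurState lam) =
    (∑ i ∈ Finset.range n, ((2 * i + 1) * row lam i : ℂ)) • schurState lam := by
  rw [schurState_eq, map_smul, Hd_fockBasis, diagonalValue_stateSet lam (row_eq_zero lam le_rfl),
    smul_comm]

theorem H0β_schurState (b : ℝ) (lam : n.Partition) :
    H0β b (schurState lam) = energy b lam • schurState lam := by
  have h := sum_col_sq lam (row_eq_zero lam le_rfl)
  have h2 : ∑ i ∈ Finset.range (row lam 0), (col lam i : ℂ) ^ 2 =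
      ∑ i ∈ Finset.range n, ((2 * i + 1) * row lam i : ℂ) := by exact_mod_cast h
  rw [H0β, LinearMap.add_apply, LinearMap.smul_apply, H0_schurState, Hd_schurState, energy, h2,
    smul_smul, ← add_smul]

/-- On the polynomial side the interaction is a constant minus squeezing. The diagonal coefficient
of the squeezing and the constant give `Hd`, and its off-diagonal coefficients are those of `-Ht`.
-/
theorem Hint_schurState (b : ℝ) (lam : n.Partition) : Hint b (schurState lam) =
    (1 - (b : ℂ) ^ 2) • (Hd (schurState lam) + Ht (schurState lam)) := by
  have hmem := schurState_mem_graded lam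
  obtain ⟨f, hf, hθ⟩ := exists_bosonize_eq hmem
  have hHt : Ht (schurState lam) ∈ graded 0 n := by simpa using shifts_Ht _ _ _ hmem
  rw [← hf, Hint_bosonize]
  congr 1
  rw [hf, Hd_schurState]
  refine eq_of_schurCoeff_eq (n := n) (bosonize_interaction_mem (hf ▸ hmem))
    (Submodule.add_mem _ (Submodule.smul_mem _ _ hmem) hHt) fun mu => ?_
  have h1 : coeff (exponents n mu) (powerSumEval n f * delta n) = if lam = mu then 1 else 0 := by
    rw [← schurCoeff_bosonize, hf, schurCoeff_schurState]
  have hα := exponents_strictAnti (N := n) mu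
  have h2 : coeff (exponents n mu) (∑ i, ∑ j ∈ Finset.Ioi i,
      (squeeze i j (powerSumEval n f * delta n) + squeeze j i (powerSumEval n f * delta n))) =
      (∑ i, ∑ j ∈ Finset.Ioi i, ((exponents n mu i : ℂ) - exponents n mu j - 1)) *
        coeff (exponents n mu) (powerSumEval n f * delta n) - schurCoeff mu (Ht (schurState lam)) := by
    rw [schurCoeff, correlator_Ht hα, sub_neg_eq_add, Finset.sum_mul, ← Finset.sum_add_distrib,
      coeff_sum]
    refine Finset.sum_congr rfl fun i _ => ?_
    rw [Finset.sum_mul, ← Finset.sum_add_distrib, coeff_sum]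
    refine Finset.sum_congr rfl fun j hj => ?_
    rw [Finset.mem_Ioi] at hj
    rw [coeff_squeeze hj.ne _ (hα hj)]
    simp only [← hf, correlator_sites_bosonize]
  rw [schurCoeff_bosonize, powerSumEval_interaction_mul_delta (hθ n), coeff_sub, coeff_smul, h2,
    map_add, map_smul, schurCoeff_schurState, h1]
  by_cases h : lam = mu
  · subst h
    rw [← diagonal_constant lam (row_eq_zero lam le_rfl)]
    simp only [if_true, smul_eq_mul]
    ring
  · simp [h]

theorem H_apply (b : ℝ) {v : Fock} (hv : v ∈ graded 0 n) :
    H b v = H0β b v + (1 - (b : ℂ) ^ 2) • Ht v := by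
  rw [graded_zero_eq_span] at hv
  induction hv using Submodule.span_induction with
  | mem x hx =>
    obtain ⟨mu, rfl⟩ := hx
    rw [H, LinearMap.add_apply, Hint_schurState, H0β, LinearMap.add_apply, LinearMap.smul_apply,
      smul_add, add_assoc]
  | zero => simp
  | add x y _ _ hx hy => simp only [map_add, hx, hy, smul_add]; abel
  | smul a x _ hx => simp only [map_smul, hx, smul_add]; rw [smul_comm a]

/-! ### Triangularity -/

theorem sum_fin_row (lam : n.Partition) (h : row lam N = 0) (J : ℕ) :
    ∑ k : Fin N, (if (k : ℕ) < J then (row lam k : ℤ) else 0) =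
      ∑ k ∈ Finset.range J, (row lam k : ℤ) := by
  rw [← Finset.sum_range fun k => if k < J then (row lam k : ℤ) else 0, ← Finset.sum_filter]
  refine Finset.sum_subset (fun k hk => ?_) fun k hk hk' => ?_
  · rw [Finset.mem_filter] at hk
    exact Finset.mem_range.2 hk.2
  · rw [Finset.mem_range] at hk
    rw [Finset.mem_filter, Finset.mem_range, not_and] at hk'
    have := row_antitone lam (show N ≤ k by by_contra hc; exact hk' (not_le.1 hc) hk)
    rw [show row lam k = 0 by omega, Nat.cast_zero]

/-- The shifted exponents of `mu` are a rearrangement of those of `lam`. By the rearrangement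
inequality with an indicator function, their first `J` entries sum to at most the `J` largest. -/
theorem sum_prefix_le {lam mu : n.Partition} {i j : Fin N} (hij : i ≠ j) {t : ℕ}
    (ht : t ≤ exponents N mu j) {σ : Equiv.Perm (Fin N)}
    (hσ : ∀ k, (exponents N mu + Finsupp.single i t - Finsupp.single j t) (σ k) =
      exponents N lam k) (hl : row lam N = 0) (hm : row mu N = 0) (J : ℕ) :
    ∑ k ∈ Finset.range J, (row mu k : ℤ) +
      t * ((if (i : ℕ) < J then 1 else 0) - if (j : ℕ) < J then 1 else 0) ≤
        ∑ k ∈ Finset.range J, (row lam k : ℤ) := by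
  set f : Fin N → ℤ := fun k => if (k : ℕ) < J then 1 else 0 with hf
  set γ := exponents N mu + Finsupp.single i t - Finsupp.single j t with hγ
  have hγ' : ∀ k, (γ k : ℤ) = exponents N mu k + (if k = i then (t : ℤ) else 0) -
      if k = j then (t : ℤ) else 0 := by
    intro k
    rw [hγ, Finsupp.tsub_apply, Finsupp.add_apply, Finsupp.single_apply, Finsupp.single_apply]
    by_cases hj : k = j
    · subst hj
      rw [if_neg hij, if_pos rfl, if_neg hij.symm, if_pos rfl]
      omega
    · rw [if_neg (Ne.symm hj), if_neg hj]
      by_cases hi : k = i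
      · simp [hi]
      · simp [hi, Ne.symm hi]
  have hmono : Monovary f fun k => (exponents N lam k : ℤ) := by
    refine Antitone.monovary (fun k l hkl => ?_) fun k l hkl => ?_
    · have : (k : ℕ) ≤ l := hkl
      simp only [hf]
      split_ifs <;> omega
    · exact_mod_cast (exponents_strictAnti lam).antitone hkl
  have h1 := hmono.sum_mul_comp_perm_le_sum_mul (σ := σ.symm)
  have h2 : ∀ k, (exponents N lam (σ.symm k) : ℤ) = γ k := fun k => by
    rw [← hσ, Equiv.apply_symm_apply]
  simp only [h2, hγ'] at h1
  have h3 : ∀ nu : n.Partition, row nu N = 0 → ∑ k, f k * (exponents N nu k : ℤ) =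
      ∑ k ∈ Finset.range J, (row nu k : ℤ) + ∑ k : Fin N, f k * ((N - 1 - (k : ℕ) : ℕ) : ℤ) := by
    intro nu hnu
    rw [← sum_fin_row nu hnu, ← Finset.sum_add_distrib]
    refine Finset.sum_congr rfl fun k _ => ?_
    rw [exponents_apply, Nat.cast_add, mul_add]
    simp [hf]
  have h4 : ∑ k, f k * ((exponents N mu k : ℤ) + (if k = i then (t : ℤ) else 0) -
      if k = j then (t : ℤ) else 0) = ∑ k, f k * (exponents N mu k : ℤ) + t * (f i - f j) := by
    simp only [mul_sub, mul_add, Finset.sum_sub_distrib, Finset.sum_add_distrib, mul_ite, mul_zero,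
      Finset.sum_ite_eq', Finset.mem_univ, if_true]
    ring
  rw [h4, h3 mu hm, h3 lam hl] at h1
  simp only [hf] at h1 ⊢
  linarith

theorem dominanceLT_of_schurCoeff_Ht_ne_zero {lam mu : n.Partition}
    (h : schurCoeff mu (Ht (schurState lam)) ≠ 0) : DominanceLT mu lam := by
  rw [schurCoeff, correlator_Ht (exponents_strictAnti mu), neg_ne_zero] at h
  obtain ⟨i, -, h⟩ := Finset.exists_ne_zero_of_sum_ne_zero h
  obtain ⟨j, hij, h⟩ := Finset.exists_ne_zero_of_sum_ne_zero h
  obtain ⟨t, ht, h⟩ := Finset.exists_ne_zero_of_sum_ne_zero (right_ne_zero_of_mul h)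
  rw [correlator_sites_schurState, coeff_alternant (row_eq_zero lam le_rfl)] at h
  obtain ⟨σ, -, h⟩ := Finset.exists_ne_zero_of_sum_ne_zero h
  rw [Finset.mem_Ioi] at hij
  rw [Finset.mem_Ico] at ht
  have hσ := of_not_not fun hc => h (if_neg hc)
  have key := sum_prefix_le hij.ne (show t ≤ exponents n mu j by omega) hσ
    (row_eq_zero lam le_rfl) (row_eq_zero mu le_rfl)
  constructor
  · rintro rfl
    -- This prefix contains `i` but not `j`, so it gains `t ≥ 1`, which excludes equality.
    have := key (i + 1)
    have h1 : ¬(j : ℕ) < i + 1 := by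
      have : (i : ℕ) < j := hij
      omega
    rw [if_pos (Nat.lt_succ_self _), if_neg h1] at this
    omega
  · intro J
    have h1 := key J
    have h2 : (i : ℕ) < j := hij
    have h3 : (0 : ℤ) ≤ t * ((if (i : ℕ) < J then 1 else 0) - if (j : ℕ) < J then 1 else 0) := by
      refine mul_nonneg (Int.natCast_nonneg t) ?_
      split_ifs <;> omega
    zify
    linarith

end

/-! ### The resolvent and the eigenvalue equation. -/

section

variable {n : ℕ}

/-! ### The resolvent -/

theorem schurState_mem_spanLT {lam mu : n.Partition} (h : DominanceLT mu lam) :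
    schurState mu ∈ spanLT lam := Submodule.subset_span ⟨mu, h, rfl⟩

theorem spanLT_mono {lam mu : n.Partition} (h : mu = lam ∨ DominanceLT mu lam) :
    spanLT mu ≤ spanLT lam := by
  rcases h with rfl | h
  · exact le_rfl
  · refine Submodule.span_mono (Set.image_mono fun nu hnu => ?_)
    rw [Set.mem_ofPred_eq] at hnu ⊢
    exact hnu.trans h

theorem spanLT_le_spanLE (lam : n.Partition) : spanLT lam ≤ spanLE lam :=
  Submodule.span_mono (Set.image_mono fun _ h => Or.inr h)

theorem spanLE_le_graded (lam : n.Partition) : spanLE lam ≤ graded 0 n := by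
  refine Submodule.span_le.2 ?_
  rintro _ ⟨mu, -, rfl⟩
  exact schurState_mem_graded mu

theorem Ht_schurState_mem (lam : n.Partition) : Ht (schurState lam) ∈ spanLT lam := by
  have h : Ht (schurState lam) ∈ graded 0 n := by
    simpa using shifts_Ht _ _ _ (schurState_mem_graded lam)
  rw [eq_sum_schurCoeff h]
  refine Submodule.sum_mem _ fun mu _ => ?_
  by_cases hc : schurCoeff mu (Ht (schurState lam)) = 0
  · rw [hc, zero_smul]
    exact Submodule.zero_mem _
  · exact Submodule.smul_mem _ _
      (schurState_mem_spanLT (dominanceLT_of_schurCoeff_Ht_ne_zero hc))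

theorem Ht_mem_spanLT (lam : n.Partition) : ∀ v ∈ spanLE lam, Ht v ∈ spanLT lam := by
  intro v hv
  have : spanLE lam ≤ (spanLT lam).comap Ht := by
    refine Submodule.span_le.2 ?_
    rintro _ ⟨mu, h, rfl⟩
    exact spanLT_mono h (Ht_schurState_mem mu)
  exact this hv

theorem energy_sub_H0β_mem (b : ℝ) (lam : n.Partition) :
    ∀ v ∈ spanLT lam, (energy b lam • (1 : Module.End ℂ Fock) - H0β b) v ∈ spanLT lam := by
  intro v hv
  have : spanLT lam ≤ (spanLT lam).comap (energy b lam • (1 : Module.End ℂ Fock) - H0β b) := by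
    refine Submodule.span_le.2 ?_
    rintro _ ⟨mu, h, rfl⟩
    rw [SetLike.mem_coe, Submodule.mem_comap, LinearMap.sub_apply, H0β_schurState]
    exact Submodule.sub_mem _ (Submodule.smul_mem _ _ (schurState_mem_spanLT h))
      (Submodule.smul_mem _ _ (schurState_mem_spanLT h))
  exact this hv

/-- The restriction of `E_λ - H_0^β` to the span of the Schur states below `λ`. -/
def gap (b : ℝ) (lam : n.Partition) : spanLT lam →ₗ[ℂ] spanLT lam :=
  (energy b lam • (1 : Module.End ℂ Fock) - H0β b).restrict (energy_sub_H0β_mem b lam)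

theorem gap_apply (b : ℝ) (lam : n.Partition) (v : spanLT lam) :
    (gap b lam v : Fock) = energy b lam • (v : Fock) - H0β b v := rfl

theorem gap_schurState (b : ℝ) {lam mu : n.Partition} (h : schurState mu ∈ spanLT lam) :
    gap b lam ⟨schurState mu, h⟩ = (energy b lam - energy b mu) • ⟨schurState mu, h⟩ := by
  ext1
  rw [gap_apply, H0β_schurState, ← sub_smul]
  rfl

instance (lam : n.Partition) : FiniteDimensional ℂ (spanLT lam) :=
  FiniteDimensional.span_of_finite ℂ ((Set.toFinite _).image _)

instance (lam : n.Partition) : FiniteDimensional ℂ (spanLE lam) :=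
  FiniteDimensional.span_of_finite ℂ ((Set.toFinite _).image _)

theorem gap_surjective {b : ℝ} (hb : 0 < b) (lam : n.Partition) :
    Function.Surjective (gap b lam) := by
  rintro ⟨v, hv⟩
  have h : ∀ w (hw : w ∈ spanLT lam), (⟨w, hw⟩ : spanLT lam) ∈ LinearMap.range (gap b lam) := by
    intro w hw
    induction hw using Submodule.span_induction with
    | mem x hx =>
      obtain ⟨mu, h, rfl⟩ := hx
      have hne := sub_ne_zero.2 (DominanceLT.energy_ne hb h)
      refine ⟨(energy b lam - energy b mu)⁻¹ • ⟨schurState mu, schurState_mem_spanLT h⟩, ?_⟩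
      rw [map_smul, gap_schurState, smul_smul, inv_mul_cancel₀ hne, one_smul]
    | zero => exact Submodule.zero_mem _
    | add x y _ _ hx hy => exact Submodule.add_mem _ hx hy
    | smul a x _ hx => exact Submodule.smul_mem _ a hx
  exact h v hv

/-- The bijection `E_λ - H_0^β` of the span of the Schur states below `λ`. -/
def gapEquiv {b : ℝ} (hb : 0 < b) (lam : n.Partition) : spanLT lam ≃ₗ[ℂ] spanLT lam :=
  LinearEquiv.ofBijective (gap b lam)
    ⟨LinearMap.injective_iff_surjective.2 (gap_surjective hb lam), gap_surjective hb lam⟩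

theorem gapEquiv_apply {b : ℝ} (hb : 0 < b) (lam : n.Partition) (v : spanLT lam) :
    gapEquiv hb lam v = gap b lam v := rfl

/-- The inverse is diagonal in the Schur states, so it preserves every smaller span; this keeps the
kernel strictly triangular at each `mu`, not only at `lam`. -/
theorem gapEquiv_symm_mem {b : ℝ} (hb : 0 < b) {lam mu : n.Partition}
    (h : mu = lam ∨ DominanceLT mu lam) (w : Fock) (hw : w ∈ spanLT mu) (hw' : w ∈ spanLT lam) :
    ((gapEquiv hb lam).symm ⟨w, hw'⟩ : Fock) ∈ spanLT mu := by
  induction hw using Submodule.span_induction with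
  | mem x hx =>
    obtain ⟨nu, hnu, rfl⟩ := hx
    have hlt : DominanceLT nu lam := by
      rcases h with rfl | h
      · exact hnu
      · exact DominanceLT.trans hnu h
    have hne := sub_ne_zero.2 (DominanceLT.energy_ne hb hlt)
    have : (gapEquiv hb lam).symm ⟨schurState nu, hw'⟩ =
        (energy b lam - energy b nu)⁻¹ • ⟨schurState nu, hw'⟩ := by
      rw [LinearEquiv.symm_apply_eq, gapEquiv_apply, map_smul, gap_schurState, smul_smul,
        inv_mul_cancel₀ hne, one_smul]
    rw [this]
    exact Submodule.smul_mem _ _ (schurState_mem_spanLT hnu)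
  | zero =>
    rw [show (⟨0, hw'⟩ : spanLT lam) = 0 from rfl, map_zero]
    exact Submodule.zero_mem _
  | add x y hx hy ihx ihy =>
    have hx' := spanLT_mono h hx
    have hy' := spanLT_mono h hy
    rw [show (⟨x + y, hw'⟩ : spanLT lam) = ⟨x, hx'⟩ + ⟨y, hy'⟩ from rfl, map_add]
    exact Submodule.add_mem _ (ihx hx') (ihy hy')
  | smul a x hx ih =>
    have hx' := spanLT_mono h hx
    rw [show (⟨a • x, hw'⟩ : spanLT lam) = a • ⟨x, hx'⟩ from rfl, map_smul]
    exact Submodule.smul_mem _ _ (ih hx')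

/-- The restriction of `H_t` to the span of the Schur states up to `λ`. -/
def hop (lam : n.Partition) : spanLE lam →ₗ[ℂ] spanLT lam := Ht.restrict (Ht_mem_spanLT lam)

/-- The operator `(E_λ - H_0^β)⁻¹ H_t`. -/
def kernelOp {b : ℝ} (hb : 0 < b) (lam : n.Partition) : Module.End ℂ (spanLE lam) :=
  Submodule.inclusion (spanLT_le_spanLE lam) ∘ₗ (gapEquiv hb lam).symm.toLinearMap ∘ₗ hop lam

theorem kernelOp_apply {b : ℝ} (hb : 0 < b) (lam : n.Partition) (v : spanLE lam) :
    (kernelOp hb lam v : Fock) = (gapEquiv hb lam).symm (hop lam v) := rfl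

theorem wellFounded_dominanceLT : WellFounded (DominanceLT : n.Partition → n.Partition → Prop) := by
  have : IsTrans n.Partition DominanceLT := ⟨fun _ _ _ => DominanceLT.trans⟩
  have : Std.Irrefl (DominanceLT : n.Partition → n.Partition → Prop) := ⟨not_dominanceLT_self⟩
  exact Finite.wellFounded_of_trans_of_irrefl _

/-- The kernel maps each Schur state into the span strictly below it. So `s = (1 - a K) s + a K s`,
with the second term in the range by well-founded induction on dominance. -/
theorem resolvent_surjective {b : ℝ} (hb : 0 < b) (lam : n.Partition) (a : ℂ) :
    Function.Surjective (1 - a • kernelOp hb lam : Module.End ℂ (spanLE lam)) := by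
  set X := LinearMap.range (1 - a • kernelOp hb lam : Module.End ℂ (spanLE lam)) with hX
  have key : ∀ mu (h : mu = lam ∨ DominanceLT mu lam),
      (⟨schurState mu, Submodule.subset_span ⟨mu, h, rfl⟩⟩ : spanLE lam) ∈ X := by
    intro mu
    induction mu using wellFounded_dominanceLT.induction with
    | _ mu ih =>
      intro h
      set s : spanLE lam := ⟨schurState mu, Submodule.subset_span ⟨mu, h, rfl⟩⟩ with hs
      have h1 : ∀ w (hw : w ∈ spanLT mu) (hw' : w ∈ spanLE lam), (⟨w, hw'⟩ : spanLE lam) ∈ X := by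
        intro w hw
        induction hw using Submodule.span_induction with
        | mem x hx =>
          intro hw'
          obtain ⟨nu, hnu, rfl⟩ := hx
          refine ih nu hnu (Or.inr ?_)
          rcases h with rfl | h
          · exact hnu
          · exact DominanceLT.trans hnu h
        | zero => exact fun _ => X.zero_mem
        | add x y hx hy ihx ihy =>
          exact fun _ => X.add_mem (ihx (spanLT_le_spanLE lam (spanLT_mono h hx)))
            (ihy (spanLT_le_spanLE lam (spanLT_mono h hy)))
        | smul c x hx ihx =>
          exact fun _ => X.smul_mem c (ihx (spanLT_le_spanLE lam (spanLT_mono h hx)))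
      have h2 : kernelOp hb lam s ∈ X := by
        refine h1 _ ?_ (kernelOp hb lam s).2
        rw [kernelOp_apply]
        exact gapEquiv_symm_mem hb h _ (Ht_schurState_mem mu) _
      have h3 : s = (1 - a • kernelOp hb lam : Module.End ℂ (spanLE lam)) s + a • kernelOp hb lam s := by
        rw [LinearMap.sub_apply, LinearMap.smul_apply, Module.End.one_apply, sub_add_cancel]
      rw [h3]
      exact X.add_mem ⟨s, rfl⟩ (X.smul_mem _ h2)
  rintro ⟨v, hv⟩
  have h : ∀ w (hw : w ∈ spanLE lam), (⟨w, hw⟩ : spanLE lam) ∈ X := by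
    intro w hw
    induction hw using Submodule.span_induction with
    | mem x hx =>
      obtain ⟨mu, h, rfl⟩ := hx
      exact key mu h
    | zero => exact X.zero_mem
    | add x y _ _ hx hy => exact X.add_mem hx hy
    | smul c x _ hx => exact X.smul_mem c hx
  exact h v hv

theorem exists_resolvent {b : ℝ} (hb : 0 < b) (lam : n.Partition) (a : ℂ) :
    ∃ R : Module.End ℂ (spanLE lam), (1 - a • kernelOp hb lam) * R = 1 ∧
      R * (1 - a • kernelOp hb lam) = 1 := by
  have hs := resolvent_surjective hb lam a
  set e := LinearEquiv.ofBijective (1 - a • kernelOp hb lam : Module.End ℂ (spanLE lam))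
    ⟨LinearMap.injective_iff_surjective.2 hs, hs⟩ with he
  refine ⟨e.symm.toLinearMap, LinearMap.ext fun v => e.apply_symm_apply v,
    LinearMap.ext fun v => e.symm_apply_apply v⟩

theorem eq_sum_lower {lam : n.Partition} {v : Fock} (hv : v ∈ spanLT lam) :
    v = ∑ mu ∈ lower lam, schurCoeff mu v • schurState mu := by
  induction hv using Submodule.span_induction with
  | mem x hx =>
    obtain ⟨mu, h, rfl⟩ := hx
    rw [Finset.sum_eq_single mu]
    · rw [schurCoeff_schurState, if_pos rfl, one_smul]
    · intro nu _ hnu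
      rw [schurCoeff_schurState, if_neg hnu.symm, zero_smul]
    · exact fun h' => absurd (mem_lower.2 h) h'
  | zero => simp
  | add x y _ _ hx hy =>
    conv_lhs => rw [hx, hy]
    simp only [map_add, add_smul, Finset.sum_add_distrib]
  | smul c x _ hx =>
    conv_lhs => rw [hx]
    simp only [map_smul, smul_eq_mul, mul_smul, Finset.smul_sum]

/-- Multiplying the fixed-point equation by `E_λ - H0β`, which kills the Schur state of `lam`, gives
`(E_λ - H0β) Q = (1 - b²) Ht Q`. This is the eigenvalue equation. -/
theorem eigen_of_resolvent {b : ℝ} (hb : 0 < b) (lam : n.Partition) {Q : spanLE lam}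
    (h : (1 - (1 - (b : ℂ) ^ 2) • kernelOp hb lam : Module.End ℂ (spanLE lam)) Q = schurVec lam) :
    (Q : Fock) - schurState lam ∈ spanLT lam ∧ H b Q = energy b lam • (Q : Fock) := by
  have h1 : (Q : Fock) - schurState lam =
      (1 - (b : ℂ) ^ 2) • ((gapEquiv hb lam).symm (hop lam Q) : Fock) := by
    have := congrArg Subtype.val h
    rw [LinearMap.sub_apply, LinearMap.smul_apply, Module.End.one_apply] at this
    rw [← kernelOp_apply, sub_eq_iff_eq_add', ← sub_eq_iff_eq_add]
    exact this
  refine ⟨h1 ▸ Submodule.smul_mem _ _ (Subtype.mem _), ?_⟩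
  have h2 : energy b lam • ((gapEquiv hb lam).symm (hop lam Q) : Fock) -
      H0β b ((gapEquiv hb lam).symm (hop lam Q) : Fock) = Ht Q := by
    rw [← gap_apply, ← gapEquiv_apply hb, LinearEquiv.apply_symm_apply]
    rfl
  have h3 : energy b lam • ((Q : Fock) - schurState lam) - H0β b ((Q : Fock) - schurState lam) =
      (1 - (b : ℂ) ^ 2) • Ht Q := by
    rw [h1, map_smul, smul_comm, ← smul_sub, h2]
  rw [map_sub, H0β_schurState, smul_sub, sub_sub_sub_cancel_right] at h3
  rw [H_apply b (spanLE_le_graded lam Q.2), ← h3]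
  abel

/-- The converse, responsible for uniqueness: an eigenvector with leading term `lam` satisfies the
fixed-point equation, whose solution is unique. -/
theorem resolvent_of_eigen {b : ℝ} (hb : 0 < b) (lam : n.Partition) {Q : spanLE lam}
    (h : (Q : Fock) - schurState lam ∈ spanLT lam) (hQ : H b Q = energy b lam • (Q : Fock)) :
    (1 - (1 - (b : ℂ) ^ 2) • kernelOp hb lam : Module.End ℂ (spanLE lam)) Q = schurVec lam := by
  have h1 : gap b lam ⟨_, h⟩ = (1 - (b : ℂ) ^ 2) • hop lam Q := by
    ext1
    rw [gap_apply]
    change energy b lam • ((Q : Fock) - schurState lam) - H0β b ((Q : Fock) - schurState lam) =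
      (1 - (b : ℂ) ^ 2) • Ht Q
    rw [map_sub, H0β_schurState, smul_sub, sub_sub_sub_cancel_right, ← hQ,
      H_apply b (spanLE_le_graded lam Q.2), add_sub_cancel_left]
  have h2 : (⟨_, h⟩ : spanLT lam) = (1 - (b : ℂ) ^ 2) • (gapEquiv hb lam).symm (hop lam Q) := by
    rw [← map_smul, ← h1, ← gapEquiv_apply hb, LinearEquiv.symm_apply_apply]
  have h3 := congrArg Subtype.val h2
  ext1
  change (Q : Fock) - (1 - (b : ℂ) ^ 2) • (kernelOp hb lam Q : Fock) = schurState lam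
  rw [kernelOp_apply, sub_eq_iff_eq_add, ← sub_eq_iff_eq_add']
  exact h3

end

/-! ### From Schur triangularity to monomial triangularity. -/

section

variable {n N : ℕ}

/-! ### Monomial symmetric polynomials -/

theorem parts_ofSym (s : Sym (Fin N) n) {γ : Fin N →₀ ℕ} (h : Multiset.toFinsupp s.1 = γ) :
    (Nat.Partition.ofSym s).parts = (Finset.univ.val.map γ).filter (· ≠ 0) := by
  have h1 : ∀ i, s.1.count i = γ i := fun i => by rw [← h, Multiset.toFinsupp_apply]
  have h2 : s.1.dedup = (Finset.univ.val : Multiset (Fin N)).filter fun i => γ i ≠ 0 := by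
    refine (Multiset.Nodup.ext s.1.nodup_dedup (Finset.univ.nodup.filter _)).2 fun i => ?_
    rw [Multiset.mem_dedup, Multiset.mem_filter, ← h1, Multiset.count_ne_zero]
    simp
  change s.1.dedup.map s.1.count = _
  rw [h2, Multiset.map_congr rfl fun i _ => h1 i, Multiset.filter_map]
  rfl

theorem sum_filter_ne_zero (s : Multiset ℕ) : (s.filter (· ≠ 0)).sum = s.sum := by
  induction s using Multiset.induction_on with
  | empty => rfl
  | cons a s ih =>
    rw [Multiset.filter_cons, Multiset.sum_add, ih, Multiset.sum_cons]
    by_cases ha : a = 0 <;> simp [ha]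

/-- A monomial determines the multiset of its variables, so it occurs in the defining sum at most
once. -/
theorem coeff_msymm (nu : n.Partition) (γ : Fin N →₀ ℕ) : coeff γ (msymm (Fin N) ℂ nu) =
    if nu.parts = (Finset.univ.val.map γ).filter (· ≠ 0) then 1 else 0 := by
  have h0 : ∀ s : Multiset (Fin N), (s.map (X : Fin N → MvPolynomial (Fin N) ℂ)).prod =
      monomial (Multiset.toFinsupp s) 1 := by
    intro s
    induction s using Multiset.induction_on with
    | empty => rw [Multiset.map_zero, Multiset.prod_zero, map_zero]; rfl
    | cons a s ih =>
      rw [Multiset.map_cons, Multiset.prod_cons, ih, ← Multiset.singleton_add, map_add,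
        Multiset.toFinsupp_singleton, X, monomial_mul, mul_one]
  rw [msymm, coeff_sum]
  simp only [h0, coeff_monomial]
  by_cases h : nu.parts = (Finset.univ.val.map γ).filter (· ≠ 0)
  · rw [if_pos h]
    have hc : (Finsupp.toMultiset γ).card = n := by
      rw [Finsupp.card_toMultiset, ← nu.parts_sum, h, Finsupp.sum_fintype _ _ fun _ => rfl]
      rw [sum_filter_ne_zero]
      rfl
    have hf : Multiset.toFinsupp (Finsupp.toMultiset γ) = γ := Finsupp.toMultiset_toFinsupp γ
    have hp : Nat.Partition.ofSym (⟨Finsupp.toMultiset γ, hc⟩ : Sym (Fin N) n) = nu :=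
      Nat.Partition.ext (by rw [h]; exact parts_ofSym _ hf)
    rw [Finset.sum_eq_single ⟨⟨Finsupp.toMultiset γ, hc⟩, hp⟩]
    · exact if_pos hf
    · intro s _ hs
      refine if_neg fun h' => hs ?_
      refine Subtype.ext (Subtype.ext ?_)
      exact (Multiset.toFinsupp_toMultiset _).symm.trans (congrArg Finsupp.toMultiset h')
    · simp
  · rw [if_neg h]
    refine Finset.sum_eq_zero fun s _ => if_neg fun h' => h ?_
    rw [← s.2, parts_ofSym _ h']

theorem exists_partition_of_exponents (γ : Fin N →₀ ℕ) (h : ∑ i, γ i = n) :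
    ∃ (nu : n.Partition) (e : Equiv.Perm (Fin N)), row nu N = 0 ∧
      (∀ i : Fin N, row nu i = γ (e i)) ∧
        nu.parts = (Finset.univ.val.map γ).filter (· ≠ 0) := by
  obtain ⟨e, he⟩ := exists_antitone_mapDomain γ
  let ρ : ℕ → ℕ := fun i => if h : i < N then γ (e.symm ⟨i, h⟩) else 0
  have hρi : ∀ i : Fin N, ρ i = γ (e.symm i) := fun i => dif_pos i.2
  have hN : ρ N = 0 := dif_neg (lt_irrefl N)
  have hρ : Antitone ρ := by
    intro i j hij
    simp only [ρ]
    by_cases hj : j < N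
    · rw [dif_pos hj, dif_pos (hij.trans_lt hj)]
      have : (⟨i, hij.trans_lt hj⟩ : Fin N) ≤ ⟨j, hj⟩ := hij
      have := he this
      rwa [Finsupp.mapDomain_equiv_apply, Finsupp.mapDomain_equiv_apply] at this
    · rw [dif_neg hj]
      exact Nat.zero_le _
  have hs : ∑ i ∈ Finset.range N, ρ i = n := by
    rw [Finset.sum_range, ← h]
    exact (Finset.sum_congr rfl fun i _ => hρi i).trans (Equiv.sum_comp e.symm γ)
  obtain ⟨nu, h1, h2⟩ := exists_partition_row_eq hρ hN hs
  refine ⟨nu, e.symm, h1 ▸ hN, fun i => h1 ▸ hρi i, ?_⟩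
  rw [h2]
  congr 1
  have h3 : Multiset.map ρ (Finset.range N).val =
      Multiset.map (fun i : Fin N => ρ i) (Finset.univ : Finset (Fin N)).val := by
    have : (Finset.range N).val =
        Multiset.map (fun i : Fin N => (i : ℕ)) (Finset.univ : Finset (Fin N)).val := by
      rw [← Nat.Iio_eq_range, ← Fin.map_valEmbedding_univ]
      rfl
    rw [this, Multiset.map_map]
    rfl
  rw [h3, Multiset.map_congr rfl fun i _ => hρi i]
  have h4 : (Finset.univ : Finset (Fin N)).val.map e.symm = Finset.univ.val := by
    have := congrArg Finset.val (Finset.map_univ_equiv e.symm)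
    exact this
  conv_rhs => rw [← h4, Multiset.map_map]
  rfl

/-! ### Triangularity in monomial symmetric polynomials -/

/-- The exponents given by the parts of a partition. -/
def rowExponents (N : ℕ) (nu : n.Partition) : Fin N →₀ ℕ :=
  Finsupp.equivFunOnFinite.symm fun i => row nu i

theorem coeff_mapDomain {Q : MvPolynomial (Fin N) ℂ}
    (hQ : ∀ e : Equiv.Perm (Fin N), rename e Q = Q) (e : Equiv.Perm (Fin N)) (γ : Fin N →₀ ℕ) :
    coeff (γ.mapDomain e) Q = coeff γ Q := by
  conv_lhs => rw [← hQ e]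
  exact coeff_rename_mapDomain e e.injective Q γ

theorem coeff_eq_coeff_rowExponents {Q : MvPolynomial (Fin N) ℂ}
    (hQ : ∀ e : Equiv.Perm (Fin N), rename e Q = Q) {γ : Fin N →₀ ℕ} {nu : n.Partition}
    {e : Equiv.Perm (Fin N)} (h : ∀ i : Fin N, row nu i = γ (e i)) :
    coeff γ Q = coeff (rowExponents N nu) Q := by
  rw [← coeff_mapDomain hQ e.symm γ]
  congr 1
  ext i
  rw [Finsupp.mapDomain_equiv_apply, Equiv.symm_symm, ← h]
  rfl

theorem sum_eq_of_coeff_ne_zero {Q : MvPolynomial (Fin N) ℂ}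
    (hθ : ∑ i, theta i Q = (n : ℂ) • Q) {γ : Fin N →₀ ℕ} (h : coeff γ Q ≠ 0) :
    ∑ i, γ i = n := by
  have h1 := congrArg (coeff γ) hθ
  rw [coeff_sum, coeff_smul, smul_eq_mul] at h1
  simp only [coeff_theta, ← Finset.sum_mul] at h1
  exact_mod_cast mul_right_cancel₀ h h1

/-- Rearranging `nu'` cannot increase its prefix sums beyond those of the sorted order. The
staircase minus its permutation has nonnegative prefix sums `D J`, which all vanish only for the
identity. -/
theorem dominanceLT_of_shift {nu nu' : n.Partition} (hnu : row nu N = 0) (hnu' : row nu' N = 0)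
    {σ e : Equiv.Perm (Fin N)} (hσ : σ ≠ 1)
    (h : ∀ i : Fin N, row nu' (e.symm i) + (N - 1 - (σ.symm i : ℕ)) =
      row nu i + (N - 1 - (i : ℕ))) : DominanceLT nu nu' := by
  have hanti : ∀ J : ℕ, Antitone fun k : Fin N => if (k : ℕ) < J then (1 : ℤ) else 0 := by
    intro J k l hkl
    have : (k : ℕ) ≤ l := hkl
    beta_reduce
    split_ifs <;> omega
  have h1 : ∀ J, ∑ k : Fin N, (if (k : ℕ) < J then (1 : ℤ) else 0) * row nu' (e.symm k) ≤
      ∑ k ∈ Finset.range J, (row nu' k : ℤ) := by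
    intro J
    have hm : Monovary (fun k : Fin N => if (k : ℕ) < J then (1 : ℤ) else 0)
        fun k => (row nu' k : ℤ) := (hanti J).monovary fun k l hkl => by
      exact_mod_cast row_antitone nu' hkl
    refine (hm.sum_mul_comp_perm_le_sum_mul (σ := e.symm)).trans_eq ?_
    rw [← sum_fin_row nu' hnu']
    exact Finset.sum_congr rfl fun k _ => by simp
  set D : ℕ → ℤ := fun J => ∑ k : Fin N, (if (k : ℕ) < J then (1 : ℤ) else 0) *
    (((N - 1 - (k : ℕ) : ℕ) : ℤ) - ((N - 1 - (σ.symm k : ℕ) : ℕ) : ℤ)) with hD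
  have h2 : ∀ J, 0 ≤ D J := by
    intro J
    have hm : Monovary (fun k : Fin N => if (k : ℕ) < J then (1 : ℤ) else 0)
        fun k => ((N - 1 - (k : ℕ) : ℕ) : ℤ) := (hanti J).monovary fun k l hkl => by
      have : (k : ℕ) ≤ l := hkl
      omega
    have := hm.sum_mul_comp_perm_le_sum_mul (σ := σ.symm)
    simp only [hD, mul_sub, Finset.sum_sub_distrib]
    exact sub_nonneg.2 this
  have h3 : ∀ J, ∑ k ∈ Finset.range J, (row nu k : ℤ) + D J ≤
      ∑ k ∈ Finset.range J, (row nu' k : ℤ) := by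
    intro J
    refine le_of_eq_of_le ?_ (h1 J)
    rw [← sum_fin_row nu hnu, ← Finset.sum_add_distrib]
    refine Finset.sum_congr rfl fun k _ => ?_
    have := h k
    split_ifs
    · omega
    · simp
  constructor
  · rintro rfl
    refine hσ ?_
    have h4 : ∀ J, D J = 0 := fun J => le_antisymm (by have := h3 J; linarith) (h2 J)
    have h5 : ∀ i : Fin N, σ.symm i = i := by
      intro i
      have h6 : D (i + 1) - D i =
          ((N - 1 - (i : ℕ) : ℕ) : ℤ) - ((N - 1 - (σ.symm i : ℕ) : ℕ) : ℤ) := by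
        simp only [hD, ← Finset.sum_sub_distrib, ← sub_mul]
        rw [Finset.sum_eq_single i]
        · rw [if_pos (Nat.lt_succ_self _), if_neg (lt_irrefl _)]
          ring
        · intro k _ hk
          have : (k : ℕ) ≠ i := fun h => hk (Fin.ext h)
          have h7 : ((k : ℕ) < i + 1) = ((k : ℕ) < i) := by
            rw [eq_iff_iff]
            omega
          simp only [h7, sub_self, zero_mul]
        · simp
      rw [h4, h4] at h6
      have := (σ.symm i).2
      have := i.2
      ext
      omega
    ext i
    have := h5 (σ i)
    rw [Equiv.symm_apply_apply] at this
    rw [Equiv.Perm.one_apply, ← this]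
  · intro J
    have := h3 J
    have := h2 J
    zify
    linarith

theorem coeff_exponents_alternant {nu : n.Partition} (hnu : row nu N = 0) (mu : n.Partition) :
    coeff (exponents N nu) (alternant N (row mu)) = if mu = nu then 1 else 0 := by
  by_cases h : row mu N = 0
  · exact coeff_alternant_exponents hnu h
  · rw [alternant, if_neg h, coeff_zero, if_neg]
    rintro rfl
    exact h hnu

/-- Downward induction in dominance. The coefficient of `Q * delta` at `nu` plus the staircase is
the coefficient of `Q` at `nu`, plus contributions of rearrangements of strictly larger partitions.
If `nu` is not below `lam`, those partitions are neither `lam` nor below it, so they contribute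
nothing. -/
theorem coeff_rowExponents {lam : n.Partition} {c : n.Partition → ℂ} {Q : MvPolynomial (Fin N) ℂ}
    (hsymm : ∀ e : Equiv.Perm (Fin N), rename e Q = Q) (hθ : ∑ i, theta i Q = (n : ℂ) • Q)
    (hQ : Q * delta N = alternant N (row lam) +
      ∑ mu ∈ lower lam, c mu • alternant N (row mu)) (nu : n.Partition) (hnu : row nu N = 0)
    (hlt : ¬DominanceLT nu lam) : coeff (rowExponents N nu) Q = if lam = nu then 1 else 0 := by
  have hwf : WellFounded fun mu nu : n.Partition => DominanceLT nu mu := by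
    have : IsTrans n.Partition fun mu nu => DominanceLT nu mu :=
      ⟨fun _ _ _ h1 h2 => DominanceLT.trans h2 h1⟩
    have : Std.Irrefl fun mu nu : n.Partition => DominanceLT nu mu := ⟨not_dominanceLT_self⟩
    exact Finite.wellFounded_of_trans_of_irrefl _
  induction nu using hwf.induction with
  | _ nu ih =>
    have h1 : coeff (exponents N nu) (Q * delta N) = if lam = nu then 1 else 0 := by
      rw [hQ, coeff_add, coeff_exponents_alternant hnu, coeff_sum, Finset.sum_eq_zero, add_zero]
      intro mu hmu
      rw [coeff_smul, coeff_exponents_alternant hnu, if_neg, smul_zero]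
      rintro rfl
      exact hlt (mem_lower.1 hmu)
    -- The identity permutation contributes the wanted coefficient; all other terms of the
    -- Vandermonde determinant have to be shown to vanish.
    rw [← h1, delta, alternant_eq_sum rfl, Finset.mul_sum, coeff_sum, Finset.sum_eq_single 1]
    · rw [coeff_mul_monomial', if_pos]
      · simp only [Equiv.Perm.sign_one, Units.val_one, Int.cast_one, mul_one]
        congr 1
        ext i
        simp [exponents, rowExponents, ← Equiv.Perm.inv_def]
      · intro i
        simp [exponents, ← Equiv.Perm.inv_def]
    · intro σ _ hσ
      rw [coeff_mul_monomial']
      split_ifs with hle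
      · refine mul_eq_zero_of_left ?_ _
        set s : Fin N →₀ ℕ := Finsupp.equivFunOnFinite.symm
          fun i : Fin N => 0 + (N - 1 - (σ.symm i : ℕ)) with hs
        by_contra hne
        obtain ⟨nu', e, hnu', hrow, -⟩ := exists_partition_of_exponents _
          (sum_eq_of_coeff_ne_zero hθ hne)
        have hdom : DominanceLT nu nu' := by
          refine dominanceLT_of_shift hnu hnu' hσ (e := e) fun i => ?_
          rw [hrow, Equiv.apply_symm_apply, Finsupp.tsub_apply, exponents_apply]
          have := hle i
          rw [exponents_apply] at this
          have h2 : s i = N - 1 - (σ.symm i : ℕ) := by simp [hs]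
          omega
        rw [coeff_eq_coeff_rowExponents hsymm hrow,
          ih nu' hdom hnu' fun h => hlt (hdom.trans h)] at hne
        by_cases h2 : lam = nu'
        · rw [h2] at hlt
          exact hlt hdom
        · exact hne (if_neg h2)
      · rfl
    · simp

theorem eq_msymm_add_sum {lam : n.Partition} {c : n.Partition → ℂ} {Q : MvPolynomial (Fin N) ℂ}
    (hsymm : ∀ e : Equiv.Perm (Fin N), rename e Q = Q) (hθ : ∑ i, theta i Q = (n : ℂ) • Q)
    (hQ : Q * delta N = alternant N (row lam) +
      ∑ mu ∈ lower lam, c mu • alternant N (row mu)) :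
    Q = msymm (Fin N) ℂ lam +
      ∑ mu ∈ lower lam, coeff (rowExponents N mu) Q • msymm (Fin N) ℂ mu := by
  ext γ
  rw [coeff_add, coeff_sum]
  simp only [coeff_smul, coeff_msymm, smul_eq_mul]
  by_cases h : ∑ i, γ i = n
  · obtain ⟨nu, e, hnu, hrow, hparts⟩ := exists_partition_of_exponents γ h
    have h1 : ∀ mu : n.Partition,
        mu.parts = (Finset.univ.val.map γ).filter (· ≠ 0) ↔ mu = nu := by
      intro mu
      rw [← hparts, Nat.Partition.ext_iff]
    simp only [h1, mul_ite, mul_one, mul_zero]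
    rw [coeff_eq_coeff_rowExponents hsymm hrow, Finset.sum_ite_eq' (lower lam) nu]
    by_cases hlt : DominanceLT nu lam
    · rw [if_pos (mem_lower.2 hlt), if_neg, zero_add]
      rintro rfl
      exact not_dominanceLT_self _ hlt
    · rw [if_neg (mt mem_lower.1 hlt), add_zero, coeff_rowExponents hsymm hθ hQ nu hnu hlt]
  · have h1 : ∀ mu : n.Partition, mu.parts ≠ (Finset.univ.val.map γ).filter (· ≠ 0) := by
      intro mu hmu
      refine h ?_
      rw [← mu.parts_sum, hmu]
      exact (sum_filter_ne_zero _).symm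
    simp only [h1, if_false, mul_zero, Finset.sum_const_zero, add_zero]
    by_contra hne
    exact h (sum_eq_of_coeff_ne_zero hθ hne)

end

section

variable {n N : ℕ}

/-! ### Jack states -/

theorem schurState_ne_zero (lam : n.Partition) : schurState lam ≠ 0 := fun h => by
  have := schurCoeff_schurState lam lam
  rw [h, map_zero, if_pos rfl] at this
  exact zero_ne_one this

theorem ne_zero_of_sub_mem_spanLT {lam : n.Partition} {v : Fock}
    (h : v - schurState lam ∈ spanLT lam) : v ≠ 0 := by
  rintro rfl
  have h1 : schurCoeff lam (0 - schurState lam) = 0 := by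
    rw [eq_sum_lower h, map_sum]
    refine Finset.sum_eq_zero fun mu hmu => ?_
    rw [map_smul, schurCoeff_schurState, if_neg (mem_lower.1 hmu).1, smul_zero]
  rw [zero_sub, map_neg, schurCoeff_schurState, if_pos rfl] at h1
  norm_num at h1

theorem powerSumEval_mul_delta {lam : n.Partition} {c : n.Partition → ℂ} {f : BosonFock}
    (h : bosonize f = schurState lam + ∑ mu ∈ lower lam, c mu • schurState mu) :
    powerSumEval N f * delta N = alternant N (row lam) +
      ∑ mu ∈ lower lam, c mu • alternant N (row mu) := by
  ext α
  rw [← correlator_sites_bosonize, h, map_add, map_sum, coeff_add, coeff_sum,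
    correlator_sites_schurState]
  simp only [map_smul, coeff_smul, correlator_sites_schurState]

theorem cubic_add_interaction_of_eigen {b : ℝ} {ε : ℂ} {f : BosonFock}
    (h : H b (bosonize f) = ε • bosonize f) :
    cubicUp f + cubicDown f + (1 - (b : ℂ) ^ 2) • interaction f = ε • f := by
  refine bosonize_injective ?_
  rw [map_add, map_smul, map_smul, ← Hint_bosonize, ← H0_bosonize, ← h]
  rfl

theorem hasEigenvector_bosonHamiltonian {b : ℝ} (hb : 0 < b) {ε : ℂ} {f : BosonFock}
    (hf : f ≠ 0) (h : cubicUp f + cubicDown f + (1 - (b : ℂ) ^ 2) • interaction f = ε • f) :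
    Module.End.HasEigenvector (bosonHamiltonian b) ε (similarity b f) := by
  refine ⟨Module.End.mem_eigenspace_iff.2 ?_, fun h0 => hf ?_⟩
  · rw [bosonHamiltonian_similarity hb, h, map_smul]
  · rw [← similarity_similarity_inv hb f, h0, map_zero]

/-- The eigenvalue equation gives `quadratic + cubicDown` as `ε` plus `b²` times `interaction`. The
drift contributes `b²` times `N * n - interaction`, so the interaction cancels and the eigenvalue is
shifted by `b² * N * n`. -/
theorem satisfiesCS_powerSumEval {b : ℝ} {ε : ℂ} {f : BosonFock}
    (h : cubicUp f + cubicDown f + (1 - (b : ℂ) ^ 2) • interaction f = ε • f)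
    (hθ : ∑ i, theta i (powerSumEval N f) = (n : ℂ) • powerSumEval N f) :
    SatisfiesCS ((b : ℂ) ^ 2) (ε + (b : ℂ) ^ 2 * N * n) (powerSumEval N f) := by
  refine (satisfiesCS_iff _ _ _).2 fun z hz => ?_
  have h1 : quadratic f + cubicDown f = ε • f + (b : ℂ) ^ 2 • interaction f := by
    rw [← h, interaction, LinearMap.sub_apply]
    module
  rw [interactionAt_powerSumEval hz, hθ, laplacian_powerSumEval, h1, map_add, map_smul, map_smul]
  simp only [smul_eq_C_mul, map_add, map_sub, map_mul, eval_C, map_natCast]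
  ring

end

end CalogeroSutherland

end

/-! ### Assembly of the theorem. -/

open CalogeroSutherland in
theorem mainTheorem5 (b : ℝ) (hb : 0 < b) {n : ℕ} (lam : n.Partition) :
    -- the Schur states are eigenvectors of the free part and of its diagonal deformation
    Module.End.HasEigenvector CalogeroSutherland.H0
      (CalogeroSutherland.freeEnergy lam) (CalogeroSutherland.schurState lam) ∧
    Module.End.HasEigenvector (CalogeroSutherland.H0β b)
      (CalogeroSutherland.energy b lam) (CalogeroSutherland.schurState lam) ∧
    -- `A` is `E_λ - H_0^β` on the span of the Schur states below `λ`, `T` is `H_t`,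
    -- `K` is `(E_λ - H_0^β)⁻¹ H_t`, and `R` is the resolvent `(1 - (1 - b²) (E_λ - H_0^β)⁻¹ H_t)⁻¹`
    ∃ (A : CalogeroSutherland.spanLT lam ≃ₗ[ℂ] CalogeroSutherland.spanLT lam)
      (T : CalogeroSutherland.spanLE lam →ₗ[ℂ] CalogeroSutherland.spanLT lam)
      (K R : Module.End ℂ (CalogeroSutherland.spanLE lam))
      (c : n.Partition → ℂ) (P : CalogeroSutherland.Fock),
      (∀ v, (A v : CalogeroSutherland.Fock) =
        CalogeroSutherland.energy b lam • (v : CalogeroSutherland.Fock) -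
          CalogeroSutherland.H0β b v) ∧
      (∀ v, (T v : CalogeroSutherland.Fock) = CalogeroSutherland.Ht v) ∧
      (∀ v, (K v : CalogeroSutherland.Fock) = A.symm (T v)) ∧
      (1 - (1 - (b : ℂ) ^ 2) • K) * R = 1 ∧
      R * (1 - (1 - (b : ℂ) ^ 2) • K) = 1 ∧
      P = (R (CalogeroSutherland.schurVec lam) : CalogeroSutherland.Fock) ∧
      -- triangular form, eigenvalue, uniqueness
      P = CalogeroSutherland.schurState lam +
        ∑ mu ∈ CalogeroSutherland.lower lam, c mu • CalogeroSutherland.schurState mu ∧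
      Module.End.HasEigenvector (CalogeroSutherland.H b) (CalogeroSutherland.energy b lam) P ∧
      (∀ Q : CalogeroSutherland.Fock,
        Q - CalogeroSutherland.schurState lam ∈ CalogeroSutherland.spanLT lam →
        CalogeroSutherland.H b Q = CalogeroSutherland.energy b lam • Q → Q = P) ∧
      -- the similarity transformation leads to the Jack polynomials
      ∃ f : CalogeroSutherland.BosonFock,
        CalogeroSutherland.bosonize f = P ∧
        Module.End.HasEigenvector (CalogeroSutherland.bosonHamiltonian b)
          (CalogeroSutherland.energy b lam) (CalogeroSutherland.similarity b f) ∧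
        ∀ N : ℕ,
          CalogeroSutherland.IsJack ((b : ℂ) ^ 2) lam
            (CalogeroSutherland.waveFunction b N (CalogeroSutherland.similarity b f)) ∧
          CalogeroSutherland.SatisfiesCS ((b : ℂ) ^ 2)
            (CalogeroSutherland.energy b lam + (b : ℂ) ^ 2 * N * n)
            (CalogeroSutherland.waveFunction b N (CalogeroSutherland.similarity b f)) ∧
          CalogeroSutherland.waveFunction b N (CalogeroSutherland.similarity b f) *
              CalogeroSutherland.alternant N (fun _ => 0) =
            CalogeroSutherland.alternant N (CalogeroSutherland.row lam) +
              ∑ mu ∈ CalogeroSutherland.lower lam,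
                c mu • CalogeroSutherland.alternant N (CalogeroSutherland.row mu) := by
  have hR := exists_resolvent hb lam (1 - (b : ℂ) ^ 2)
  obtain ⟨R, hR1, hR2⟩ := hR
  have hP : (1 - (1 - (b : ℂ) ^ 2) • kernelOp hb lam : Module.End ℂ (spanLE lam))
      (R (schurVec lam)) = schurVec lam := LinearMap.congr_fun hR1 (schurVec lam)
  obtain ⟨hlt, heig⟩ := eigen_of_resolvent hb lam hP
  have hne := ne_zero_of_sub_mem_spanLT hlt
  have htri := sub_eq_iff_eq_add'.1 (eq_sum_lower hlt)
  obtain ⟨f, hf, hθ⟩ := exists_bosonize_eq (spanLE_le_graded lam (R (schurVec lam)).2)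
  have hf0 : f ≠ 0 := by
    rintro rfl
    exact hne (by rw [← hf, map_zero])
  have hcubic := cubic_add_interaction_of_eigen (f := f) (by rw [hf]; exact heig)
  -- The coefficients and the vector are left to unification: the latter is the resolvent applied to
  -- the Schur state, the former are the values of `schurCoeff` supplied by `htri`.
  refine ⟨⟨Module.End.mem_eigenspace_iff.2 (H0_schurState lam), schurState_ne_zero lam⟩,
    ⟨Module.End.mem_eigenspace_iff.2 (H0β_schurState b lam), schurState_ne_zero lam⟩,
    gapEquiv hb lam, hop lam, kernelOp hb lam, R, _, _, fun v => gap_apply b lam v,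
    fun v => rfl, fun v => kernelOp_apply hb lam v, hR1, hR2, rfl, htri,
    ⟨Module.End.mem_eigenspace_iff.2 heig, hne⟩, fun Q hQ hQeig => ?_,
    f, hf, hasEigenvector_bosonHamiltonian hb hf0 hcubic, fun N => ?_⟩
  · have hmem : Q ∈ spanLE lam := by
      rw [← sub_add_cancel Q (schurState lam)]
      exact Submodule.add_mem _ (spanLT_le_spanLE lam hQ) (schurState_mem_spanLE lam)
    have h := resolvent_of_eigen hb lam (Q := ⟨Q, hmem⟩) hQ hQeig
    rw [← h]
    exact congrArg Subtype.val (LinearMap.congr_fun hR2 ⟨Q, hmem⟩).symm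
  · rw [waveFunction_similarity hb]
    have hQ := powerSumEval_mul_delta (N := N) (hf.trans htri)
    have hCS := satisfiesCS_powerSumEval hcubic (hθ N)
    exact ⟨⟨⟨_, eq_msymm_add_sum (fun e => rename_powerSumEval e f) (hθ N) hQ⟩, _, hCS⟩, hCS, hQ⟩
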